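/- Let $S$ be a finite set of places of $\mathbb{Q}$ with $\infty\in S$, and write $p\in S$ for the finite places in $S$. Let $\mathbb{A}_S=\prod_{v\in S}\mathbb{Q}_v$, $|x|=\prod_{v\in S}|x_v|_v$, $R_S=\prod_{p\in S}\mathbb{Z}_p$, let $\Gamma=\{\pm\prod_{p\in S}p^{n_p} : n_p\in\mathbb{Z}\}$ be diagonally embedded in $\mathbb{A}_S^*$, $\Gamma_+=\Gamma\cap\mathbb{Q}_{>0}$, $X_S=\mathbb{A}_S/\Gamma$, $C_S=\mathbb{A}_S^*/\Gamma$, and let $K_S$ be the kernel of the module $C_S\to\mathbb{R}_+^*$. The measure of $X_S$ is the image of the restriction of the Haar measure of $\mathbb{A}_S$ to the fundamental domain $R_S^*\times\mathbb{R}_+^*$, normalized so that $R_S^*\times[0,1]$ has measure $1$. The group $C_S$ acts unitarily on $L^2(X_S)$ by $\xi\mapsto |c|^{1/2}\xi(c\,\cdot)$, and $L^2(X_S)^{K_S}$ is the space of $K_S$-invariant vectors. On it, $\mathbb{S}$ is the selfadjoint generator of the archimedean scaling group, $(e^{it\mathbb{S}}\xi)(x)=e^{t/2}\xi(e^t x)$.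 Let $d^*u=du/u$. Let $w_S:L^2(X_S)^{K_S}\to L^2(\mathbb{R}_+^*,d^*u)$ be the unitary with $(w_S\xi)(|c|)=|c|^{1/2}\xi(c)$ for almost all $c\in C_S\subset X_S$, let $(w_\infty f)(u)=u^{1/2}f(u)$ for $f\in L^2(\mathbb{R})^{ev}$ (the even functions in $L^2(\mathbb{R})$), and let $\mathbb{F}_\mu:L^2(\mathbb{R}_+^*,d^*u)\to L^2(\mathbb{R})$ be the continuous extension of $g\mapsto\int_0^\infty g(u)u^{-is}d^*u$. For $f\in L^2(\mathbb{R})^{ev}$ let $\eta_S(f)\in L^2(X_S)^{K_S}$ be the class of $1_{R_S}\otimes f$, i.e. $\eta_S(f)(x)=\sum_{\gamma\in\Gamma_+}(1_{R_S}\otimes f)(\gamma x)$. Let $L_p(z)=(1-p^{-z})^{-1}$, $L_\infty(z)=\pi^{-z/2}\Gamma(z/2)$, $dm_S(s)=\big|\prod_{v\in S}L_v(\tfrac12-is)\big|^2ds$, $\mathcal{M}_S(h)(s)=\big(\prod_{v\in S}L_v(\tfrac12-is)\big)^{-1}h(s)$, $\mathcal{U}_S=\mathbb{F}_\mu\circ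 w_S$, $V_S=\mathcal{M}_S\circ\mathcal{U}_S$, $\xi_\infty(x)=2^{1/4}e^{-\pi x^2}$, $\xi_S=\eta_S(\xi_\infty)$. These maps are well defined and bounded, and the following hold. (i) For $f\in L^2(\mathbb{R})^{ev}$ and almost every $s\in\mathbb{R}$, $\ \mathbb{F}_\mu(w_S(\eta_S(f)))(s)=\Big(\prod_{p\in S\setminus\{\infty\}}L_p(\tfrac12-is)\Big)\,\mathbb{F}_\mu(w_\infty f)(s)$. (ii) For each $p\in S\setminus\{\infty\}$ let the Fourier transform of $\mathbb{Q}_p$ be taken with respect to a continuous additive character and the Haar measure with $\mathbb{Z}_p$ of measure $1$, such that $1_{\mathbb{Z}_p}$ is its own Fourier transform. On $\mathbb{R}$ let $\mathbb{F}_{e_{\mathbb{R}}}f(y)=\int f(x)e^{-2\pi ixy}dx$. Calling $\sum_{\gamma\in\Gamma}h(\gamma x)$ the class of a function $h$ on $\mathbb{A}_S$, there is a unique bounded operator $\mathbb{F}_S$ on $L^2(X_S)$ that sends the class of $\bigotimes_v\varphi_v$ to the class of $\bigotimes_v\widehat{\varphi_v}$ for all Schwartz functions $\varphi_\infty$ and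 all locally constant compactly supported $\varphi_p$. It is unitary, and $\mathbb{F}_S\circ\eta_S=\eta_S\circ\mathbb{F}_{e_{\mathbb{R}}}$ on $L^2(\mathbb{R})^{ev}$. (iii) $V_S:L^2(X_S)^{K_S}\to L^2(\mathbb{R},dm_S)$ is a linear bijection with $\|V_S\xi\|=\sqrt{2\pi}\,\|\xi\|$, and $V_S(\xi_S)$ is the constant $2^{-3/4}$. The vector $\xi_S$ is nonzero, and with $\hat\xi_S=\xi_S/\|\xi_S\|$ the pair $(\mathbb{S},\hat\xi_S)$ is a cyclic pair: $\mathbb{S}$ is selfadjoint in the infinite dimensional space $L^2(X_S)^{K_S}$, $\hat\xi_S$ is a unit vector in the domain of all powers of $\mathbb{S}$, and the vectors $\mathbb{S}^n\hat\xi_S$ span a dense subspace. Up to normalization $V_S$ gives its canonical form: $2^{3/4}\|\xi_S\|\,V_S$ is a unitary from $L^2(X_S)^{K_S}$ onto $L^2$ of the probability measure $m_S(\mathbb{R})^{-1}dm_S$, which transforms $\mathbb{S}$ (with its domain) into the multiplication by the variable $s$ and $\hat\xi_S$ into the constant function $1$. (iv) The cyclic pair $(\mathbb{S},\hat\xi_S)$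 is even, i.e. it has a $\mathbb{Z}/2\mathbb{Z}$-grading: an operator $\gamma$ with $\gamma=\gamma^*$, $\gamma^2=1$, $\gamma\mathbb{S}=-\mathbb{S}\gamma$, $\gamma\hat\xi_S=\hat\xi_S$. Every $\mathbb{F}_S$ as in (ii) preserves $L^2(X_S)^{K_S}$, its restriction is the unique $\mathbb{Z}/2\mathbb{Z}$-grading, and $V_S\circ\mathbb{F}_S\circ V_S^{-1}$ is the symmetry $h(s)\mapsto h(-s)$. -/

import Mathlib

open MeasureTheory Filter Topology
open scoped ENNReal FourierTransform

noncomputable section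
namespace Semilocal

instance factPrime (p : Nat.Primes) : Fact (p : ℕ).Prime := ⟨p.2⟩

instance padicMeasurableSpace (p : ℕ) [Fact p.Prime] : MeasurableSpace ℚ_[p] := borel _
instance padicBorelSpace (p : ℕ) [Fact p.Prime] : BorelSpace ℚ_[p] := ⟨rfl⟩

/-- The Haar measure of the additive group `ℚ_p` with `ℤ_p` of measure `1`. -/
def haarP (p : ℕ) [Fact p.Prime] : Measure ℚ_[p] :=
  Measure.addHaarMeasure
    ⟨⟨Metric.closedBall 0 1, isCompact_closedBall 0 1⟩,
      ⟨0, mem_interior_iff_mem_nhds.2 (Metric.closedBall_mem_nhds 0 one_pos)⟩⟩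

instance haarP_isAddHaar (p : ℕ) [Fact p.Prime] : (haarP p).IsAddHaarMeasure := by
  unfold haarP; infer_instance

theorem haarP_closedBall_one (p : ℕ) [Fact p.Prime] : haarP p (Metric.closedBall 0 1) = 1 :=
  Measure.addHaarMeasure_self

theorem haarP_ball_one (p : ℕ) [Fact p.Prime] :
    (p : ℝ≥0∞) * haarP p (Metric.ball 0 1) = 1 := by
  have hU : (⋃ i : Fin p, (fun x : ℚ_[p] => -(i : ℕ) + x) ⁻¹' Metric.ball 0 1)
      = Metric.closedBall 0 1 := by
    ext x
    simp only [Set.mem_iUnion, Set.mem_preimage, mem_ball_zero_iff, mem_closedBall_zero_iff]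
    constructor
    · rintro ⟨i, hi⟩
      have : x = (i : ℕ) + (-(i : ℕ) + x) := by ring
      rw [this]
      exact (Padic.nonarchimedean _ _).trans
        (max_le (by exact_mod_cast Padic.norm_int_le_one (p := p) (i : ℕ)) hi.le)
    · intro hx
      obtain ⟨z, rfl⟩ : ∃ z : ℤ_[p], (z : ℚ_[p]) = x := ⟨⟨x, hx⟩, rfl⟩
      obtain ⟨n, hn, hm⟩ := PadicInt.exists_mem_range (p := p) z
      rw [IsLocalRing.mem_maximalIdeal, PadicInt.mem_nonunits] at hm
      refine ⟨⟨n, hn⟩, ?_⟩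
      rw [neg_add_eq_sub]
      rw [PadicInt.norm_def] at hm
      rwa [PadicInt.coe_sub, PadicInt.coe_natCast] at hm
  have hd : Pairwise (Function.onFun Disjoint
      fun i : Fin p => (fun x : ℚ_[p] => -(i : ℕ) + x) ⁻¹' Metric.ball 0 1) := by
    intro i j hij
    rw [Function.onFun, Set.disjoint_left]
    intro x hi hj
    simp only [Set.mem_preimage, mem_ball_zero_iff] at hi hj
    apply hij
    have h1 : ‖(((i : ℕ) - (j : ℕ) : ℤ) : ℚ_[p])‖ < 1 := by
      have : (((i : ℕ) - (j : ℕ) : ℤ) : ℚ_[p]) = (-(j : ℕ) + x) - (-(i : ℕ) + x) := by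
        push_cast; ring
      rw [this, sub_eq_add_neg]
      refine (Padic.nonarchimedean _ _).trans_lt (max_lt hj (by rwa [norm_neg]))
    rw [Padic.norm_intCast_lt_one_iff] at h1
    have := Int.eq_zero_of_abs_lt_dvd h1 (by have := i.2; have := j.2; rw [abs_lt]; omega)
    ext; omega
  rw [← haarP_closedBall_one p, ← hU, measure_iUnion hd]
  · simp only [measure_preimage_add, tsum_fintype, Finset.sum_const, Finset.card_univ,
      Fintype.card_fin, nsmul_eq_mul]
  · exact fun i => (measurable_const_add _) Metric.isOpen_ball.measurableSet

theorem haarP_closedBall_zpow (p : ℕ) [hp : Fact p.Prime] (n : ℤ) :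
    haarP p {x | ‖x‖ ≤ (p : ℝ) ^ n} = (p : ℝ≥0∞) ^ n := by
  have hp0 : (p : ℚ_[p]) ≠ 0 := by exact_mod_cast hp.out.ne_zero
  have hpr : (0 : ℝ) < p := by exact_mod_cast hp.out.pos
  have hpe : (p : ℝ≥0∞) ≠ 0 := by exact_mod_cast hp.out.ne_zero
  have hpt : (p : ℝ≥0∞) ≠ ⊤ := ENNReal.natCast_ne_top p
  let e : ℚ_[p] ≃ₜ+ ℚ_[p] :=
    { Equiv.mulLeft₀ (p : ℚ_[p]) hp0 with
      map_add' := mul_add _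
      continuous_toFun := continuous_const_mul _
      continuous_invFun := continuous_const_mul _ }
  have he : ∀ x, e x = p * x := fun _ => rfl
  have key : ∀ s : Set ℚ_[p], haarP p (e ⁻¹' s) = p * haarP p s := by
    intro s
    have h := fun s : Set ℚ_[p] => addEquivAddHaarChar_smul_preimage (haarP p) (X := s) e
    have h1 := h (Metric.ball 0 1)
    have : e ⁻¹' (Metric.ball 0 1) = Metric.closedBall 0 1 := by
      ext x
      simp only [Set.mem_preimage, he, mem_ball_zero_iff, mem_closedBall_zero_iff, norm_mul,
        Padic.norm_p]
      have := Padic.norm_le_pow_iff_norm_lt_pow_add_one x 0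
      rw [zpow_zero, zero_add, zpow_one] at this
      rw [this, inv_mul_lt_iff₀ hpr, mul_one]
    rw [this, haarP_closedBall_one, ← haarP_ball_one p] at h1
    have hb0 : haarP p (Metric.ball 0 1) ≠ 0 := by
      intro h0; have := haarP_ball_one p; simp [h0] at this
    have hbt : haarP p (Metric.ball 0 1) ≠ ⊤ :=
      (Metric.isBounded_ball.measure_lt_top).ne
    rw [ENNReal.smul_def, smul_eq_mul, ← mul_assoc, ENNReal.mul_eq_right hb0 hbt] at h1
    have h2 := h s
    rw [ENNReal.smul_def, smul_eq_mul] at h2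
    rw [← h2, ← mul_assoc, mul_comm (p : ℝ≥0∞), h1, one_mul]
  have step : ∀ n : ℤ, haarP p {x | ‖x‖ ≤ (p : ℝ) ^ (n + 1)}
      = p * haarP p {x | ‖x‖ ≤ (p : ℝ) ^ n} := by
    intro n
    rw [← key]
    congr 1
    ext x
    simp only [Set.mem_ofPred_eq, Set.mem_preimage, he, norm_mul, Padic.norm_p]
    rw [inv_mul_le_iff₀ hpr, zpow_add₀ hpr.ne', zpow_one, mul_comm]
  have h0 : haarP p {x | ‖x‖ ≤ (p : ℝ) ^ (0 : ℤ)} = 1 := by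
    rw [← haarP_closedBall_one p]; congr 1; ext; simp
  induction n using Int.induction_on with
  | zero => rw [h0, zpow_zero]
  | succ i ih => rw [step, ih, ENNReal.zpow_add hpe hpt, zpow_one, mul_comm]
  | pred i ih =>
    have := step (-(i : ℤ) - 1)
    rw [sub_add_cancel, ih] at this
    rw [ENNReal.zpow_sub hpe hpt, this, zpow_one, mul_comm, ← mul_assoc,
      ENNReal.inv_mul_cancel hpe hpt, one_mul]

theorem haarP_mul_le_one (p : ℕ) [hp : Fact p.Prime] {a : ℚ_[p]} (ha : a ≠ 0) :
    haarP p {x | ‖a * x‖ ≤ 1} = ENNReal.ofReal ‖a‖⁻¹ := by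
  have hpr : (0 : ℝ) < p := by exact_mod_cast hp.out.pos
  obtain ⟨n, hn⟩ := Padic.padicNormE.image ha
  push_cast at hn
  have : {x : ℚ_[p] | ‖a * x‖ ≤ 1} = {x | ‖x‖ ≤ (p : ℝ) ^ n} := by
    ext x
    simp only [Set.mem_ofPred_eq, norm_mul, hn, zpow_neg]
    rw [inv_mul_le_iff₀ (zpow_pos hpr n), mul_one]
  rw [this, haarP_closedBall_zpow, hn, zpow_neg, inv_inv, ← ENNReal.ofReal_natCast]
  cases n with
  | ofNat n => simp [ENNReal.ofReal_pow hpr.le]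
  | negSucc n =>
    rw [zpow_negSucc, zpow_negSucc, ENNReal.ofReal_inv_of_pos (pow_pos hpr _),
      ENNReal.ofReal_pow hpr.le]


section Spaces

variable (S : Finset Nat.Primes)

/-- The semilocal adele ring `ℝ × ∏_{p ∈ S} ℚ_p`. The finite set of primes `S` stands for the finite set
of places `S ∪ {∞}`. -/
abbrev Adele : Type := ℝ × ((p : S) → ℚ_[(p : Nat.Primes)])

/-- The product of Lebesgue measure and the Haar measures of the `ℚ_p` with `ℤ_p` of measure `1`. -/
def haarA : Measure (Adele S) :=
  (volume : Measure ℝ).prod (Measure.pi fun p : S => haarP (p : Nat.Primes))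

instance haarA_isAddHaar : (haarA S).IsAddHaarMeasure := by
  unfold haarA; infer_instance

/-- The module `|x|_S = ∏_v |x_v|_v`. -/
def modA (x : Adele S) : ℝ := |x.1| * ∏ p : S, ‖x.2 p‖

/-- `Γ`, the units of the ring of rational numbers with denominators involving only primes in `S`:
the rational numbers `± ∏_{p ∈ S} p ^ n_p`. It acts on the adeles through the diagonal embedding. -/
def Gam : Subgroup ℚˣ where
  carrier := {q | ∀ p : Nat.Primes, p ∉ S → ‖((q : ℚ) : ℚ_[p])‖ = 1}
  one_mem' := fun p _ => by simp
  mul_mem' := fun {a b} ha hb p hp => by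
    have h1 := ha p hp
    have h2 := hb p hp
    simp [h1, h2]
  inv_mem' := fun {a} ha p hp => by
    have h1 := ha p hp
    simp [h1]

instance Gam_countable : Countable (Gam S) :=
  Function.Injective.countable (f := fun g : Gam S => ((g : ℚˣ) : ℚ))
    fun _ _ h => Subtype.ext (Units.ext h)

theorem Gam_smul_fst (g : Gam S) (x : Adele S) : (g • x).1 = ((g : ℚˣ) : ℚ) * x.1 :=
  Rat.smul_def _ _

theorem Gam_smul_snd (g : Gam S) (x : Adele S) (p : S) :
    (g • x).2 p = (((g : ℚˣ) : ℚ) : ℚ_[(p : Nat.Primes)]) * x.2 p :=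
  Rat.smul_def _ _


theorem den_eq_one_of_norm {q : ℚ} (h : ∀ p : Nat.Primes, ‖(q : ℚ_[p])‖ = 1) : q.den = 1 := by
  rw [Nat.eq_one_iff_not_exists_prime_dvd]
  intro p hp hd
  have := Fact.mk hp
  have h1 : ‖(q.num : ℚ_[p])‖ < 1 := by
    have h2 : (q.num : ℚ_[p]) = (q : ℚ_[p]) * (q.den : ℚ_[p]) := by
      have := Rat.mul_den_eq_num q
      exact_mod_cast congrArg (fun r : ℚ => (r : ℚ_[p])) this.symm
    rw [h2, norm_mul, show ‖(q : ℚ_[p])‖ = 1 from h ⟨p, hp⟩, one_mul]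
    exact Padic.norm_natCast_lt_one_iff.2 hd
  rw [Padic.norm_intCast_lt_one_iff] at h1
  have := Nat.dvd_gcd (Int.natCast_dvd.1 h1) hd
  rw [q.reduced.gcd_eq_one] at this
  exact hp.one_lt.ne' (Nat.dvd_one.1 this)

theorem abs_eq_one_of_norm {q : ℚ} (h : ∀ p : Nat.Primes, ‖(q : ℚ_[p])‖ = 1) : |q| = 1 := by
  have hq : q ≠ 0 := by
    rintro rfl
    simpa using h ⟨2, Nat.prime_two⟩
  have h1 := den_eq_one_of_norm h
  have h2 : q⁻¹.den = 1 := den_eq_one_of_norm fun p => by simp [h p]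
  have h3 : q.num * q⁻¹.num = 1 := by
    have e1 := Rat.coe_int_num_of_den_eq_one h1
    have e2 := Rat.coe_int_num_of_den_eq_one h2
    have : (q.num : ℚ) * (q⁻¹.num : ℚ) = 1 := by rw [e1, e2, mul_inv_cancel₀ hq]
    exact_mod_cast this
  rw [← Rat.coe_int_num_of_den_eq_one h1]
  rcases Int.eq_one_or_neg_one_of_mul_eq_one h3 with h | h <;> rw [h] <;> simp

/-- The positive element `∏ p ^ (n p)` of `Γ`. -/
def primeProd (n : S → ℤ) : ℚˣ :=
  ∏ p : S, (Units.mk0 ((p : Nat.Primes) : ℚ) (by exact_mod_cast p.1.2.ne_zero)) ^ n p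

theorem primeProd_val (n : S → ℤ) :
    (primeProd S n : ℚ) = ∏ p : S, (((p : Nat.Primes) : ℕ) : ℚ) ^ n p := by
  simp [primeProd, Units.coe_prod]

theorem norm_prime (p q : Nat.Primes) :
    ‖((p : ℕ) : ℚ_[q])‖ = if p = q then ((q : ℕ) : ℝ)⁻¹ else 1 := by
  split_ifs with h
  · subst h; exact Padic.norm_p
  · rw [Padic.norm_natCast_eq_one_iff]
    exact (Nat.coprime_primes q.2 p.2).2 fun h' => h (Subtype.ext h'.symm)

theorem norm_primeProd (n : S → ℤ) (q : Nat.Primes) :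
    ‖((primeProd S n : ℚ) : ℚ_[q])‖
      = ∏ p : S, (if (p : Nat.Primes) = q then ((q : ℕ) : ℝ)⁻¹ else 1) ^ n p := by
  rw [primeProd_val]
  push_cast
  rw [norm_prod]
  exact Finset.prod_congr rfl fun p _ => by rw [norm_zpow, norm_prime]

theorem norm_primeProd_mem (n : S → ℤ) (q : S) :
    ‖((primeProd S n : ℚ) : ℚ_[(q : Nat.Primes)])‖ = (((q : Nat.Primes) : ℕ) : ℝ) ^ (-n q) := by
  rw [norm_primeProd, Finset.prod_eq_single q]
  · simp
  · intro b _ hb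
    rw [if_neg fun h => hb (Subtype.ext h), one_zpow]
  · simp

theorem primeProd_mem (n : S → ℤ) : primeProd S n ∈ Gam S := by
  intro q hq
  rw [norm_primeProd]
  refine Finset.prod_eq_one fun p _ => ?_
  rw [if_neg (fun h : (p : Nat.Primes) = q => hq (h ▸ p.2)), one_zpow]

theorem Gam_ext_abs {g h : ℚˣ} (hg : g ∈ Gam S) (hh : h ∈ Gam S)
    (H : ∀ p : S, ‖((g : ℚ) : ℚ_[(p : Nat.Primes)])‖ = ‖((h : ℚ) : ℚ_[(p : Nat.Primes)])‖) :
    |(g : ℚ)| = |(h : ℚ)| := by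
  have key : |((g : ℚ) / (h : ℚ))| = 1 := by
    refine abs_eq_one_of_norm fun p => ?_
    push_cast
    rw [norm_div]
    by_cases hp : p ∈ S
    · have hh0 : ‖((h : ℚ) : ℚ_[p])‖ ≠ 0 := by
        rw [norm_ne_zero_iff]; exact_mod_cast h.ne_zero
      rw [H ⟨p, hp⟩, div_self hh0]
    · rw [hg p hp, hh p hp, div_one]
  rw [abs_div, div_eq_one_iff_eq (abs_ne_zero.2 h.ne_zero)] at key
  exact key

theorem product_formula (g : Gam S) :
    |(((g : ℚˣ) : ℚ) : ℝ)| * ∏ p : S, ‖(((g : ℚˣ) : ℚ) : ℚ_[(p : Nat.Primes)])‖ = 1 := by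
  have hn : ∀ p : S, ∃ n : ℤ, ‖(((g : ℚˣ) : ℚ) : ℚ_[(p : Nat.Primes)])‖
      = (((p : Nat.Primes) : ℕ) : ℝ) ^ (-n) := fun p => by
    obtain ⟨n, hn⟩ := Padic.padicNormE.image (p := (p : Nat.Primes))
      (q := (((g : ℚˣ) : ℚ) : ℚ_[(p : Nat.Primes)])) (by exact_mod_cast (g : ℚˣ).ne_zero)
    exact ⟨n, by rw [hn]; push_cast; rfl⟩
  choose n hn using hn
  have h1 := Gam_ext_abs S g.2 (primeProd_mem S n) fun p => by rw [hn, norm_primeProd_mem]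
  have h2 : |(((g : ℚˣ) : ℚ) : ℝ)| = ∏ p : S, (((p : Nat.Primes) : ℕ) : ℝ) ^ n p := by
    have : |(((g : ℚˣ) : ℚ) : ℝ)| = ((|((g : ℚˣ) : ℚ)| : ℚ) : ℝ) := by push_cast; rfl
    rw [this, h1, primeProd_val, abs_of_nonneg (Finset.prod_nonneg fun p _ => by positivity)]
    push_cast; rfl
  rw [h2, ← Finset.prod_mul_distrib]
  refine Finset.prod_eq_one fun p _ => ?_
  have : (((p : Nat.Primes) : ℕ) : ℝ) ≠ 0 := by exact_mod_cast p.1.2.ne_zero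
  rw [hn, ← zpow_add₀ this, add_neg_cancel, zpow_zero]

theorem modA_smul (g : Gam S) (x : Adele S) : modA S (g • x) = modA S x := by
  have := product_formula S g
  simp only [modA, Gam_smul_fst, Gam_smul_snd, abs_mul, norm_mul, Finset.prod_mul_distrib]
  rw [mul_mul_mul_comm, this, one_mul]

/-- Multiplication by an idele, as a homeomorphism of the additive group of adeles. -/
def mulIdele (a : (Adele S)ˣ) : Adele S ≃ₜ+ Adele S :=
  { Units.mulLeft a with
    map_add' := mul_add _
    continuous_toFun := continuous_const_mul _
    continuous_invFun := continuous_const_mul _ }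

theorem mulIdele_apply (a : (Adele S)ˣ) (x : Adele S) : mulIdele S a x = a * x := rfl

theorem idele_fst_ne (a : (Adele S)ˣ) : (a : Adele S).1 ≠ 0 := by
  have := congrArg Prod.fst a.mul_inv
  rw [Prod.fst_mul, Prod.fst_one] at this
  exact left_ne_zero_of_mul_eq_one this

theorem idele_snd_ne (a : (Adele S)ˣ) (p : S) : (a : Adele S).2 p ≠ 0 := by
  have := congrFun (congrArg Prod.snd a.mul_inv) p
  rw [Prod.snd_mul, Prod.snd_one, Pi.mul_apply, Pi.one_apply] at this
  exact left_ne_zero_of_mul_eq_one this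

theorem modA_pos (a : (Adele S)ˣ) : 0 < modA S a :=
  mul_pos (abs_pos.2 (idele_fst_ne S a))
    (Finset.prod_pos fun p _ => norm_pos_iff.2 (idele_snd_ne S a p))

theorem haarA_preimage (a : (Adele S)ˣ) (s : Set (Adele S)) :
    haarA S (mulIdele S a ⁻¹' s) = ENNReal.ofReal (modA S a)⁻¹ * haarA S s := by
  have h := fun s : Set (Adele S) => addEquivAddHaarChar_smul_preimage (haarA S) (X := s)
    (mulIdele S a)
  set c := addEquivAddHaarChar (mulIdele S a)
  let B : Set (Adele S) :=
    {x : ℝ | |x| ≤ 1} ×ˢ Set.univ.pi fun p : S => {x : ℚ_[(p : Nat.Primes)] | ‖x‖ ≤ 1}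
  have hvol : ∀ r : ℝ, r ≠ 0 → (volume : Measure ℝ) {x : ℝ | |r * x| ≤ 1}
      = ENNReal.ofReal (2 * |r|⁻¹) := by
    intro r hr
    have : {x : ℝ | |r * x| ≤ 1} = Metric.closedBall 0 |r|⁻¹ := by
      ext x
      simp only [Set.mem_ofPred_eq, mem_closedBall_zero_iff, Real.norm_eq_abs, abs_mul]
      rw [← one_div, le_div_iff₀' (abs_pos.2 hr)]
    rw [this, Real.volume_closedBall]
  have hB : haarA S B = ENNReal.ofReal 2 := by
    have h1 := hvol 1 one_ne_zero
    simp only [one_mul, abs_one, inv_one, mul_one] at h1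
    have h2 : ∀ p : S, haarP (p : Nat.Primes) {x | ‖x‖ ≤ 1} = 1 := fun p => by
      have := haarP_mul_le_one (p : Nat.Primes) one_ne_zero
      simpa using this
    rw [haarA, Measure.prod_prod, Measure.pi_pi, h1]
    simp [h2]
  have hB' : haarA S (mulIdele S a ⁻¹' B) = ENNReal.ofReal (modA S a)⁻¹ * ENNReal.ofReal 2 := by
    have : mulIdele S a ⁻¹' B = {x : ℝ | |(a : Adele S).1 * x| ≤ 1} ×ˢ
        Set.univ.pi fun p : S => {x | ‖(a : Adele S).2 p * x‖ ≤ 1} := by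
      ext x
      simp [B, mulIdele_apply]
    rw [this, haarA, Measure.prod_prod, Measure.pi_pi, hvol _ (idele_fst_ne S a)]
    simp only [haarP_mul_le_one _ (idele_snd_ne S a _)]
    rw [← ENNReal.ofReal_prod_of_nonneg fun p _ => by positivity,
      ← ENNReal.ofReal_mul (by positivity), ← ENNReal.ofReal_mul (by have := modA_pos S a; positivity)]
    congr 1
    rw [modA, mul_inv, Finset.prod_inv_distrib]
    ring
  have hm := modA_pos S a
  have hc : (c : ℝ≥0∞) * ENNReal.ofReal (modA S a)⁻¹ = 1 := by
    have h1 := h B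
    rw [ENNReal.smul_def, smul_eq_mul, hB, hB', ← mul_assoc,
      ENNReal.mul_eq_right (by simp) (by simp)] at h1
    exact h1
  have h2 := h s
  rw [ENNReal.smul_def, smul_eq_mul] at h2
  rw [← h2, ← mul_assoc, mul_comm (ENNReal.ofReal _), hc, one_mul]

theorem map_mulIdele (a : (Adele S)ˣ) :
    Measure.map (mulIdele S a) (haarA S) = ENNReal.ofReal (modA S a)⁻¹ • haarA S := by
  ext s hs
  have hm : Measurable (mulIdele S a) := (mulIdele S a).toHomeomorph.measurable
  rw [Measure.map_apply hm hs, haarA_preimage,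
    Measure.smul_apply, smul_eq_mul]

/-- The diagonal embedding of `Γ` in the ideles. -/
def principal : Gam S →* (Adele S)ˣ :=
  (Units.map (algebraMap ℚ (Adele S)).toMonoidHom).comp (Gam S).subtype

theorem principal_mul (g : Gam S) (x : Adele S) : (principal S g : Adele S) * x = g • x := by
  change algebraMap ℚ (Adele S) ((g : ℚˣ) : ℚ) * x = _
  rw [← Algebra.smul_def]; rfl

theorem modA_mul (x y : Adele S) : modA S (x * y) = modA S x * modA S y := by
  simp only [modA, Prod.fst_mul, Prod.snd_mul, Pi.mul_apply, abs_mul, norm_mul,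
    Finset.prod_mul_distrib]
  ring

theorem modA_one : modA S 1 = 1 := by simp [modA]

theorem modA_principal (g : Gam S) : modA S (principal S g) = 1 := by
  have := modA_smul S g 1
  rwa [← principal_mul, mul_one, modA_one] at this

instance Gam_smulInvariant : SMulInvariantMeasure (Gam S) (Adele S) (haarA S) where
  measure_preimage_smul g s _ := by
    have := haarA_preimage S (principal S g) s
    rw [modA_principal, inv_one, ENNReal.ofReal_one, one_mul] at this
    rw [← this]
    simp only [Set.preimage, mulIdele_apply, principal_mul]

/-- The fundamental domain `R_S^* × ℝ_+^*` for the action of `Γ`, where `R_S^* = ∏_{p ∈ S} ℤ_p^*`. -/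
def fundDomain : Set (Adele S) := {x | 0 < x.1 ∧ ∀ p : S, ‖x.2 p‖ = 1}

theorem measurableSet_fundDomain : MeasurableSet (fundDomain S) := by
  have : fundDomain S = {x | 0 < x.1} ∩ ⋂ p : S, {x | ‖x.2 p‖ = 1} := by
    ext x; simp [fundDomain]
  rw [this]
  refine (measurableSet_lt measurable_const measurable_fst).inter (MeasurableSet.iInter fun p => ?_)
  exact measurableSet_eq_fun (((measurable_pi_apply p).comp measurable_snd).norm) measurable_const

theorem ae_isUnit : ∀ᵐ x ∂haarA S, x.1 ≠ 0 ∧ ∀ p : S, x.2 p ≠ 0 := by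
  have h1 : ∀ᵐ x ∂haarA S, x.1 ≠ 0 :=
    Measure.quasiMeasurePreserving_fst.ae (p := fun y : ℝ => y ≠ 0) (Measure.ae_ne volume 0)
  have h2 : ∀ p : S, ∀ᵐ x ∂haarA S, x.2 p ≠ 0 := fun p => by
    refine Measure.quasiMeasurePreserving_snd.ae
      (p := fun y : (p : S) → ℚ_[(p : Nat.Primes)] => y p ≠ 0) ?_
    exact (Measure.tendsto_eval_ae_ae (μ := fun p : S => haarP (p : Nat.Primes)) (i := p)).eventually
      (Measure.ae_ne (haarP (p : Nat.Primes)) 0)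
  filter_upwards [h1, ae_all_iff.2 h2] with x a b using ⟨a, b⟩

theorem isFundamentalDomain : IsFundamentalDomain (Gam S) (fundDomain S) (haarA S) where
  nullMeasurableSet := (measurableSet_fundDomain S).nullMeasurableSet
  ae_covers := by
    filter_upwards [ae_isUnit S] with x hx
    have hn : ∀ p : S, ∃ n : ℤ, ‖x.2 p‖ = (((p : Nat.Primes) : ℕ) : ℝ) ^ (-n) := fun p => by
      obtain ⟨n, hn⟩ := Padic.padicNormE.image (hx.2 p)
      exact ⟨n, by rw [hn]; push_cast; rfl⟩
    choose n hn using hn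
    let g : Gam S := ⟨primeProd S (-n), primeProd_mem S _⟩
    have hg : (0 : ℝ) < ((primeProd S (-n) : ℚ) : ℝ) := by
      have : (0 : ℚ) < primeProd S (-n) := by
        rw [primeProd_val]
        exact Finset.prod_pos fun p _ => zpow_pos (by exact_mod_cast p.1.2.pos) _
      exact_mod_cast this
    have hgp : ∀ p : S, ‖((primeProd S (-n) : ℚ) : ℚ_[(p : Nat.Primes)])‖ * ‖x.2 p‖ = 1 :=
      fun p => by
        have : (((p : Nat.Primes) : ℕ) : ℝ) ≠ 0 := by exact_mod_cast p.1.2.ne_zero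
        rw [norm_primeProd_mem, hn, ← zpow_add₀ this]
        simp
    rcases lt_or_gt_of_ne hx.1 with h | h
    · refine ⟨⟨-1, fun p _ => by simp⟩ * g, ?_, fun p => ?_⟩
      · rw [Gam_smul_fst]
        simp only [Subgroup.coe_mul, Units.val_mul, Units.val_neg, Units.val_one, g]
        push_cast
        nlinarith [mul_pos_of_neg_of_neg h (neg_neg_of_pos hg)]
      · rw [Gam_smul_snd, norm_mul]
        simp only [Subgroup.coe_mul, Units.val_mul, Units.val_neg, Units.val_one, g]
        push_cast
        rw [norm_mul, norm_neg, norm_one, one_mul, hgp]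
    · refine ⟨g, ?_, fun p => ?_⟩
      · rw [Gam_smul_fst]; exact mul_pos hg h
      · rw [Gam_smul_snd, norm_mul]; exact hgp p
  aedisjoint := by
    intro g h hgh
    refine Disjoint.aedisjoint (Set.disjoint_left.2 fun x hg hh => hgh ?_)
    rw [Set.mem_smul_set_iff_inv_smul_mem] at hg hh
    obtain ⟨hg1, hg2⟩ := hg
    obtain ⟨hh1, hh2⟩ := hh
    rw [Gam_smul_fst] at hg1 hh1
    have hx : ∀ p : S, ‖x.2 p‖ ≠ 0 := fun p h0 => by
      have := hg2 p
      rw [Gam_smul_snd, norm_mul, h0, mul_zero] at this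
      exact zero_ne_one this
    have habs := Gam_ext_abs S (g⁻¹).2 (h⁻¹).2 fun p => by
      have h1 := hg2 p
      have h2 := hh2 p
      rw [Gam_smul_snd, norm_mul] at h1 h2
      exact mul_right_cancel₀ (hx p) (h1.trans h2.symm)
    have hpos : (0 : ℚ) < ((g⁻¹ : Gam S) : ℚˣ) * ((h⁻¹ : Gam S) : ℚˣ) := by
      have : (0 : ℝ) < ((((g⁻¹ : Gam S) : ℚˣ) : ℚ) : ℝ) * ((((h⁻¹ : Gam S) : ℚˣ) : ℚ) : ℝ) := by
        have h3 := mul_pos hg1 hh1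
        have : (0 : ℝ) ≤ x.1 * x.1 := mul_self_nonneg _
        by_contra hcon
        nlinarith [mul_nonneg this (sub_nonneg.2 (not_lt.1 hcon))]
      exact_mod_cast this
    have : ((g⁻¹ : Gam S) : ℚˣ) = ((h⁻¹ : Gam S) : ℚˣ) := by
      ext
      rcases abs_eq_abs.1 habs with h4 | h4
      · exact h4
      · rw [h4] at hpos
        nlinarith [mul_self_nonneg ((((h⁻¹ : Gam S) : ℚˣ) : ℚ))]
    exact inv_injective (Subtype.ext this)


/-- The semilocal adele class space `X_S`, the quotient of the adeles by `Γ` (with the quotient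
σ-algebra). -/
abbrev X : Type := MulAction.orbitRel.Quotient (Gam S) (Adele S)

/-- The canonical projection from the adeles to `X_S`. -/
def proj (x : Adele S) : X S := Quotient.mk'' x

theorem measurable_proj : Measurable (proj S) := measurable_quotient_mk''

/-- The measure on `X_S` induced by the Haar measure of the adeles: the image under the projection of
the restriction of that measure to the fundamental domain `R_S^* × ℝ_+^*`. The Haar measure is
normalized so that `R_S^* × [0, 1]` has measure `1`, that is, divided by `∏ (1 - 1 / p)`. -/
def muX : Measure (X S) :=
  (∏ p : S, ENNReal.ofReal (1 - (((p : Nat.Primes) : ℕ) : ℝ)⁻¹))⁻¹ •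
    Measure.map (proj S) ((haarA S).restrict (fundDomain S))

/-- The semilocal idele class group `C_S`. -/
abbrev CS : Type := (Adele S)ˣ ⧸ (principal S).range

/-- The module as a homomorphism on the ideles. -/
def modHom : (Adele S)ˣ →* ℝ where
  toFun a := modA S a
  map_one' := modA_one S
  map_mul' a b := modA_mul S a b

/-- The module as a homomorphism on `C_S`. -/
def modC : CS S →* ℝ := QuotientGroup.lift _ (modHom S) (by
  rintro _ ⟨g, rfl⟩
  exact modA_principal S g)

theorem modC_mk (a : (Adele S)ˣ) : modC S (QuotientGroup.mk a) = modA S a := rfl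

/-- `K_S`, the kernel of the module on `C_S`. -/
def KS : Subgroup (CS S) := (modC S).ker

/-- The action of `C_S` on `X_S` by multiplication. -/
def act (c : CS S) (x : X S) : X S :=
  Quotient.map₂ (sa := QuotientGroup.leftRel (principal S).range)
    (sb := MulAction.orbitRel (Gam S) (Adele S)) (sc := MulAction.orbitRel (Gam S) (Adele S))
    (fun (a : (Adele S)ˣ) (x : Adele S) => (a : Adele S) * x) (by
      intro a b hab x y hxy
      rw [← Quotient.eq_iff_equiv, Quotient.eq, QuotientGroup.leftRel_apply] at hab
      obtain ⟨g, hg⟩ := hab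
      obtain ⟨h, rfl⟩ := hxy
      have hb : b = a * principal S g := by rw [hg, mul_inv_cancel_left]
      refine ⟨g⁻¹ * h, ?_⟩
      simp only [← principal_mul, hb, map_mul, Units.val_mul]
      have : (principal S g : Adele S) * (principal S g⁻¹ : Adele S) = 1 := by
        rw [← Units.val_mul, ← map_mul, mul_inv_cancel, map_one, Units.val_one]
      linear_combination ((a : Adele S) * (principal S h : Adele S) * y) * this) c x

theorem act_mk (a : (Adele S)ˣ) (x : Adele S) :
    act S (QuotientGroup.mk a) (proj S x) = proj S (a * x) := rfl

theorem measurable_act (c : CS S) : Measurable (act S c) := by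
  induction c using QuotientGroup.induction_on with
  | H a =>
    refine measurable_from_quotient.2 ?_
    exact (measurable_proj S).comp (measurable_const_mul (a : Adele S))

theorem modC_pos (c : CS S) : 0 < modC S c := by
  induction c using QuotientGroup.induction_on with
  | H a => exact modA_pos S a

theorem map_act (c : CS S) :
    Measure.map (act S c) (muX S) = ENNReal.ofReal (modC S c)⁻¹ • muX S := by
  induction c using QuotientGroup.induction_on with
  | H a =>
  rw [muX, Measure.map_smul, smul_comm, modC_mk]
  congr 1
  ext s hs
  rw [Measure.map_map (measurable_act S _) (measurable_proj S), Measure.smul_apply,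
    Measure.map_apply (measurable_proj S) hs,
    Measure.map_apply ((measurable_act S _).comp (measurable_proj S)) hs]
  have hA := measurable_proj S hs
  have hm : Measurable (mulIdele S a) := (mulIdele S a).toHomeomorph.measurable
  have h1 : (act S (QuotientGroup.mk a) ∘ proj S) ⁻¹' s = mulIdele S a ⁻¹' (proj S ⁻¹' s) := rfl
  rw [h1, Measure.restrict_apply hA, Measure.restrict_apply (hm hA)]
  have hF : IsFundamentalDomain (Gam S) (mulIdele S a ⁻¹' fundDomain S) (haarA S) := by
    refine (isFundamentalDomain S).preimage_of_equiv (f := mulIdele S a) ⟨hm, ?_⟩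
      (e := id) Function.bijective_id ?_
    · rw [map_mulIdele]
      exact Measure.smul_absolutelyContinuous
    · intro g x
      change (a : Adele S) * (g • x) = g • ((a : Adele S) * x)
      rw [mul_smul_comm]
  have hinv : ∀ g : Gam S, (fun x => g • x) ⁻¹' (mulIdele S a ⁻¹' (proj S ⁻¹' s))
      = mulIdele S a ⁻¹' (proj S ⁻¹' s) := by
    intro g
    ext x
    simp only [Set.mem_preimage, mulIdele_apply, mul_smul_comm]
    have : proj S (g • ((a : Adele S) * x)) = proj S ((a : Adele S) * x) :=
      Quotient.sound ⟨g, rfl⟩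
    rw [this]
  rw [(isFundamentalDomain S).measure_set_eq hF (hm hA) hinv, ← Set.preimage_inter,
    haarA_preimage, smul_eq_mul]

/-- The Hilbert space `L²(X_S)`. -/
abbrev L2X : Type := Lp ℂ 2 (muX S)

theorem qmp_act (c : CS S) : Measure.QuasiMeasurePreserving (act S c) (muX S) (muX S) :=
  ⟨measurable_act S c, by rw [map_act]; exact Measure.smul_absolutelyContinuous⟩

theorem memLp_comp_act (c : CS S) (ξ : L2X S) :
    MemLp (fun x => ((modC S c ^ (1 / 2 : ℝ) : ℝ) : ℂ) * ξ (act S c x)) 2 (muX S) := by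
  refine MemLp.const_mul ?_ _
  refine MemLp.comp_of_map (f := act S c) ?_ (measurable_act S c).aemeasurable
  rw [map_act]
  exact (Lp.memLp ξ).smul_measure ENNReal.ofReal_ne_top

/-- The unitary action of `C_S` on `L²(X_S)`, `(θ(c) ξ)(x) = |c|^{1/2} ξ(c x)`. -/
def theta (c : CS S) : L2X S →ₗᵢ[ℂ] L2X S where
  toFun ξ := (memLp_comp_act S c ξ).toLp _
  map_add' ξ ζ := by
    rw [← MemLp.toLp_add, MemLp.toLp_eq_toLp_iff]
    filter_upwards [(qmp_act S c).ae (Lp.coeFn_add ξ ζ)] with x hx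
    simp only [hx, Pi.add_apply, mul_add]
  map_smul' r ξ := by
    rw [RingHom.id_apply, ← MemLp.toLp_const_smul, MemLp.toLp_eq_toLp_iff]
    filter_upwards [(qmp_act S c).ae (Lp.coeFn_smul r ξ)] with x hx
    simp only [hx, Pi.smul_apply, smul_eq_mul]
    ring
  norm_map' ξ := by
    change ‖(memLp_comp_act S c ξ).toLp _‖ = _
    have hc := modC_pos S c
    rw [Lp.norm_toLp, Lp.norm_def]
    congr 1
    have : (fun x => ((modC S c ^ (1 / 2 : ℝ) : ℝ) : ℂ) * ξ (act S c x))
        = ((modC S c ^ (1 / 2 : ℝ) : ℝ) : ℂ) • ((ξ : X S → ℂ) ∘ act S c) := rfl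
    have h2 : AEStronglyMeasurable ξ (Measure.map (act S c) (muX S)) := by
      rw [map_act]; exact (Lp.aestronglyMeasurable ξ).smul_measure _
    rw [this, eLpNorm_const_smul, ← eLpNorm_map_measure h2 (measurable_act S c).aemeasurable,
      map_act, eLpNorm_smul_measure_of_ne_top (by simp), smul_eq_mul, ← mul_assoc]
    have h3 : ‖((modC S c ^ (1 / 2 : ℝ) : ℝ) : ℂ)‖ₑ
        * ENNReal.ofReal (modC S c)⁻¹ ^ (1 / (2 : ℝ≥0∞)).toReal = 1 := by
      rw [← ofReal_norm, Complex.norm_real, Real.norm_of_nonneg (by positivity),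
        ENNReal.ofReal_rpow_of_pos (by positivity), ← ENNReal.ofReal_mul (by positivity)]
      simp only [one_div, ENNReal.toReal_inv, ENNReal.toReal_ofNat]
      rw [Real.inv_rpow hc.le, mul_inv_cancel₀ (by positivity), ENNReal.ofReal_one]
    rw [h3, one_mul]

theorem theta_apply (c : CS S) (ξ : L2X S) :
    theta S c ξ =ᵐ[muX S] fun x => ((modC S c ^ (1 / 2 : ℝ) : ℝ) : ℂ) * ξ (act S c x) :=
  (memLp_comp_act S c ξ).coeFn_toLp

/-- The Hilbert space `L²(X_S)^{K_S}` of `K_S`-invariant vectors. -/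
def HS : Submodule ℂ (L2X S) :=
  ⨅ k : KS S, LinearMap.eqLocus (theta S k).toLinearMap LinearMap.id

theorem mem_HS {ξ : L2X S} : ξ ∈ HS S ↔ ∀ k ∈ KS S, theta S k ξ = ξ := by
  simp [HS, Submodule.mem_iInf, LinearMap.mem_eqLocus]

instance HS_complete : CompleteSpace (HS S) := by
  refine IsClosed.completeSpace_coe (hs := ?_)
  have : (HS S : Set (L2X S)) = ⋂ k : KS S, {ξ | theta S k ξ = ξ} := by
    ext ξ; simp [mem_HS]
  change IsClosed (HS S : Set (L2X S))
  rw [this]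
  exact isClosed_iInter fun k => isClosed_eq (theta S k).continuous continuous_id


/-- The class in `C_S` of the idele with component `exp t` at the archimedean place and `1` at the
finite places: the archimedean scaling subgroup. -/
def scaleClass (t : ℝ) : CS S :=
  QuotientGroup.mk (MulEquiv.prodUnits.symm (Units.mk0 (Real.exp t) (Real.exp_pos t).ne', 1))

/-- `ζ` is the value at `ξ` of the generator of the scaling group:
`(θ(exp t) ξ - ξ) / t → i ζ` in `L²(X_S)` as `t → 0`. -/
def IsGeneratorValue (ξ ζ : HS S) : Prop :=
  Tendsto (fun t : ℝ => (t : ℂ)⁻¹ • (theta S (scaleClass S t) (ξ : L2X S) - (ξ : L2X S)))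
    (𝓝[≠] 0) (𝓝 (Complex.I • (ζ : L2X S)))

theorem IsGeneratorValue.unique {ξ ζ ζ' : HS S} (h : IsGeneratorValue S ξ ζ)
    (h' : IsGeneratorValue S ξ ζ') : ζ = ζ' :=
  Subtype.ext (smul_right_injective _ Complex.I_ne_zero (tendsto_nhds_unique h h'))

theorem IsGeneratorValue.add {ξ ξ' ζ ζ' : HS S} (h : IsGeneratorValue S ξ ζ)
    (h' : IsGeneratorValue S ξ' ζ') : IsGeneratorValue S (ξ + ξ') (ζ + ζ') := by
  refine (Tendsto.add h h').congr' ?_ |>.trans_eq ?_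
  · refine Eventually.of_forall fun t => ?_
    simp only [Submodule.coe_add, map_add, ← smul_add]
    congr 1
    abel
  · rw [Submodule.coe_add, smul_add]

theorem IsGeneratorValue.smul {ξ ζ : HS S} (c : ℂ) (h : IsGeneratorValue S ξ ζ) :
    IsGeneratorValue S (c • ξ) (c • ζ) := by
  refine (Tendsto.const_smul h c).congr' ?_ |>.trans_eq ?_
  · refine Eventually.of_forall fun t => ?_
    simp only [Submodule.coe_smul, map_smul, ← smul_sub]
    rw [smul_comm]
  · rw [Submodule.coe_smul, smul_comm]

/-- The scaling operator `𝕊`: the generator of the archimedean scaling group on `L²(X_S)^{K_S}`, i.e.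
`exp(i t 𝕊) ξ (x) = exp(t / 2) ξ(exp(t) x)`. Its domain is the set of vectors where the derivative at
`t = 0` exists (`L²(X_S)^{K_S}` being closed and invariant under the group). -/
def scalingOp : HS S →ₗ.[ℂ] HS S where
  domain :=
    { carrier := {ξ | ∃ ζ, IsGeneratorValue S ξ ζ}
      add_mem' := fun ⟨ζ, h⟩ ⟨ζ', h'⟩ => ⟨ζ + ζ', h.add S h'⟩
      zero_mem' := ⟨0, by simp [IsGeneratorValue]⟩
      smul_mem' := fun c _ ⟨ζ, h⟩ => ⟨c • ζ, h.smul S c⟩ }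
  toFun :=
    { toFun := fun ξ => ξ.2.choose
      map_add' := fun ξ ξ' =>
        (ξ + ξ').2.choose_spec.unique S (ξ.2.choose_spec.add S ξ'.2.choose_spec)
      map_smul' := fun c ξ => (c • ξ).2.choose_spec.unique S (ξ.2.choose_spec.smul S c) }

/-- The Hilbert space `L²(ℝ)^{ev}` of even functions in `L²(ℝ)`. -/
def L2even : Submodule ℂ (Lp ℂ 2 (volume : Measure ℝ)) :=
  LinearMap.eqLocus
    (Lp.compMeasurePreservingₗ ℂ (fun x : ℝ => -x) (Measure.measurePreserving_neg volume))
    LinearMap.id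

theorem memLp_gaussian :
    MemLp (fun x : ℝ => ((2 ^ (1 / 4 : ℝ) * Real.exp (-Real.pi * x ^ 2) : ℝ) : ℂ)) 2 volume := by
  rw [memLp_two_iff_integrable_sq_norm (by fun_prop)]
  have h := (integrable_exp_neg_mul_sq (b := 2 * Real.pi) (by positivity)).const_mul
    ((2 : ℝ) ^ (1 / 2 : ℝ))
  refine h.congr (Eventually.of_forall fun x => ?_)
  have h2 : ((2 : ℝ) ^ (1 / 4 : ℝ)) ^ 2 = 2 ^ (1 / 2 : ℝ) := by
    rw [← Real.rpow_natCast, ← Real.rpow_mul (by norm_num)]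
    norm_num
  simp only [Complex.norm_real, Real.norm_eq_abs, sq_abs, mul_pow]
  rw [← Real.exp_nat_mul, h2]
  congr 2
  push_cast
  ring

/-- The unit vector `ξ_∞(x) = 2^{1/4} exp(-π x²)` of `L²(ℝ)^{ev}`. -/
def xiInf : L2even :=
  ⟨memLp_gaussian.toLp _, by
    rw [L2even, LinearMap.mem_eqLocus, LinearMap.id_apply]
    refine (Lp.toLp_compMeasurePreserving memLp_gaussian
      (Measure.measurePreserving_neg volume)).trans ?_
    rw [MemLp.toLp_eq_toLp_iff]
    refine Eventually.of_forall fun x => ?_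
    simp⟩

/-- The Haar measure `d^*u = du / u` of the multiplicative group of positive real numbers, as a measure
on `ℝ` carried by `(0, ∞)`. -/
def dstar : Measure ℝ :=
  (volume.restrict (Set.Ioi 0)).withDensity fun u => ENNReal.ofReal u⁻¹

/-- `Fmu` is the Fourier transform `𝔽_μ` of the multiplicative group `ℝ_+^*`: the bounded operator
from `L²(ℝ_+^*, d^*u)` to `L²(ℝ)` given on integrable elements by `∫ g(u) u^{-is} d^*u`. -/
def IsMultFourier (Fmu : Lp ℂ 2 dstar ≃L[ℂ] Lp ℂ 2 (volume : Measure ℝ)) : Prop :=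
  ∀ g : Lp ℂ 2 dstar, Integrable g dstar →
    Fmu g =ᵐ[volume] fun s : ℝ => ∫ u, g u * (u : ℂ) ^ (-(Complex.I * s)) ∂dstar

/-- `w` is the map `w_∞(f)(u) = u^{1/2} f(u)`. -/
def IsWInf (w : L2even →L[ℂ] Lp ℂ 2 dstar) : Prop :=
  ∀ f : L2even, w f =ᵐ[dstar]
    fun u : ℝ => ((u ^ (1 / 2 : ℝ) : ℝ) : ℂ) * (f : Lp ℂ 2 (volume : Measure ℝ)) u

/-- `w` is the canonical identification `w_S` of `L²(X_S)^{K_S}` with `L²(ℝ_+^*, d^*u)`. A class `c` of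
ideles is a point of `X_S`, almost every point of `X_S` is of this form, and
`(w_S ξ)(|c|) = |c|^{1/2} ξ(c)`: the `K_S`-invariant function `|c|^{1/2} ξ(c)` on `C_S` depends on
the module of `c` only. -/
def IsWS (w : HS S ≃ₗᵢ[ℂ] Lp ℂ 2 dstar) : Prop :=
  ∀ ξ : HS S, ∀ᵐ x ∂haarA S,
    w ξ (modA S x) = ((modA S x ^ (1 / 2 : ℝ) : ℝ) : ℂ) * (ξ : L2X S) (proj S x)

/-- The function `1_{R_S} ⊗ f` on the adeles, where `R_S = ∏_{p ∈ S} ℤ_p`. -/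
def oneTensor (f : ℝ → ℂ) (x : Adele S) : ℂ :=
  {y : (p : S) → ℚ_[(p : Nat.Primes)] | ∀ p, ‖y p‖ ≤ 1}.indicator 1 x.2 * f x.1

/-- `η` is the map `η_S`, sending an even function `f` to the class of `1_{R_S} ⊗ f`: the function
`∑_γ (1_{R_S} ⊗ f)(γ x)` of `x`, the sum being over the positive elements `γ` of `Γ`. -/
def IsEta (η : L2even →L[ℂ] HS S) : Prop :=
  ∀ f : L2even, ∀ᵐ x ∂haarA S,
    HasSum (fun g : {g : Gam S // 0 < ((g : ℚˣ) : ℚ)} =>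
      oneTensor S (f : Lp ℂ 2 (volume : Measure ℝ)) ((g : Gam S) • x)) ((η f : L2X S) (proj S x))

/-- `ξ` is the class in `L²(X_S)` of the function `h` on the adeles: `ξ(x) = ∑_{γ ∈ Γ} h(γ x)`. -/
def IsClassOf (h : Adele S → ℂ) (ξ : L2X S) : Prop :=
  ∀ᵐ x ∂haarA S, HasSum (fun g : Gam S => h (g • x)) (ξ (proj S x))

/-- The tensor product `⊗_v φ_v` as a function on the adeles. -/
def tensor (φinf : ℝ → ℂ) (φ : (p : S) → ℚ_[(p : Nat.Primes)] → ℂ) (x : Adele S) : ℂ :=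
  φinf x.1 * ∏ p : S, φ p (x.2 p)

/-- The additive character `ψ` of `ℚ_p` is normalized: for the Haar measure with `ℤ_p` of measure `1`,
the function `1_{ℤ_p}` is its own Fourier transform. -/
structure IsNormalizedChar (p : ℕ) [Fact p.Prime] (ψ : AddChar ℚ_[p] Circle) : Prop where
  continuous : Continuous ψ
  fourier_one : Fourier.fourierIntegral ψ (haarP p)
      ({x : ℚ_[p] | ‖x‖ ≤ 1}.indicator (1 : ℚ_[p] → ℂ)) =
    {x : ℚ_[p] | ‖x‖ ≤ 1}.indicator (1 : ℚ_[p] → ℂ)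

/-- `F` is the Fourier transform `𝔽_S` of `L²(X_S)`, induced by the tensor product of the local Fourier
transforms: for Schwartz functions `φ_∞` on `ℝ` and locally constant functions `φ_p` with compact
support on `ℚ_p`, it sends the class of `⊗ φ_v` to the class of the tensor product of the Fourier
transforms of the `φ_v`. -/
def IsSemilocalFourier (ψ : (p : S) → AddChar ℚ_[(p : Nat.Primes)] Circle)
    (F : L2X S →L[ℂ] L2X S) : Prop :=
  ∀ (φinf : SchwartzMap ℝ ℂ) (φ : (p : S) → ℚ_[(p : Nat.Primes)] → ℂ),
    (∀ p, IsLocallyConstant (φ p) ∧ HasCompactSupport (φ p)) →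
    ∃ ξ ζ : L2X S, IsClassOf S (tensor S φinf φ) ξ ∧
      IsClassOf S (tensor S (𝓕 φinf : SchwartzMap ℝ ℂ)
        fun p => Fourier.fourierIntegral (ψ p) (haarP (p : Nat.Primes)) (φ p)) ζ ∧
      F ξ = ζ

/-- The local Euler factor `L_p(z) = (1 - p^{-z})⁻¹`. -/
def eulerFactor (p : ℕ) (z : ℂ) : ℂ := (1 - (p : ℂ) ^ (-z))⁻¹

/-- The product of the finite Euler factors `∏_{p ∈ S} L_p(1/2 - i s)`. -/
def finiteEuler (s : ℝ) : ℂ :=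
  ∏ p : S, eulerFactor (p : Nat.Primes) (1 / 2 - Complex.I * s)

/-- The product `∏_v L_v(1/2 - i s)` over all the places, where `L_∞(z) = π^{-z/2} Γ(z/2)`. -/
def fullEuler (s : ℝ) : ℂ := Complex.Gammaℝ (1 / 2 - Complex.I * s) * finiteEuler S s

/-- The measure `dm_S(s) = |∏_v L_v(1/2 - i s)|² ds`. -/
def mS : Measure ℝ := volume.withDensity fun s => ENNReal.ofReal (‖fullEuler S s‖ ^ 2)

end Spaces

section CyclicPairs

variable {H : Type*} [NormedAddCommGroup H] [InnerProductSpace ℂ H] [CompleteSpace H]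

/-- A cyclic pair: a selfadjoint operator `D` in an infinite dimensional Hilbert space and a unit vector
`ξ` which is in the domain of all the powers of `D` and such that the span of the vectors `D^n ξ` (the
sequence `v` below) is dense. -/
structure IsCyclicPair (D : H →ₗ.[ℂ] H) (ξ : H) : Prop where
  infinite_dimensional : ¬ FiniteDimensional ℂ H
  dense_domain : Dense (D.domain : Set H)
  selfAdjoint : IsSelfAdjoint D
  norm_eq_one : ‖ξ‖ = 1
  cyclic : ∃ v : ℕ → H, v 0 = ξ ∧
    (∀ n, ∃ h : v n ∈ D.domain, D ⟨v n, h⟩ = v (n + 1)) ∧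
    Dense (Submodule.span ℂ (Set.range v) : Set H)

/-- The unitary `U` gives the canonical form of the pair `(D, ξ)`: it transforms `D` (with its domain)
into the multiplication by the variable in `L²(ℝ, μ)`, where `μ` is a probability measure, and `ξ` into
the constant function `1`. -/
structure IsCanonicalForm (D : H →ₗ.[ℂ] H) (ξ : H) (μ : Measure ℝ) (U : H ≃ₗᵢ[ℂ] Lp ℂ 2 μ) :
    Prop where
  isProbabilityMeasure : IsProbabilityMeasure μ
  mem_domain_iff : ∀ x, x ∈ D.domain ↔ MemLp (fun s : ℝ => (s : ℂ) * U x s) 2 μ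
  map_operator : ∀ x : D.domain, U (D x) =ᵐ[μ] fun s : ℝ => (s : ℂ) * U x s
  map_vector : U ξ =ᵐ[μ] fun _ => 1

/-- A `ℤ/2`-grading of `(D, ξ)`: a selfadjoint unitary `γ` with `γ D = - D γ` and `γ ξ = ξ`. -/
structure IsGrading (D : H →ₗ.[ℂ] H) (ξ : H) (γ : H →L[ℂ] H) : Prop where
  sq_eq_one : ∀ x, γ (γ x) = x
  selfAdjoint : IsSelfAdjoint γ
  anticommute : ∀ x : D.domain, ∃ h : γ x ∈ D.domain, D ⟨γ x, h⟩ = -γ (D x)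
  fix : γ ξ = ξ

/-- The pair `(D, ξ)` is even if it admits a `ℤ/2`-grading. -/
def IsEven (D : H →ₗ.[ℂ] H) (ξ : H) : Prop := ∃ γ : H →L[ℂ] H, IsGrading D ξ γ

end CyclicPairs

end Semilocal

end

open Semilocal

/-!
The action of `Γ` on the ideles has the fundamental domain `R_S^* × ℝ_+^*`, on which the module is the
archimedean coordinate. Hence a `K_S`-invariant vector of `L²(X_S)` is a function of the module
(`exists_eq_comp_modX`), and `wS` identifies `L²(X_S)^{K_S}` with `L²(ℝ_+^*, d^*u)`; in the variable
`log u` the transform `𝔽_μ` is the Fourier transform of `ℝ`.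

*The map `η_S`.* At a unit, the terms of the sum over `Γ_+` which do not vanish are indexed by the
positive integers with all prime factors in `S` (`hasSum_oneTensor_iff`). So `η_S` is a sum of
dilations, and `𝔽_μ` turns it into the multiplication by `∑ n^{-(1/2 - is)}`, the finite Euler product
(`Fmu_sumOp`). Together with the Mellin transform of the Gaussian (`mellin_gaussian`) this shows that
`V_S ξ_S` is constant.

*The cyclic pair.* The unitary `𝔽_μ ∘ wS` turns the scaling group into the multiplications by `e^{its}`,
whose generator is the multiplication by `s` (`isGeneratorValue_iff`). The vectors `𝕊^n ξ_S` become the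
powers of `s`; they are total because the density of `m_S` decays exponentially, as the Gamma function
does on vertical lines (`norm_Gamma_le_exp`), so that moments determine a function
(`ae_eq_zero_of_moments`). A grading fixes the cyclic vector and anticommutes with `𝕊`, which
determines it on all `𝕊^n ξ_S` (`IsCyclicPair.grading_unique`); since the density of `m_S` is even, the
reflection `h(s) ↦ h(-s)` is a grading.

*The Fourier transform.* The scalar product of the classes of two pure tensors unfolds to a sum of
integrals over the adeles, indexed by `Γ` (`inner_cls_cls`). By Plancherel at each place and the product
formula the local Fourier transforms preserve these scalar products (`SBData.inner_hat`). As the classes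
of pure tensors are total (`dense_toL2`), there is a unique isometry `𝔽_S` with the prescribed values; its
square is `x ↦ -x`, which is trivial on classes because `-1 ∈ Γ`. The transform exchanges the actions of
an idele class and of its inverse (`FS_theta`), so it preserves `L²(X_S)^{K_S}` and anticommutes with
`𝕊`. It fixes `ξ_S`, the Gaussian and the functions `1_{ℤ_p}` being their own transforms. Hence its
restriction is the grading, i.e. the reflection.
-/

noncomputable section
namespace Semilocal

/-! ### Weighted composition operators, total families and cyclic pairs -/

section WeightedComposition

variable {α β : Type*} [MeasurableSpace α] [MeasurableSpace β]

theorem eLpNorm_two_sq {μ : Measure α} (f : α → ℂ) :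
    eLpNorm f 2 μ ^ 2 = ∫⁻ x, ‖f x‖ₑ ^ 2 ∂μ := by
  rw [eLpNorm_eq_lintegral_rpow_enorm_toReal (by simp) (by simp)]
  simp only [ENNReal.toReal_ofNat, ENNReal.rpow_ofNat]
  rw [← ENNReal.rpow_natCast, ← ENNReal.rpow_mul]
  norm_num

theorem Lp_norm_sq {μ : Measure α} (f : Lp ℂ 2 μ) :
    ENNReal.ofReal (‖f‖ ^ 2) = ∫⁻ x, ‖f x‖ₑ ^ 2 ∂μ := by
  rw [← eLpNorm_two_sq, Lp.norm_def, ENNReal.ofReal_pow ENNReal.toReal_nonneg,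
    ENNReal.ofReal_toReal (Lp.eLpNorm_ne_top f)]

theorem memLp_two_iff {μ : Measure α} {f : α → ℂ} (hf : AEStronglyMeasurable f μ) :
    MemLp f 2 μ ↔ ∫⁻ x, ‖f x‖ₑ ^ 2 ∂μ < ∞ := by
  rw [← eLpNorm_two_sq, MemLp, and_iff_right hf, ENNReal.pow_lt_top_iff]
  simp

/-- The weighted composition `g ↦ m · (g ∘ φ)` does not increase `L²` norms: the image under `φ` of
the measure `|m|² μ` is bounded by `ν`. -/
structure IsWeightedComp (μ : Measure α) (ν : Measure β) (φ : α → β) (m : α → ℂ) : Prop where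
  measurable_map : Measurable φ
  measurable_weight : Measurable m
  map_le : Measure.map φ (μ.withDensity fun x => ‖m x‖ₑ ^ 2) ≤ ν

variable {μ : Measure α} {ν : Measure β} {φ : α → β} {m : α → ℂ}

namespace IsWeightedComp

theorem ae (h : IsWeightedComp μ ν φ m) {p : β → Prop} (hp : ∀ᵐ y ∂ν, p y) :
    ∀ᵐ x ∂μ, m x ≠ 0 → p (φ x) := by
  have h1 := ae_of_ae_map h.measurable_map.aemeasurable (ae_mono h.map_le hp)
  rw [ae_withDensity_iff (h.measurable_weight.enorm.pow_const 2)] at h1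
  filter_upwards [h1] with x hx hm
  exact hx (by simpa using hm)

theorem lintegral_eq (h : IsWeightedComp μ ν φ m) {g : β → ℂ} (hg : Measurable g) :
    ∫⁻ x, ‖m x * g (φ x)‖ₑ ^ 2 ∂μ
      = ∫⁻ y, ‖g y‖ₑ ^ 2 ∂(Measure.map φ (μ.withDensity fun x => ‖m x‖ₑ ^ 2)) := by
  have hg' : Measurable fun x => ‖g (φ x)‖ₑ ^ 2 := (hg.comp h.measurable_map).enorm.pow_const 2
  rw [lintegral_map (hg.enorm.pow_const 2) h.measurable_map,
    lintegral_withDensity_eq_lintegral_mul _ (h.measurable_weight.enorm.pow_const 2) hg']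
  simp [mul_pow]

theorem memLp (h : IsWeightedComp μ ν φ m) (g : Lp ℂ 2 ν) :
    MemLp (fun x => m x * g (φ x)) 2 μ := by
  have hg := (Lp.stronglyMeasurable g).measurable
  have hm : Measurable fun x => m x * g (φ x) := h.measurable_weight.mul (hg.comp h.measurable_map)
  rw [memLp_two_iff hm.aestronglyMeasurable, h.lintegral_eq hg]
  refine (lintegral_mono' h.map_le le_rfl).trans_lt ?_
  rw [← Lp_norm_sq]
  exact ENNReal.ofReal_lt_top

/-- The bounded operator `g ↦ m · (g ∘ φ)` between `L²` spaces. -/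
def op (h : IsWeightedComp μ ν φ m) : Lp ℂ 2 ν →L[ℂ] Lp ℂ 2 μ :=
  LinearMap.mkContinuous
    { toFun := fun g => (h.memLp g).toLp _
      map_add' := fun f g => by
        rw [← MemLp.toLp_add, MemLp.toLp_eq_toLp_iff]
        filter_upwards [h.ae (Lp.coeFn_add f g)] with x hx
        by_cases hm : m x = 0
        · simp [hm]
        · simp only [hx hm, Pi.add_apply, mul_add]
      map_smul' := fun c g => by
        rw [RingHom.id_apply, ← MemLp.toLp_const_smul, MemLp.toLp_eq_toLp_iff]
        filter_upwards [h.ae (Lp.coeFn_smul c g)] with x hx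
        by_cases hm : m x = 0
        · simp [hm]
        · simp only [hx hm, Pi.smul_apply, smul_eq_mul]
          ring } 1 fun g => by
    rw [one_mul, ← sq_le_sq₀ (norm_nonneg _) (norm_nonneg _),
      ← ENNReal.ofReal_le_ofReal_iff (by positivity), Lp_norm_sq, Lp_norm_sq]
    change ∫⁻ x, ‖(h.memLp g).toLp _ x‖ₑ ^ 2 ∂μ ≤ _
    have : ∫⁻ x, ‖(h.memLp g).toLp _ x‖ₑ ^ 2 ∂μ = ∫⁻ x, ‖m x * g (φ x)‖ₑ ^ 2 ∂μ := by
      refine lintegral_congr_ae ?_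
      filter_upwards [(h.memLp g).coeFn_toLp] with x hx
      rw [hx]
    rw [this, h.lintegral_eq (Lp.stronglyMeasurable g).measurable]
    exact lintegral_mono' h.map_le le_rfl

theorem coeFn_op (h : IsWeightedComp μ ν φ m) (g : Lp ℂ 2 ν) :
    h.op g =ᵐ[μ] fun x => m x * g (φ x) :=
  (h.memLp g).coeFn_toLp

theorem op_eq_iff (h : IsWeightedComp μ ν φ m) {g : Lp ℂ 2 ν} {f : Lp ℂ 2 μ} :
    h.op g = f ↔ f =ᵐ[μ] fun x => m x * g (φ x) := by
  rw [Lp.ext_iff]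
  exact ⟨fun H => H.symm.trans (h.coeFn_op g), fun H => (h.coeFn_op g).trans H.symm⟩

theorem coeFn_op_of_ae (h : IsWeightedComp μ ν φ m) {g : Lp ℂ 2 ν} {f : β → ℂ} (hf : g =ᵐ[ν] f) :
    h.op g =ᵐ[μ] fun x => m x * f (φ x) := by
  filter_upwards [h.coeFn_op g, h.ae hf] with x hx hx'
  rw [hx]
  by_cases hm : m x = 0
  · simp [hm]
  · rw [hx' hm]

theorem norm_op (h : IsWeightedComp μ ν φ m)
    (he : Measure.map φ (μ.withDensity fun x => ‖m x‖ₑ ^ 2) = ν) (g : Lp ℂ 2 ν) :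
    ‖h.op g‖ = ‖g‖ := by
  rw [← sq_eq_sq₀ (norm_nonneg _) (norm_nonneg _), ← ENNReal.ofReal_eq_ofReal_iff (by positivity)
    (by positivity), Lp_norm_sq, Lp_norm_sq]
  have : ∫⁻ x, ‖h.op g x‖ₑ ^ 2 ∂μ = ∫⁻ x, ‖m x * g (φ x)‖ₑ ^ 2 ∂μ := by
    refine lintegral_congr_ae ?_
    filter_upwards [h.coeFn_op g] with x hx
    rw [hx]
  rw [this, h.lintegral_eq (Lp.stronglyMeasurable g).measurable, he]

end IsWeightedComp

/-- When the image of `|m|² μ` under `φ` is exactly `ν`, the weighted composition is isometric. -/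
theorem isWeightedComp_of_eq (hφ : Measurable φ) (hm : Measurable m)
    (he : Measure.map φ (μ.withDensity fun x => ‖m x‖ₑ ^ 2) = ν) : IsWeightedComp μ ν φ m :=
  ⟨hφ, hm, he.le⟩

theorem _root_.MeasureTheory.MeasurePreserving.map_withDensity_one (h : MeasurePreserving φ μ ν) :
    Measure.map φ (μ.withDensity fun _ => ‖(1 : ℂ)‖ₑ ^ 2) = ν := by
  simp [h.map_eq]

/-- The weighted composition operator as a unitary, when it is isometric and has an inverse of the
same form. -/
def weightedEquiv {ψ : β → α} {n : β → ℂ}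
    (hφ : Measurable φ) (hm : Measurable m)
    (he : Measure.map φ (μ.withDensity fun x => ‖m x‖ₑ ^ 2) = ν)
    (h' : IsWeightedComp ν μ ψ n) (h1 : ∀ᵐ y ∂ν, n y * m (ψ y) = 1 ∧ φ (ψ y) = y)
    (h2 : ∀ᵐ x ∂μ, m x * n (φ x) = 1 ∧ ψ (φ x) = x) :
    Lp ℂ 2 ν ≃ₗᵢ[ℂ] Lp ℂ 2 μ where
  toFun := (isWeightedComp_of_eq hφ hm he).op
  map_add' := map_add _
  map_smul' := map_smul _
  invFun := h'.op
  norm_map' := (isWeightedComp_of_eq hφ hm he).norm_op he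
  left_inv g := by
    rw [h'.op_eq_iff]
    have := h'.ae ((isWeightedComp_of_eq hφ hm he).coeFn_op g)
    filter_upwards [this, h1] with y hy h1
    rw [hy (left_ne_zero_of_mul_eq_one h1.1), h1.2, ← mul_assoc, h1.1, one_mul]
  right_inv g := by
    rw [(isWeightedComp_of_eq hφ hm he).op_eq_iff]
    have := (isWeightedComp_of_eq hφ hm he).ae (h'.coeFn_op g)
    filter_upwards [this, h2] with y hy h1
    rw [hy (left_ne_zero_of_mul_eq_one h1.1), h1.2, ← mul_assoc, h1.1, one_mul]

end WeightedComposition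

section Gram

/-- Bounded operators which agree on a total family are equal. -/
theorem ext_of_dense_span {H ι : Type*} [NormedAddCommGroup H] [InnerProductSpace ℂ H]
    {F : Type*} [NormedAddCommGroup F] [NormedSpace ℂ F] {a : ι → H}
    (ha : Dense (Submodule.span ℂ (Set.range a) : Set H))
    {A B : H →L[ℂ] F} (h : ∀ i, A (a i) = B (a i)) : A = B :=
  ContinuousLinearMap.ext_on ha (by rintro _ ⟨i, rfl⟩; exact h i)

variable {H ι : Type*} [NormedAddCommGroup H] [InnerProductSpace ℂ H] [CompleteSpace H]

/-- Two families with the same Gram matrix, the first of them total, are related by an isometry. -/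
theorem exists_isometry_of_gram {a b : ι → H}
    (ha : Dense (Submodule.span ℂ (Set.range a) : Set H))
    (h : ∀ i j, inner ℂ (a i) (a j) = inner ℂ (b i) (b j)) :
    ∃ T : H →ₗᵢ[ℂ] H, ∀ i, T (a i) = b i := by
  let A := Finsupp.linearCombination ℂ a
  let B := Finsupp.linearCombination ℂ b
  have hAB : ∀ x, ‖A x‖ = ‖B x‖ := by
    intro x
    have : inner ℂ (A x) (A x) = inner ℂ (B x) (B x) := by
      simp only [A, B, Finsupp.linearCombination_apply, Finsupp.sum, sum_inner, inner_sum,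
        inner_smul_left, inner_smul_right, h]
    rw [inner_self_eq_norm_sq_to_K, inner_self_eq_norm_sq_to_K] at this
    have h2 : ‖A x‖ ^ 2 = ‖B x‖ ^ 2 := by exact_mod_cast this
    exact (sq_eq_sq₀ (norm_nonneg _) (norm_nonneg _)).1 h2
  have hd : DenseRange A := by
    rw [DenseRange, ← LinearMap.coe_range, Finsupp.range_linearCombination]; exact ha
  have hb : ∀ x, ‖B x‖ ≤ 1 * ‖A x‖ := fun x => by rw [one_mul, hAB]
  have hT : ∀ x, B.extendOfNorm A (A x) = B x := fun x => LinearMap.extendOfNorm_eq hd ⟨1, hb⟩ x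
  refine ⟨⟨(B.extendOfNorm A).toLinearMap, fun y => ?_⟩, fun i => ?_⟩
  · refine hd.induction_on (p := fun y => ‖B.extendOfNorm A y‖ = ‖y‖) y ?_ ?_
    · exact isClosed_eq (by fun_prop) (by fun_prop)
    · intro x; rw [hT, hAB]
  · have := hT (Finsupp.single i 1)
    simpa [A, B] using this

end Gram

section Cyclic

variable {H : Type*} [NormedAddCommGroup H] [InnerProductSpace ℂ H] [CompleteSpace H]

/-- A grading is determined on the cyclic vectors by `γ (D ^ n ξ) = (-1) ^ n D ^ n ξ`. -/
theorem IsCyclicPair.grading_unique {D : H →ₗ.[ℂ] H} {ξ : H} (h : IsCyclicPair D ξ)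
    {γ γ' : H →L[ℂ] H} (hγ : IsGrading D ξ γ) (hγ' : IsGrading D ξ γ') : γ = γ' := by
  obtain ⟨v, h0, hv, hd⟩ := h.cyclic
  refine ext_of_dense_span hd fun n => ?_
  induction n with
  | zero => rw [h0, hγ.fix, hγ'.fix]
  | succ n ih =>
    obtain ⟨hn, hD⟩ := hv n
    obtain ⟨h1, e1⟩ := hγ.anticommute ⟨v n, hn⟩
    obtain ⟨h2, e2⟩ := hγ'.anticommute ⟨v n, hn⟩
    rw [← hD, ← neg_inj, ← e1, ← e2]
    congr 1
    exact Subtype.ext ih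

/-- A symmetric densely defined operator `D` such that `D + i` and `D - i` are onto is selfadjoint. -/
theorem isSelfAdjoint_of_surjective {D : H →ₗ.[ℂ] H} (hd : Dense (D.domain : Set H))
    (hs : ∀ x y : D.domain, inner ℂ (D x) (y : H) = inner ℂ (x : H) (D y))
    (h1 : ∀ y, ∃ x : D.domain, D x + Complex.I • (x : H) = y)
    (h2 : ∀ y, ∃ x : D.domain, D x - Complex.I • (x : H) = y) : IsSelfAdjoint D := by
  have hle : D ≤ D.adjoint := by
    refine LinearPMap.IsFormalAdjoint.le_adjoint hd fun x y => ?_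
    exact hs x y
  rw [LinearPMap.isSelfAdjoint_def]
  refine le_antisymm ?_ hle
  refine LinearPMap.le_of_eqLocus_ge fun y hy => ?_
  obtain ⟨z, hz⟩ := h1 (D.adjoint ⟨y, hy⟩ + Complex.I • y)
  have hyz : y = z := by
    obtain ⟨x, hx⟩ := h2 (y - z)
    have e1 : inner ℂ (D.adjoint ⟨y, hy⟩) (x : H) = inner ℂ y (D x) :=
      LinearPMap.adjoint_isFormalAdjoint hd ⟨y, hy⟩ x
    have e2 := hs z x
    rw [← sub_eq_zero, ← inner_self_eq_zero (𝕜 := ℂ)]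
    nth_rewrite 2 [← hx]
    have e3 : inner ℂ (D.adjoint ⟨y, hy⟩ + Complex.I • y) (x : H)
      = inner ℂ (D z + Complex.I • (z : H)) (x : H) := by rw [hz]
    simp only [inner_add_left, inner_sub_left, inner_sub_right, inner_smul_left,
      inner_smul_right, Complex.conj_I] at e3 ⊢
    rw [← e1, ← e2]
    linear_combination e3
  have hyd : y ∈ D.domain := hyz ▸ z.2
  exact ⟨hy, hyd, ((hle.2 (x := ⟨y, hyd⟩) (y := ⟨y, hy⟩) rfl)).symm⟩

end Cyclic

/-! ### The space of `K_S`-invariant vectors as `L²(ℝ_+^*, d^*u)` -/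

theorem map_withDensity_comp {α β : Type*} [MeasurableSpace α] [MeasurableSpace β] {μ : Measure α}
    {φ : α → β} (hφ : Measurable φ) {f : β → ℝ≥0∞} (hf : Measurable f) :
    Measure.map φ (μ.withDensity fun x => f (φ x)) = (Measure.map φ μ).withDensity f := by
  ext s hs
  rw [Measure.map_apply hφ hs, withDensity_apply _ (hφ hs), withDensity_apply _ hs,
    setLIntegral_map hs hf hφ]

section Dstar

/-- The exponential identifies the additive group `ℝ` with `ℝ_+^*`, and Lebesgue measure with `d^*u`. -/
theorem map_exp_volume : Measure.map Real.exp volume = dstar := by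
  ext s hs
  have h := lintegral_image_eq_lintegral_abs_deriv_mul (s := Set.univ) (f := Real.exp)
    (f' := Real.exp) MeasurableSet.univ (fun x _ => (Real.hasDerivAt_exp x).hasDerivWithinAt)
    Real.exp_injective.injOn (s.indicator fun u => ENNReal.ofReal u⁻¹)
  rw [Set.image_univ, Real.range_exp, Measure.restrict_univ] at h
  rw [dstar, withDensity_apply _ hs, ← lintegral_indicator hs, h,
    Measure.map_apply Real.measurable_exp hs, ← lintegral_indicator_one (Real.measurable_exp hs)]
  refine lintegral_congr fun x => ?_
  by_cases hx : Real.exp x ∈ s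
  · rw [Set.indicator_of_mem hx, Set.indicator_of_mem (show x ∈ Real.exp ⁻¹' s from hx),
      abs_of_pos (Real.exp_pos x), ← ENNReal.ofReal_mul (Real.exp_pos x).le,
      mul_inv_cancel₀ (Real.exp_pos x).ne', ENNReal.ofReal_one, Pi.one_apply]
  · rw [Set.indicator_of_notMem hx, Set.indicator_of_notMem (show x ∉ Real.exp ⁻¹' s from hx),
      mul_zero]

theorem measurePreserving_exp : MeasurePreserving Real.exp volume dstar :=
  ⟨Real.measurable_exp, map_exp_volume⟩

theorem dstar_ae_pos : ∀ᵐ u ∂dstar, 0 < u := by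
  rw [← map_exp_volume, ae_map_iff Real.measurable_exp.aemeasurable measurableSet_Ioi]
  exact Eventually.of_forall Real.exp_pos

theorem map_mul_dstar {a : ℝ} (ha : 0 < a) : Measure.map (fun u => a * u) dstar = dstar := by
  have h : (fun u => a * u) ∘ Real.exp = Real.exp ∘ fun x => Real.log a + x := by
    ext x; simp [Real.exp_add, Real.exp_log ha]
  rw [← map_exp_volume, Measure.map_map (measurable_const_mul a) Real.measurable_exp, h,
    ← Measure.map_map Real.measurable_exp (measurable_const_add _), map_add_left_eq_self]

theorem map_withDensity_dil {a : ℝ} (ha : 0 < a) :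
    Measure.map (fun u => a * u) (dstar.withDensity fun _ => ‖(1 : ℂ)‖ₑ ^ 2) = dstar :=
  MeasurePreserving.map_withDensity_one ⟨measurable_const_mul a, map_mul_dstar ha⟩

/-- The dilation `g ↦ g(a ·)` of `L²(ℝ_+^*, d^*u)`. -/
def dil {a : ℝ} (ha : 0 < a) : Lp ℂ 2 dstar →L[ℂ] Lp ℂ 2 dstar :=
  (isWeightedComp_of_eq (measurable_const_mul a) measurable_const (map_withDensity_dil ha)).op

theorem dil_apply {a : ℝ} (ha : 0 < a) (g : Lp ℂ 2 dstar) :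
    dil ha g =ᵐ[dstar] fun u => g (a * u) := by
  have := (isWeightedComp_of_eq (measurable_const_mul a) measurable_const
    (map_withDensity_dil ha)).coeFn_op g
  simp only [one_mul] at this
  exact this

theorem norm_dil {a : ℝ} (ha : 0 < a) (g : Lp ℂ 2 dstar) : ‖dil ha g‖ = ‖g‖ :=
  (isWeightedComp_of_eq (measurable_const_mul a) measurable_const
    (map_withDensity_dil ha)).norm_op (map_withDensity_dil ha) g

end Dstar

section Spaces

variable (S : Finset Nat.Primes)

instance haarP_sigmaFinite (p : ℕ) [Fact p.Prime] : SigmaFinite (haarP p) := by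
  unfold haarP; infer_instance

/-- The Haar measure of `∏_{p ∈ S} ℚ_p`. -/
def haarFin : Measure ((p : S) → ℚ_[(p : Nat.Primes)]) :=
  Measure.pi fun p : S => haarP (p : Nat.Primes)

instance : SigmaFinite (haarFin S) := by unfold haarFin; infer_instance
instance : SigmaFinite (haarA S) := by unfold haarA; infer_instance

theorem haarA_eq : haarA S = (volume : Measure ℝ).prod (haarFin S) := rfl

/-- The group `R_S^*` of units, as a subset of `∏_{p ∈ S} ℚ_p`. -/
def unitsFin : Set ((p : S) → ℚ_[(p : Nat.Primes)]) := {y | ∀ p, ‖y p‖ = 1}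

theorem measurableSet_unitsFin : MeasurableSet (unitsFin S) := by
  have : unitsFin S = ⋂ p : S, {y | ‖y p‖ = 1} := by ext; simp [unitsFin]
  rw [this]
  exact MeasurableSet.iInter fun p =>
    measurableSet_eq_fun (measurable_pi_apply p).norm measurable_const

/-- The volume of `R_S^*`. -/
def vol : ℝ≥0∞ := ∏ p : S, ENNReal.ofReal (1 - (((p : Nat.Primes) : ℕ) : ℝ)⁻¹)

theorem vol_ne_zero : vol S ≠ 0 := by
  refine Finset.prod_ne_zero_iff.2 fun p _ => ?_
  rw [Ne, ENNReal.ofReal_eq_zero, not_le, sub_pos]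
  exact inv_lt_one_of_one_lt₀ (by exact_mod_cast p.1.2.one_lt)

theorem vol_ne_top : vol S ≠ ∞ := ENNReal.prod_ne_top fun _ _ => ENNReal.ofReal_ne_top

theorem haarP_sphere (p : ℕ) [hp : Fact p.Prime] :
    haarP p {x | ‖x‖ = 1} = ENNReal.ofReal (1 - (p : ℝ)⁻¹) := by
  have h1 : {x : ℚ_[p] | ‖x‖ = 1} = Metric.closedBall 0 1 \ Metric.ball 0 1 := by
    ext x; simp [le_antisymm_iff]
  have hb : haarP p (Metric.ball 0 1) = (p : ℝ≥0∞)⁻¹ :=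
    ENNReal.eq_inv_of_mul_eq_one_left (by rw [mul_comm]; exact haarP_ball_one p)
  have hpr : (0 : ℝ) < p := by exact_mod_cast hp.out.pos
  rw [h1, measure_sdiff Metric.ball_subset_closedBall Metric.isOpen_ball.nullMeasurableSet
    (Metric.isBounded_ball.measure_lt_top).ne, haarP_closedBall_one, hb,
    ENNReal.ofReal_sub _ (by positivity), ENNReal.ofReal_one, ENNReal.ofReal_inv_of_pos hpr,
    ENNReal.ofReal_natCast]

theorem haarFin_unitsFin : haarFin S (unitsFin S) = vol S := by
  have : unitsFin S = Set.univ.pi fun p : S => {x : ℚ_[(p : Nat.Primes)] | ‖x‖ = 1} := by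
    ext; simp [unitsFin]
  rw [this, haarFin, Measure.pi_pi]
  exact Finset.prod_congr rfl fun p _ => haarP_sphere _

theorem muX_eq : muX S = (vol S)⁻¹ • Measure.map (proj S) ((haarA S).restrict (fundDomain S)) := rfl

/-- Almost everywhere properties on `X_S` lift to the adeles. -/
theorem ae_proj {P : X S → Prop} (h : ∀ᵐ x ∂muX S, P x) : ∀ᵐ x ∂haarA S, P (proj S x) := by
  rw [muX_eq, Measure.ae_ennreal_smul_measure_iff (by simp [vol_ne_top])] at h
  obtain ⟨t, ht, htm, ht0⟩ := exists_measurable_superset_of_null h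
  rw [Measure.map_apply (measurable_proj S) htm,
    Measure.restrict_apply (measurable_proj S htm)] at ht0
  refine measure_mono_null (t := proj S ⁻¹' t) (fun x hx => ht hx) ?_
  refine (isFundamentalDomain S).measure_zero_of_invariant _ (fun g => ?_) ht0
  ext x
  rw [Set.mem_smul_set_iff_inv_smul_mem]
  have : proj S (g⁻¹ • x) = proj S x := Quotient.sound ⟨g⁻¹, rfl⟩
  rw [Set.mem_preimage, Set.mem_preimage, this]

/-- Properties which hold almost everywhere on the fundamental domain descend to `X_S`. -/
theorem ae_of_ae_proj {P : X S → Prop} (hP : MeasurableSet {x | P x})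
    (h : ∀ᵐ x ∂(haarA S).restrict (fundDomain S), P (proj S x)) : ∀ᵐ x ∂muX S, P x := by
  rw [muX_eq, Measure.ae_ennreal_smul_measure_iff (by simp [vol_ne_top]),
    ae_map_iff (measurable_proj S).aemeasurable hP]
  exact h

theorem lintegral_muX {F : X S → ℝ≥0∞} (hF : Measurable F) :
    ∫⁻ x, F x ∂muX S = (vol S)⁻¹ * ∫⁻ x in fundDomain S, F (proj S x) ∂haarA S := by
  rw [muX_eq, lintegral_smul_measure, lintegral_map hF (measurable_proj S), smul_eq_mul]

theorem integral_muX {F : X S → ℂ} (hF : Measurable F) :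
    ∫ x, F x ∂muX S = (((vol S)⁻¹).toReal : ℂ) * ∫ x in fundDomain S, F (proj S x) ∂haarA S := by
  rw [muX_eq, integral_smul_measure,
    integral_map (measurable_proj S).aemeasurable hF.aestronglyMeasurable]
  rfl

/-- The module as a function on `X_S`. -/
def modX : X S → ℝ := Quotient.lift (modA S) (by
  rintro _ x ⟨g, rfl⟩
  exact modA_smul S g x)

theorem modX_proj (x : Adele S) : modX S (proj S x) = modA S x := rfl

theorem measurable_modA : Measurable (modA S) := by
  unfold modA
  exact measurable_fst.norm.mul (Finset.measurable_prod _ fun p _ =>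
    ((measurable_pi_apply p).comp measurable_snd).norm)

theorem measurable_modX : Measurable (modX S) :=
  measurable_from_quotient.2 (measurable_modA S)

theorem modX_act (c : CS S) (x : X S) : modX S (act S c x) = modC S c * modX S x := by
  induction c using QuotientGroup.induction_on with
  | H a =>
    induction x using Quotient.inductionOn with
    | h x => exact modA_mul S a x

/-- On the fundamental domain the module is the archimedean coordinate. -/
theorem modA_of_mem {x : Adele S} (hx : x ∈ fundDomain S) : modA S x = x.1 := by
  rw [modA, Finset.prod_eq_one fun p _ => hx.2 p, mul_one, abs_of_pos hx.1]

/-- The image of the normalized measure of `X_S` under the module is Lebesgue measure on `(0, ∞)`. -/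
theorem map_modX : Measure.map (modX S) (muX S) = volume.restrict (Set.Ioi 0) := by
  ext s hs
  rw [muX_eq, Measure.map_smul, Measure.map_map (measurable_modX S) (measurable_proj S),
    Measure.smul_apply, Measure.map_apply ((measurable_modX S).comp (measurable_proj S)) hs,
    Measure.restrict_apply (((measurable_modX S).comp (measurable_proj S)) hs),
    Measure.restrict_apply hs]
  have : (modX S ∘ proj S) ⁻¹' s ∩ fundDomain S = (s ∩ Set.Ioi 0) ×ˢ unitsFin S := by
    ext x
    constructor
    · rintro ⟨h1, h2⟩
      have h3 : modA S x ∈ s := h1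
      rw [modA_of_mem S h2] at h3
      exact ⟨⟨h3, h2.1⟩, h2.2⟩
    · rintro ⟨⟨h1, h2⟩, h3⟩
      refine ⟨?_, h2, h3⟩
      change modA S x ∈ s
      rwa [modA_of_mem S ⟨h2, h3⟩]
  rw [this, haarA_eq, Measure.prod_prod, haarFin_unitsFin, smul_eq_mul, mul_comm, mul_assoc,
    ENNReal.mul_inv_cancel (vol_ne_zero S) (vol_ne_top S), mul_one]

theorem ae_modX_pos : ∀ᵐ x ∂muX S, 0 < modX S x := by
  have : ∀ᵐ u ∂Measure.map (modX S) (muX S), 0 < u := by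
    rw [map_modX]; exact ae_restrict_mem measurableSet_Ioi
  exact ae_of_ae_map (measurable_modX S).aemeasurable this

theorem enorm_rpow_half_sq {u : ℝ} (hu : 0 < u) (r : ℝ) :
    ‖((u ^ r : ℝ) : ℂ)‖ₑ ^ 2 = ENNReal.ofReal (u ^ (2 * r)) := by
  rw [← ofReal_norm, Complex.norm_real, Real.norm_of_nonneg (by positivity),
    ← ENNReal.ofReal_pow (by positivity), mul_comm, Real.rpow_mul hu.le]
  norm_cast

theorem map_withDensity_modX :
    Measure.map (modX S)
      ((muX S).withDensity fun x => ‖((modX S x ^ (-(1 / 2) : ℝ) : ℝ) : ℂ)‖ₑ ^ 2) = dstar := by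
  rw [map_withDensity_comp (f := fun u : ℝ => ‖((u ^ (-(1 / 2) : ℝ) : ℝ) : ℂ)‖ₑ ^ 2)
    (measurable_modX S) (by fun_prop), map_modX, dstar]
  refine withDensity_congr_ae ?_
  filter_upwards [ae_restrict_mem measurableSet_Ioi] with u hu
  rw [enorm_rpow_half_sq hu]
  norm_num
  rw [Real.rpow_neg_one]

theorem isWeightedComp_fromMod : IsWeightedComp (muX S) dstar (modX S)
    fun x => ((modX S x ^ (-(1 / 2) : ℝ) : ℝ) : ℂ) :=
  isWeightedComp_of_eq (measurable_modX S)
    (Complex.measurable_ofReal.comp ((measurable_modX S).pow_const _)) (map_withDensity_modX S)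

/-- The isometry `g ↦ |x|^{-1/2} g(|x|)` from `L²(ℝ_+^*, d^*u)` to `L²(X_S)`. -/
def fromMod : Lp ℂ 2 dstar →L[ℂ] L2X S := (isWeightedComp_fromMod S).op

theorem fromMod_apply (g : Lp ℂ 2 dstar) :
    fromMod S g =ᵐ[muX S] fun x => ((modX S x ^ (-(1 / 2) : ℝ) : ℝ) : ℂ) * g (modX S x) :=
  (isWeightedComp_fromMod S).coeFn_op g

theorem norm_fromMod (g : Lp ℂ 2 dstar) : ‖fromMod S g‖ = ‖g‖ :=
  (isWeightedComp_fromMod S).norm_op (map_withDensity_modX S) g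

/-- On functions of the module an idele class acts through its module only, by dilation. -/
theorem theta_fromMod (c : CS S) (g : Lp ℂ 2 dstar) :
    theta S c (fromMod S g) = fromMod S (dil (modC_pos S c) g) := by
  have hc := modC_pos S c
  apply Lp.ext
  have h1 := (isWeightedComp_fromMod S).ae (dil_apply hc g)
  filter_upwards [theta_apply S c (fromMod S g), (qmp_act S c).ae (fromMod_apply S g),
    fromMod_apply S (dil hc g), ae_modX_pos S, h1] with x h1 h2 h3 h4 h5
  have h6 : ((modX S x ^ (-(1 / 2) : ℝ) : ℝ) : ℂ) ≠ 0 := by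
    exact_mod_cast (Real.rpow_pos_of_pos h4 _).ne'
  rw [h1, h2, h3, h5 h6, modX_act, ← mul_assoc]
  congr 1
  rw [← Complex.ofReal_mul, Real.mul_rpow hc.le h4.le, ← mul_assoc, ← Real.rpow_add hc]
  simp

theorem fromMod_mem (g : Lp ℂ 2 dstar) : fromMod S g ∈ HS S := by
  rw [mem_HS]
  intro k hk
  have hk1 : modC S k = 1 := hk
  rw [theta_fromMod]
  congr 1
  apply Lp.ext
  filter_upwards [dil_apply (modC_pos S k) g] with u hu
  rw [hu, hk1, one_mul]

/-- The idele with archimedean component `1` and given components at the finite places. -/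
def finIdele (k : (p : S) → ℚ_[(p : Nat.Primes)]) (hk : k ∈ unitsFin S) : (Adele S)ˣ :=
  ⟨(1, k), (1, fun p => (k p)⁻¹), by
    have : ∀ p, k p ≠ 0 := fun p h => by simpa [h] using hk p
    ext <;> simp [this], by
    have : ∀ p, k p ≠ 0 := fun p h => by simpa [h] using hk p
    ext <;> simp [this]⟩

theorem modA_finIdele (k : (p : S) → ℚ_[(p : Nat.Primes)]) (hk : k ∈ unitsFin S) :
    modA S (finIdele S k hk) = 1 := by
  simp only [modA, finIdele, abs_one, one_mul]
  exact Finset.prod_eq_one fun p _ => hk p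

/-- Multiplication by a unit preserves the Haar measure of `R_S^*`. -/
theorem measurePreserving_mul_unit (k : (p : S) → ℚ_[(p : Nat.Primes)]) (hk : k ∈ unitsFin S) :
    MeasurePreserving (fun y => y * k) ((haarFin S).restrict (unitsFin S))
      ((haarFin S).restrict (unitsFin S)) := by
  have hm : Measurable fun y : (p : S) → ℚ_[(p : Nat.Primes)] => y * k :=
    (continuous_mul_const k).measurable
  refine ⟨hm, ?_⟩
  ext s hs
  rw [Measure.map_apply hm hs, Measure.restrict_apply (hm hs), Measure.restrict_apply hs]
  have h1 : (fun y => y * k) ⁻¹' s ∩ unitsFin S = (fun y => y * k) ⁻¹' (s ∩ unitsFin S) := by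
    ext y
    simp only [Set.mem_inter_iff, Set.mem_preimage, and_congr_right_iff]
    intro _
    simp only [unitsFin, Set.mem_ofPred_eq, Pi.mul_apply, norm_mul, hk _, mul_one]
  rw [h1]
  have h2 := haarA_preimage S (finIdele S k hk) (Set.Icc 0 1 ×ˢ (s ∩ unitsFin S))
  have h3 : mulIdele S (finIdele S k hk) ⁻¹' (Set.Icc 0 1 ×ˢ (s ∩ unitsFin S))
      = Set.Icc 0 1 ×ˢ ((fun y => y * k) ⁻¹' (s ∩ unitsFin S)) := by
    ext x
    simp [mulIdele_apply, finIdele, mul_comm]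
  rw [h3, modA_finIdele, haarA_eq, Measure.prod_prod, Measure.prod_prod] at h2
  simpa using h2

/-- A `K_S`-invariant element of `L²(X_S)` is almost everywhere a function of the module: its value
is the mean over `R_S^*`. -/
theorem exists_eq_comp_modX (ξ : HS S) :
    ∃ G : ℝ → ℂ, Measurable G ∧ (ξ : L2X S) =ᵐ[muX S] fun x => G (modX S x) := by
  set f : Adele S → ℂ := fun x => (ξ : L2X S) (proj S x) with hf
  have hξm : Measurable (ξ : L2X S) := (Lp.stronglyMeasurable _).measurable
  have hfm : Measurable f := hξm.comp (measurable_proj S)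
  set νU := (haarFin S).restrict (unitsFin S) with hνU
  have hfin : IsFiniteMeasure νU := ⟨by
    rw [hνU, Measure.restrict_apply_univ, haarFin_unitsFin]; exact (vol_ne_top S).lt_top⟩
  have hcm : Measurable fun z : ((p : S) → ℚ_[(p : Nat.Primes)]) × Adele S =>
      ((z.2.1, z.1 * z.2.2) : Adele S) :=
    Continuous.measurable (by fun_prop)
  have h1 : ∀ᵐ k ∂νU, ∀ᵐ x ∂haarA S, f (x.1, k * x.2) = f x := by
    filter_upwards [ae_restrict_mem (measurableSet_unitsFin S)] with k hk
    have hK : (QuotientGroup.mk (finIdele S k hk) : CS S) ∈ KS S := modA_finIdele S k hk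
    have h2 := theta_apply S (QuotientGroup.mk (finIdele S k hk)) (ξ : L2X S)
    rw [(mem_HS S).1 ξ.2 _ hK] at h2
    filter_upwards [ae_proj S h2] with x hx
    have : act S (QuotientGroup.mk (finIdele S k hk)) (proj S x) = proj S (x.1, k * x.2) := by
      rw [act_mk]; congr 1; ext <;> simp [finIdele]
    rw [this, modC_mk, modA_finIdele, Real.one_rpow, Complex.ofReal_one, one_mul] at hx
    exact hx.symm
  -- for almost every `x`, the function does not change under almost every unit `k`
  rw [Measure.ae_ae_comm (p := fun k (x : Adele S) => f (x.1, k * x.2) = f x)] at h1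
  swap
  · exact measurableSet_eq_fun (hfm.comp hcm) (hfm.comp measurable_snd)
  let G : ℝ → ℂ := fun t => (((vol S).toReal⁻¹ : ℝ) : ℂ) * ∫ k, f (t, k) ∂νU
  have hGm : Measurable G := by
    refine Measurable.const_mul ?_ _
    exact (hfm.stronglyMeasurable.integral_prod_right' (ν := νU)).measurable
  refine ⟨G, hGm, ae_of_ae_proj S (measurableSet_eq_fun hξm (hGm.comp (measurable_modX S))) ?_⟩
  filter_upwards [ae_restrict_of_ae h1, ae_restrict_mem (measurableSet_fundDomain S)] with x hx hxF
  rw [modX_proj, modA_of_mem S hxF]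
  change f x = (((vol S).toReal⁻¹ : ℝ) : ℂ) * ∫ k, f (x.1, k) ∂νU
  have hx2 : x.2 ∈ unitsFin S := hxF.2
  have hmp := measurePreserving_mul_unit S x.2 hx2
  have e1 : ∫ k, f (x.1, k) ∂νU = ∫ k, f (x.1, k * x.2) ∂νU := by
    rw [← integral_map (φ := fun k => k * x.2) (f := fun k => f (x.1, k)) (μ := νU)
      hmp.measurable.aemeasurable
      (hfm.comp (measurable_const.prodMk measurable_id)).aestronglyMeasurable, hmp.map_eq]
  rw [e1, integral_congr_ae hx, integral_const, Measure.real, hνU, Measure.restrict_apply_univ,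
    haarFin_unitsFin, Complex.real_smul, ← mul_assoc, ← Complex.ofReal_mul, inv_mul_cancel₀,
    Complex.ofReal_one, one_mul]
  exact (ENNReal.toReal_pos (vol_ne_zero S) (vol_ne_top S)).ne'

/-- An invariant vector is a function `G(|x|)`, and comes from `u^{1/2} G(u)`. -/
theorem fromMod_surjective (ξ : HS S) : ∃ g, fromMod S g = ξ := by
  obtain ⟨G, hG, hξ⟩ := exists_eq_comp_modX S ξ
  have hgm : Measurable fun u : ℝ => ((u ^ (1 / 2 : ℝ) : ℝ) : ℂ) * G u := by fun_prop
  have h1 : (ξ : L2X S) =ᵐ[muX S] fun x => ((modX S x ^ (-(1 / 2) : ℝ) : ℝ) : ℂ) *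
      (((modX S x ^ (1 / 2 : ℝ) : ℝ) : ℂ) * G (modX S x)) := by
    filter_upwards [hξ, ae_modX_pos S] with x hx hp
    rw [hx, ← mul_assoc, ← Complex.ofReal_mul, ← Real.rpow_add hp]
    simp
  have hg : MemLp (fun u : ℝ => ((u ^ (1 / 2 : ℝ) : ℝ) : ℂ) * G u) 2 dstar := by
    rw [memLp_two_iff hgm.aestronglyMeasurable]
    have := (isWeightedComp_fromMod S).lintegral_eq hgm
    rw [map_withDensity_modX] at this
    rw [← this, lintegral_congr_ae (g := fun x => ‖(ξ : L2X S) x‖ₑ ^ 2), ← Lp_norm_sq]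
    · exact ENNReal.ofReal_lt_top
    · filter_upwards [h1] with x hx
      rw [hx]
  refine ⟨hg.toLp _, ((isWeightedComp_fromMod S).op_eq_iff).2 ?_⟩
  filter_upwards [h1, (isWeightedComp_fromMod S).ae hg.coeFn_toLp, ae_modX_pos S] with x hx h2 hp
  rw [hx, h2 (by exact_mod_cast (Real.rpow_pos_of_pos hp _).ne')]

/-- The inverse of the unitary `w_S`. -/
def wSinv : Lp ℂ 2 dstar ≃ₗᵢ[ℂ] HS S :=
  LinearIsometryEquiv.ofSurjective
    ⟨(fromMod S).toLinearMap.codRestrict (HS S) (fromMod_mem S), norm_fromMod S⟩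
    fun ξ => by
      obtain ⟨g, hg⟩ := fromMod_surjective S ξ
      exact ⟨g, Subtype.ext hg⟩

theorem coe_wSinv (g : Lp ℂ 2 dstar) : (wSinv S g : L2X S) = fromMod S g := rfl

/-- The unitary `w_S`. -/
def wS : HS S ≃ₗᵢ[ℂ] Lp ℂ 2 dstar := (wSinv S).symm

theorem fromMod_wS (ξ : HS S) : fromMod S (wS S ξ) = ξ := by
  rw [← coe_wSinv, wS, LinearIsometryEquiv.apply_symm_apply]

theorem ae_modA_pos : ∀ᵐ x ∂haarA S, 0 < modA S x := by
  filter_upwards [ae_isUnit S] with x hx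
  exact mul_pos (abs_pos.2 hx.1) (Finset.prod_pos fun p _ => norm_pos_iff.2 (hx.2 p))

theorem isWS_wS : IsWS S (wS S) := by
  intro ξ
  have h := fromMod_apply S (wS S ξ)
  rw [fromMod_wS] at h
  filter_upwards [ae_proj S h, ae_modA_pos S] with x hx hp
  rw [hx, modX_proj, ← mul_assoc, ← Complex.ofReal_mul, ← Real.rpow_add hp]
  simp

/-- `L²(X_S)^{K_S}` is stable under `C_S`. -/
theorem theta_mem (c : CS S) (ξ : HS S) : theta S c (ξ : L2X S) ∈ HS S := by
  rw [← fromMod_wS S ξ, theta_fromMod]; exact fromMod_mem S _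

theorem wS_theta (c : CS S) (ξ : HS S) :
    wS S ⟨theta S c (ξ : L2X S), theta_mem S c ξ⟩ = dil (modC_pos S c) (wS S ξ) := by
  rw [wS, LinearIsometryEquiv.symm_apply_eq]
  apply Subtype.ext
  rw [coe_wSinv, ← theta_fromMod]
  exact congrArg (theta S c) (fromMod_wS S ξ).symm

/-- Almost everywhere properties for `d^*u` pull back along the module. -/
theorem ae_modA {P : ℝ → Prop} (h : ∀ᵐ u ∂dstar, P u) : ∀ᵐ x ∂haarA S, P (modA S x) := by
  have h1 := ae_proj S ((isWeightedComp_fromMod S).ae h)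
  filter_upwards [h1, ae_modA_pos S] with x hx hp
  exact hx (by rw [modX_proj]; exact_mod_cast (Real.rpow_pos_of_pos hp _).ne')

end Spaces

/-! ### The Fourier transform of the multiplicative group -/

theorem _root_.MeasureTheory.MeasurePreserving.integral_comp_aesm {α β : Type*} [MeasurableSpace α]
    [MeasurableSpace β] {μ : Measure α} {ν : Measure β} {φ : α → β} (h : MeasurePreserving φ μ ν)
    {f : β → ℂ} (hf : AEStronglyMeasurable f ν) : ∫ x, f (φ x) ∂μ = ∫ y, f y ∂ν := by
  rw [← h.map_eq] at hf
  rw [← integral_map h.measurable.aemeasurable hf, h.map_eq]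

section RealFourier

/-- On `L¹ ∩ L²` the Fourier transform of `L²` is given by the Fourier integral. -/
theorem Lp_fourier_eq_integral (f : Lp ℂ 2 (volume : Measure ℝ)) (hf : Integrable f volume) :
    (𝓕 f : Lp ℂ 2 (volume : Measure ℝ)) =ᵐ[volume] 𝓕 (f : ℝ → ℂ) := by
  have hc : Continuous (𝓕 (f : ℝ → ℂ)) :=
    VectorFourier.fourierIntegral_continuous Real.continuous_fourierChar
      (by fun_prop : Continuous fun p : ℝ × ℝ => innerₗ ℝ p.1 p.2) hf
  refine ae_eq_of_integral_contDiff_smul_eq ((Lp.memLp _).locallyIntegrable (by norm_num))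
    hc.locallyIntegrable fun g hg1 hg2 => ?_
  have hg₁ : HasCompactSupport (Complex.ofRealCLM ∘ g) := hg2.comp_left rfl
  have hg₂ : ContDiff ℝ ((⊤ : ℕ∞) : WithTop ℕ∞) (Complex.ofRealCLM ∘ g) := by fun_prop
  let G : SchwartzMap ℝ ℂ := hg₁.toSchwartzMap hg₂
  have hG : ∀ x, G x = (g x : ℂ) := fun x => rfl
  have e1 : ∫ x, g x • (𝓕 f : Lp ℂ 2 (volume : Measure ℝ)) x
      = Lp.toTemperedDistribution (𝓕 f : Lp ℂ 2 (volume : Measure ℝ)) G := by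
    rw [Lp.toTemperedDistribution_apply]
    refine integral_congr_ae (Eventually.of_forall fun x => ?_)
    simp [hG]
  rw [e1, ← Lp.fourier_toTemperedDistribution_eq, TemperedDistribution.fourier_apply,
    Lp.toTemperedDistribution_apply]
  have e2 := VectorFourier.integral_fourierIntegral_smul_eq_flip (μ := (volume : Measure ℝ))
    (ν := (volume : Measure ℝ)) (L := innerₗ ℝ) (f := (G : ℝ → ℂ)) (g := (f : ℝ → ℂ))
    Real.continuous_fourierChar (by fun_prop) G.integrable hf
  rw [flip_innerₗ] at e2
  calc _ = ∫ x, VectorFourier.fourierIntegral Real.fourierChar volume (innerₗ ℝ) (G : ℝ → ℂ) x • f x := by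
        refine integral_congr_ae (Eventually.of_forall fun x => ?_)
        simp only [SchwartzMap.fourier_coe]
        rfl
    _ = _ := e2
    _ = _ := by
        refine integral_congr_ae (Eventually.of_forall fun x => ?_)
        simp only [hG, Complex.coe_smul]
        rfl

/-- Bounded operators on `L²` which agree on `L¹ ∩ L²` are equal. -/
theorem ext_of_integrable {α F : Type*} [MeasurableSpace α] {μ : Measure α}
    [NormedAddCommGroup F] [NormedSpace ℂ F] {A B : Lp ℂ 2 μ →L[ℂ] F}
    (h : ∀ g : Lp ℂ 2 μ, Integrable g μ → A g = B g) : A = B := by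
  ext g
  induction g using Lp.induction (p := 2) ENNReal.ofNat_ne_top with
  | indicatorConst c hs hμ =>
    refine h _ ?_
    rw [Lp.simpleFunc.coe_indicatorConst]
    exact ((integrable_indicator_iff hs).2 (integrableOn_const hμ.ne)).congr
      indicatorConstLp_coeFn.symm
  | add hf hg _ h1 h2 => rw [map_add, map_add, h1, h2]
  | isClosed => exact isClosed_eq A.continuous B.continuous

end RealFourier

section MultFourier

/-- The identification of `L²(ℝ_+^*, d^*u)` with `L²(ℝ)` by the exponential. -/
def expEquiv : Lp ℂ 2 dstar ≃ₗᵢ[ℂ] Lp ℂ 2 (volume : Measure ℝ) :=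
  weightedEquiv (φ := Real.exp) (m := fun _ => 1) (ψ := Real.log) (n := fun _ => 1)
    Real.measurable_exp measurable_const (measurePreserving_exp.map_withDensity_one)
    (isWeightedComp_of_eq Real.measurable_log measurable_const
      (MeasurePreserving.map_withDensity_one ⟨Real.measurable_log, by
        rw [← map_exp_volume, Measure.map_map Real.measurable_log Real.measurable_exp]
        have : Real.log ∘ Real.exp = id := by ext x; simp
        rw [this, Measure.map_id]⟩))
    (by filter_upwards [dstar_ae_pos] with u hu using ⟨one_mul _, Real.exp_log hu⟩)
    (Eventually.of_forall fun x => ⟨one_mul _, Real.log_exp x⟩)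

theorem expEquiv_apply (g : Lp ℂ 2 dstar) : expEquiv g =ᵐ[volume] fun t => g (Real.exp t) := by
  have := (isWeightedComp_of_eq Real.measurable_exp (measurable_const (a := (1 : ℂ)))
    (measurePreserving_exp.map_withDensity_one)).coeFn_op g
  simp only [one_mul] at this
  exact this

theorem map_mul_volume {a : ℝ} (ha : 0 < a) :
    Measure.map (fun s => a * s) (volume.withDensity fun _ : ℝ => ‖((a ^ (1 / 2 : ℝ) : ℝ) : ℂ)‖ₑ ^ 2)
      = volume := by
  rw [withDensity_const, enorm_rpow_half_sq ha, Measure.map_smul, Real.map_volume_mul_left ha.ne',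
    smul_smul, ← ENNReal.ofReal_mul (by positivity)]
  norm_num
  rw [abs_of_pos ha, mul_inv_cancel₀ ha.ne', ENNReal.ofReal_one, one_smul]

/-- The unitary `h ↦ a^{1/2} h(a ·)` of `L²(ℝ)`. -/
def dilR {a : ℝ} (ha : 0 < a) : Lp ℂ 2 (volume : Measure ℝ) ≃ₗᵢ[ℂ] Lp ℂ 2 (volume : Measure ℝ) :=
  weightedEquiv (φ := fun s => a * s) (m := fun _ => ((a ^ (1 / 2 : ℝ) : ℝ) : ℂ))
    (ψ := fun s => a⁻¹ * s) (n := fun _ => ((a⁻¹ ^ (1 / 2 : ℝ) : ℝ) : ℂ))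
    (measurable_const_mul a) measurable_const (map_mul_volume ha)
    (isWeightedComp_of_eq (measurable_const_mul _) measurable_const (map_mul_volume (inv_pos.2 ha)))
    (Eventually.of_forall fun u => ⟨by
      rw [← Complex.ofReal_mul, ← Real.mul_rpow (by positivity) ha.le, inv_mul_cancel₀ ha.ne']
      simp, mul_inv_cancel_left₀ ha.ne' u⟩)
    (Eventually.of_forall fun u => ⟨by
      rw [← Complex.ofReal_mul, ← Real.mul_rpow ha.le (by positivity), mul_inv_cancel₀ ha.ne']
      simp, inv_mul_cancel_left₀ ha.ne' u⟩)

theorem dilR_apply_of_ae {a : ℝ} (ha : 0 < a) {h : Lp ℂ 2 (volume : Measure ℝ)} {k : ℝ → ℂ}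
    (hk : h =ᵐ[volume] k) :
    dilR ha h =ᵐ[volume] fun s => ((a ^ (1 / 2 : ℝ) : ℝ) : ℂ) * k (a * s) :=
  (isWeightedComp_of_eq (measurable_const_mul a) measurable_const (map_mul_volume ha)).coeFn_op_of_ae hk

/-- The unitary `(2π)^{-1/2} 𝔽_μ`. -/
def FmuU : Lp ℂ 2 dstar ≃ₗᵢ[ℂ] Lp ℂ 2 (volume : Measure ℝ) :=
  (expEquiv.trans (Lp.fourierTransformₗᵢ ℝ ℂ)).trans (dilR (a := (2 * Real.pi)⁻¹) (by positivity))

theorem sqrt_two_pi_ne : ((Real.sqrt (2 * Real.pi) : ℝ) : ℂ) ≠ 0 := by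
  exact_mod_cast (Real.sqrt_pos.2 (by positivity)).ne'

/-- The Fourier transform `𝔽_μ` of `ℝ_+^*`. -/
def Fmu : Lp ℂ 2 dstar ≃L[ℂ] Lp ℂ 2 (volume : Measure ℝ) :=
  FmuU.toContinuousLinearEquiv.trans
    (ContinuousLinearEquiv.smulLeft (Units.mk0 _ sqrt_two_pi_ne))

theorem Fmu_apply (g : Lp ℂ 2 dstar) : Fmu g = ((Real.sqrt (2 * Real.pi) : ℝ) : ℂ) • FmuU g := rfl

theorem norm_Fmu (g : Lp ℂ 2 dstar) : ‖Fmu g‖ = Real.sqrt (2 * Real.pi) * ‖g‖ := by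
  rw [Fmu_apply, norm_smul, LinearIsometryEquiv.norm_map, Complex.norm_real,
    Real.norm_of_nonneg (Real.sqrt_nonneg _)]

theorem cpow_exp (t : ℝ) (z : ℂ) : ((Real.exp t : ℝ) : ℂ) ^ z = Complex.exp (t * z) := by
  rw [Complex.ofReal_exp, Complex.cpow_def_of_ne_zero (Complex.exp_ne_zero _),
    ← Complex.ofReal_exp, ← Complex.ofReal_log (Real.exp_pos t).le, Real.log_exp]

theorem isMultFourier_Fmu : IsMultFourier Fmu := by
  intro g hg
  have hge : Integrable (fun t => g (Real.exp t)) volume :=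
    (measurePreserving_exp.integrable_comp hg.aestronglyMeasurable).2 hg
  have h1 := expEquiv_apply g
  have h2 := Lp_fourier_eq_integral (expEquiv g) (hge.congr h1.symm)
  have h3 := dilR_apply_of_ae (a := (2 * Real.pi)⁻¹) (by positivity) h2
  have h4 := Lp.coeFn_smul ((Real.sqrt (2 * Real.pi) : ℝ) : ℂ) (FmuU g)
  rw [← Fmu_apply] at h4
  have h5 : FmuU g = dilR (a := (2 * Real.pi)⁻¹) (by positivity) (𝓕 (expEquiv g)) := rfl
  filter_upwards [h3, h4] with s h3 h4
  rw [h4, Pi.smul_apply, h5, h3, smul_eq_mul, ← mul_assoc, ← Complex.ofReal_mul,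
    ← Real.sqrt_eq_rpow, Real.sqrt_inv, mul_inv_cancel₀ (Real.sqrt_pos.2 (by positivity)).ne',
    Complex.ofReal_one, one_mul, Real.fourier_congr_ae h1, Real.fourier_real_eq_integral_exp_smul]
  have hasm : AEStronglyMeasurable (fun u : ℝ => g u * (u : ℂ) ^ (-(Complex.I * s))) dstar :=
    (Lp.aestronglyMeasurable g).mul (Complex.measurable_ofReal.pow_const _).aestronglyMeasurable
  rw [← measurePreserving_exp.integral_comp_aesm hasm]
  refine integral_congr_ae (Eventually.of_forall fun t => ?_)
  simp only [cpow_exp, smul_eq_mul]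
  rw [mul_comm]
  congr 2
  push_cast
  field_simp

theorem map_withDensity_unimodular {m : ℝ → ℂ} (hm : ∀ s, ‖m s‖ = 1) :
    Measure.map id ((volume : Measure ℝ).withDensity fun s => ‖m s‖ₑ ^ 2) = volume := by
  have : (fun s => ‖m s‖ₑ ^ 2) = fun _ => 1 := by
    ext s; rw [← ofReal_norm, hm]; simp
  rw [Measure.map_id, this, withDensity_const, one_smul]

theorem norm_cpow_I_mul {a : ℝ} (ha : 0 < a) (s : ℝ) : ‖(a : ℂ) ^ (Complex.I * s)‖ = 1 := by
  rw [Complex.norm_cpow_eq_rpow_re_of_pos ha]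
  simp

/-- Dilation by `a` becomes multiplication by `a^{is}`. -/
theorem Fmu_dil {a : ℝ} (ha : 0 < a) (g : Lp ℂ 2 dstar) :
    Fmu (dil ha g) =ᵐ[volume] fun s : ℝ => (a : ℂ) ^ (Complex.I * s) * Fmu g s := by
  have hw := map_withDensity_unimodular (m := fun s : ℝ => (a : ℂ) ^ (Complex.I * s))
    (norm_cpow_I_mul ha)
  have ha' : (a : ℂ) ≠ 0 := by exact_mod_cast ha.ne'
  have hm : Measurable fun s : ℝ => (a : ℂ) ^ (Complex.I * s) := by
    refine Continuous.measurable ?_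
    exact (Continuous.const_cpow (by fun_prop) (Or.inl ha'))
  have hwc := isWeightedComp_of_eq measurable_id hm hw
  have key : (Fmu : Lp ℂ 2 dstar →L[ℂ] Lp ℂ 2 (volume : Measure ℝ)) ∘L dil ha
      = hwc.op ∘L (Fmu : Lp ℂ 2 dstar →L[ℂ] Lp ℂ 2 (volume : Measure ℝ)) := by
    refine ext_of_integrable fun g hg => ?_
    change Fmu (dil ha g) = hwc.op (Fmu g)
    symm
    rw [hwc.op_eq_iff]
    have hmp : MeasurePreserving (fun u => a * u) dstar dstar :=
      ⟨measurable_const_mul a, map_mul_dstar ha⟩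
    have hi : Integrable (fun u => g (a * u)) dstar :=
      (hmp.integrable_comp hg.aestronglyMeasurable).2 hg
    have h1 := isMultFourier_Fmu (dil ha g) (hi.congr (dil_apply ha g).symm)
    filter_upwards [h1, isMultFourier_Fmu g hg] with s h1 h2
    rw [h1, id, h2]
    have e1 : ∫ u, dil ha g u * (u : ℂ) ^ (-(Complex.I * s)) ∂dstar
        = ∫ u, g (a * u) * (u : ℂ) ^ (-(Complex.I * s)) ∂dstar := by
      refine integral_congr_ae ?_
      filter_upwards [dil_apply ha g] with u hu
      rw [hu]
    have e2 : ∫ u, g u * (u : ℂ) ^ (-(Complex.I * s)) ∂dstar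
        = ∫ u, g (a * u) * ((a * u : ℝ) : ℂ) ^ (-(Complex.I * s)) ∂dstar := by
      have hasm : AEStronglyMeasurable (fun u : ℝ => g u * (u : ℂ) ^ (-(Complex.I * s))) dstar :=
        (Lp.aestronglyMeasurable g).mul (Complex.measurable_ofReal.pow_const _).aestronglyMeasurable
      exact (hmp.integral_comp_aesm hasm).symm
    rw [e1, e2, ← integral_const_mul]
    refine integral_congr_ae ?_
    filter_upwards [dstar_ae_pos] with u hu
    rw [Complex.ofReal_mul, Complex.mul_cpow_ofReal_nonneg ha.le hu.le, Complex.cpow_neg (a : ℂ)]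
    have := (Complex.cpow_ne_zero_iff (x := (a : ℂ)) (y := Complex.I * s)).2 (Or.inl ha')
    field_simp
  have h := congrArg (fun T => T g) key
  have h2 : hwc.op (Fmu g) = Fmu (dil ha g) := h.symm
  rwa [hwc.op_eq_iff] at h2

end MultFourier

section WInf

theorem isWeightedComp_wInf : IsWeightedComp dstar (volume : Measure ℝ) id
    fun u => ((u ^ (1 / 2 : ℝ) : ℝ) : ℂ) where
  measurable_map := measurable_id
  measurable_weight := by fun_prop
  map_le := by
    rw [Measure.map_id, dstar, ← withDensity_mul _ (by fun_prop) (by fun_prop)]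
    refine le_trans (le_of_eq ?_) (Measure.restrict_le_self (s := Set.Ioi 0))
    rw [← withDensity_one (μ := (volume : Measure ℝ).restrict (Set.Ioi 0))]
    rw [withDensity_one]
    refine (withDensity_congr_ae (g := 1) ?_).trans withDensity_one
    filter_upwards [ae_restrict_mem measurableSet_Ioi] with u hu
    have hu' : (0 : ℝ) < u := hu
    rw [Pi.mul_apply, enorm_rpow_half_sq hu, ← ENNReal.ofReal_mul (by positivity)]
    norm_num
    rw [inv_mul_cancel₀ hu'.ne']

/-- The map `w_∞(f)(u) = u^{1/2} f(u)` on all of `L²(ℝ)`. -/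
def halfWeight : Lp ℂ 2 (volume : Measure ℝ) →L[ℂ] Lp ℂ 2 dstar := isWeightedComp_wInf.op

theorem halfWeight_apply (f : Lp ℂ 2 (volume : Measure ℝ)) :
    halfWeight f =ᵐ[dstar] fun u : ℝ => ((u ^ (1 / 2 : ℝ) : ℝ) : ℂ) * f u :=
  isWeightedComp_wInf.coeFn_op f

/-- The map `w_∞`. -/
def wInf : L2even →L[ℂ] Lp ℂ 2 dstar := halfWeight ∘L L2even.subtypeL

theorem isWInf_wInf : IsWInf wInf := fun f => halfWeight_apply f

/-- Almost everywhere properties on `ℝ` hold almost everywhere for `d^*u`. -/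
theorem ae_dstar_of_ae {P : ℝ → Prop} (h : ∀ᵐ u : ℝ, P u) : ∀ᵐ u ∂dstar, P u := by
  filter_upwards [isWeightedComp_wInf.ae h, dstar_ae_pos] with u hu hp
  exact hu (by exact_mod_cast (Real.rpow_pos_of_pos hp _).ne')

end WInf

/-! ### The map `η_S` and the finite Euler product -/

section Spaces

variable (S : Finset Nat.Primes)

/-- The positive integers all of whose prime factors belong to `S`. -/
def SInt : Set ℕ := Nat.factoredNumbers (S.image fun p : Nat.Primes => (p : ℕ))

variable {S} in
theorem SInt_pos (n : SInt S) : (0 : ℝ) < (n : ℕ) := by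
  exact_mod_cast Nat.pos_of_ne_zero (Nat.ne_zero_of_mem_factoredNumbers n.2)

theorem image_filter_prime :
    (S.image fun p : Nat.Primes => (p : ℕ)).filter Nat.Prime = S.image fun p : Nat.Primes => (p : ℕ) := by
  refine Finset.filter_true_of_mem fun n hn => ?_
  obtain ⟨p, _, rfl⟩ := Finset.mem_image.1 hn
  exact p.2

/-- The Euler product over the primes of `S`. -/
theorem hasSum_SInt {F : Type*} [NormedField F] [CompleteSpace F] {f : ℕ →* F}
    (h : ∀ {p : ℕ}, p.Prime → ‖f p‖ < 1) :
    Summable (fun n : SInt S => ‖f n‖) ∧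
      HasSum (fun n : SInt S => f n) (∏ p : S, (1 - f (p : Nat.Primes))⁻¹) := by
  have := EulerProduct.summable_and_hasSum_factoredNumbers_prod_filter_prime_geometric h
    (S.image fun p : Nat.Primes => (p : ℕ))
  rw [image_filter_prime, Finset.prod_image (g := fun p : Nat.Primes => (p : ℕ))
    fun p _ q _ hpq => Nat.Primes.coe_nat_injective hpq] at this
  rw [Finset.prod_coe_sort S fun p => (1 - f (p : ℕ))⁻¹]
  exact this

/-- The completely multiplicative function `n ↦ n^{-z}`. -/
def natPow (z : ℂ) : ℕ →* ℂ where
  toFun n := (n : ℂ) ^ (-z)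
  map_one' := by simp
  map_mul' m n := by rw [Nat.cast_mul, Complex.natCast_mul_natCast_cpow]

theorem norm_natPow_lt {z : ℂ} (hz : 0 < z.re) {p : ℕ} (hp : p.Prime) :
    ‖(p : ℂ) ^ (-z)‖ < 1 := by
  rw [Complex.norm_natCast_cpow_of_pos hp.pos, Complex.neg_re]
  exact Real.rpow_lt_one_of_one_lt_of_neg (by exact_mod_cast hp.one_lt) (by linarith)

theorem half_sub_re (s : ℝ) : (1 / 2 - Complex.I * s : ℂ).re = 1 / 2 := by simp

theorem hasSum_finiteEuler (s : ℝ) :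
    HasSum (fun n : SInt S => (n : ℂ) ^ (-(1 / 2 - Complex.I * s))) (finiteEuler S s) :=
  (hasSum_SInt S (f := natPow _) fun hp =>
    norm_natPow_lt (by rw [half_sub_re]; norm_num) hp).2

theorem summable_SInt : Summable fun n : SInt S => ((n : ℕ) : ℝ) ^ (-(1 / 2) : ℝ) := by
  have h := (hasSum_SInt S (f := natPow (1 / 2)) fun hp =>
    norm_natPow_lt (by norm_num) hp).1
  refine h.congr fun n => ?_
  symm
  change _ = ‖((n : ℕ) : ℂ) ^ (-(1 / 2) : ℂ)‖
  rw [Complex.norm_natCast_cpow_of_pos (by exact_mod_cast SInt_pos n)]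
  norm_num

/-- The terms `n^{-1/2} g(n ·)` of the semilocal summation operator. -/
def dilTerm (n : SInt S) : Lp ℂ 2 dstar →L[ℂ] Lp ℂ 2 dstar :=
  ((((n : ℕ) : ℝ) ^ (-(1 / 2) : ℝ) : ℝ) : ℂ) • dil (SInt_pos n)

theorem norm_dilTerm_le (n : SInt S) : ‖dilTerm S n‖ ≤ ((n : ℕ) : ℝ) ^ (-(1 / 2) : ℝ) := by
  rw [dilTerm, norm_smul, Complex.norm_real, Real.norm_of_nonneg (by positivity)]
  refine mul_le_of_le_one_right (by positivity) ?_
  exact ContinuousLinearMap.opNorm_le_bound _ zero_le_one fun g => by rw [one_mul, norm_dil]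

theorem summable_norm_dilTerm : Summable fun n : SInt S => ‖dilTerm S n‖ :=
  (summable_SInt S).of_nonneg_of_le (fun _ => norm_nonneg _) (norm_dilTerm_le S)

/-- The operator `g ↦ ∑ n^{-1/2} g(n ·)` on `L²(ℝ_+^*, d^*u)`, the sum being over the positive integers
with all their prime factors in `S`. -/
def sumOp : Lp ℂ 2 dstar →L[ℂ] Lp ℂ 2 dstar := ∑' n, dilTerm S n

theorem sumOp_apply (g : Lp ℂ 2 dstar) : sumOp S g = ∑' n, dilTerm S n g :=
  ((summable_norm_dilTerm S).of_norm.hasSum.mapL (ContinuousLinearMap.apply ℂ _ g)).tsum_eq.symm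

theorem tsum_enorm_ne_top {ι E : Type*} [NormedAddCommGroup E] {f : ι → E} (h : Summable fun i => ‖f i‖) :
    ∑' i, ‖f i‖ₑ ≠ ∞ :=
  tsum_enorm_ne_top_iff_summable_norm.2 h

theorem summable_norm_apply {E F ι : Type*} [NormedAddCommGroup E] [NormedSpace ℂ E]
    [NormedAddCommGroup F] [NormedSpace ℂ F] {T : ι → E →L[ℂ] F} (h : Summable fun i => ‖T i‖) (x : E) :
    Summable fun i => ‖T i x‖ :=
  (h.mul_right ‖x‖).of_nonneg_of_le (fun _ => norm_nonneg _) fun i => (T i).le_opNorm x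

/-- The series which defines `sumOp` also converges pointwise almost everywhere. -/
theorem hasSum_sumOp (g : Lp ℂ 2 dstar) :
    ∀ᵐ u ∂dstar, HasSum (fun n : SInt S => ((((n : ℕ) : ℝ) ^ (-(1 / 2) : ℝ) : ℝ) : ℂ) * g (n * u))
      (sumOp S g u) := by
  have h := Lp.hasSum_coeFn_tsum (tsum_enorm_ne_top (summable_norm_apply (summable_norm_dilTerm S) g))
  have h2 : ∀ᵐ u ∂dstar, ∀ n : SInt S, dilTerm S n g u
      = ((((n : ℕ) : ℝ) ^ (-(1 / 2) : ℝ) : ℝ) : ℂ) * g (n * u) := by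
    refine ae_all_iff.2 fun n => ?_
    filter_upwards [dil_apply (SInt_pos n) g,
      Lp.coeFn_smul ((((n : ℕ) : ℝ) ^ (-(1 / 2) : ℝ) : ℝ) : ℂ) (dil (SInt_pos n) g)] with u h1 h2
    change (((((n : ℕ) : ℝ) ^ (-(1 / 2) : ℝ) : ℝ) : ℂ) • dil (SInt_pos n) g : Lp ℂ 2 dstar) u = _
    rw [h2, Pi.smul_apply, h1, smul_eq_mul]
  filter_upwards [h, h2] with u h h2
  rw [sumOp_apply]
  simpa only [h2] using h

/-- In the Fourier transform the dilation by `n` is the multiplication by `n^{is}`, and the sum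
`∑ n^{-1/2 + is}` is the finite Euler product. -/
theorem Fmu_sumOp (g : Lp ℂ 2 dstar) :
    Fmu (sumOp S g) =ᵐ[volume] fun s => finiteEuler S s * Fmu g s := by
  let T : SInt S → Lp ℂ 2 (volume : Measure ℝ) := fun n => Fmu (dilTerm S n g)
  have hT : Summable fun n => ‖T n‖ := by
    refine ((summable_norm_apply (summable_norm_dilTerm S) g).mul_left
      (Real.sqrt (2 * Real.pi))).congr fun n => ?_
    rw [← norm_Fmu]
  have e : Fmu (sumOp S g) = ∑' n, T n := by
    rw [sumOp_apply]
    exact Fmu.map_tsum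
  have h2 : ∀ᵐ s : ℝ, ∀ n : SInt S, T n s = (n : ℂ) ^ (-(1 / 2 - Complex.I * s)) * Fmu g s := by
    refine ae_all_iff.2 fun n => ?_
    have e1 : T n = ((((n : ℕ) : ℝ) ^ (-(1 / 2) : ℝ) : ℝ) : ℂ) • Fmu (dil (SInt_pos n) g) := by
      rw [← map_smul]
      rfl
    rw [e1]
    filter_upwards [Fmu_dil (SInt_pos n) g,
      Lp.coeFn_smul ((((n : ℕ) : ℝ) ^ (-(1 / 2) : ℝ) : ℝ) : ℂ) (Fmu (dil (SInt_pos n) g))] with s h1 h2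
    rw [h2, Pi.smul_apply, h1, smul_eq_mul, ← mul_assoc]
    congr 1
    have hn : ((n : ℕ) : ℂ) ≠ 0 := by exact_mod_cast (SInt_pos n).ne'
    rw [Complex.ofReal_cpow (SInt_pos n).le, Complex.ofReal_natCast, ← Complex.cpow_add _ _ hn]
    congr 1
    push_cast
    ring
  rw [e]
  filter_upwards [Lp.hasSum_coeFn_tsum (tsum_enorm_ne_top hT), h2] with s h1 h2
  simp only [h2] at h1
  exact h1.unique ((hasSum_finiteEuler S s).mul_right (Fmu g s))

/-- The map `η_S`. -/
def etaS : L2even →L[ℂ] HS S :=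
  ((wSinv S).toContinuousLinearEquiv : Lp ℂ 2 dstar →L[ℂ] HS S) ∘L sumOp S ∘L wInf

theorem wS_etaS (f : L2even) : wS S (etaS S f) = sumOp S (wInf f) :=
  (wSinv S).symm_apply_apply _

section Eta

variable {S}

/-- An integer with all its prime factors in `S`, as an element of `Γ`. -/
def natGam (n : SInt S) : Gam S :=
  ⟨Units.mk0 ((n : ℕ) : ℚ) (by exact_mod_cast (SInt_pos n).ne'), fun p hp => by
    rw [Units.val_mk0, Rat.cast_natCast, Padic.norm_natCast_eq_one_iff]
    refine (Nat.coprime_comm.1 ((Nat.Prime.coprime_iff_not_dvd p.2).2 fun hd => hp ?_)).symm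
    obtain ⟨q, hq, e⟩ := Finset.mem_image.1 (Nat.mem_factoredNumbers'.1 n.2 p p.2 hd)
    rwa [← Nat.Primes.coe_nat_injective e]⟩

theorem natGam_val (n : SInt S) : (((natGam n : Gam S) : ℚˣ) : ℚ) = (n : ℕ) := rfl

/-- A positive element of `Γ` which is integral at the primes of `S` is an integer. -/
theorem exists_natGam {g : Gam S} (h0 : 0 < ((g : ℚˣ) : ℚ))
    (h : ∀ p : S, ‖(((g : ℚˣ) : ℚ) : ℚ_[(p : Nat.Primes)])‖ ≤ 1) : ∃ n : SInt S, natGam n = g := by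
  have hle : ∀ p : Nat.Primes, ‖(((g : ℚˣ) : ℚ) : ℚ_[p])‖ ≤ 1 := fun p => by
    by_cases hp : p ∈ S
    · exact h ⟨p, hp⟩
    · exact (g.2 p hp).le
  have hden : ((g : ℚˣ) : ℚ).den = 1 := by
    rw [Nat.eq_one_iff_not_exists_prime_dvd]
    intro p hp hd
    have := Fact.mk hp
    have h1 : ‖((((g : ℚˣ) : ℚ).num : ℤ) : ℚ_[p])‖ < 1 := by
      have h2 : ((((g : ℚˣ) : ℚ).num : ℤ) : ℚ_[p])
          = (((g : ℚˣ) : ℚ) : ℚ_[p]) * (((g : ℚˣ) : ℚ).den : ℚ_[p]) := by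
        have := Rat.mul_den_eq_num ((g : ℚˣ) : ℚ)
        exact_mod_cast congrArg (fun r : ℚ => (r : ℚ_[p])) this.symm
      rw [h2, norm_mul]
      exact mul_lt_one_of_nonneg_of_lt_one_right (hle ⟨p, hp⟩) (norm_nonneg _)
        (Padic.norm_natCast_lt_one_iff.2 hd)
    rw [Padic.norm_intCast_lt_one_iff] at h1
    have h3 := Nat.dvd_gcd (Int.natCast_dvd.1 h1) hd
    rw [((g : ℚˣ) : ℚ).reduced.gcd_eq_one] at h3
    exact hp.one_lt.ne' (Nat.dvd_one.1 h3)
  obtain ⟨n, hn⟩ : ∃ n : ℕ, ((g : ℚˣ) : ℚ) = n := by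
    refine ⟨((g : ℚˣ) : ℚ).num.toNat, ?_⟩
    have h1 := Rat.coe_int_num_of_den_eq_one hden
    have h2 : 0 ≤ ((g : ℚˣ) : ℚ).num := Rat.num_nonneg.2 h0.le
    conv_lhs => rw [← h1]
    rw [← Int.cast_natCast, Int.toNat_of_nonneg h2]
  refine ⟨⟨n, ?_⟩, Subtype.ext (Units.ext hn.symm)⟩
  refine Nat.mem_factoredNumbers'.2 fun p hp hd => ?_
  by_contra hcon
  have hpS : (⟨p, hp⟩ : Nat.Primes) ∉ S := fun hmem =>
    hcon (Finset.mem_image.2 ⟨_, hmem, rfl⟩)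
  have h1 := g.2 ⟨p, hp⟩ hpS
  have := Fact.mk hp
  rw [hn, Rat.cast_natCast, Padic.norm_natCast_eq_one_iff] at h1
  exact (Nat.Prime.coprime_iff_not_dvd hp).1 h1 hd

/-- The positive element of `Γ` which moves the finite components of an idele to `R_S^*`. -/
theorem exists_gam_unit {x : Adele S} (hx : ∀ p : S, x.2 p ≠ 0) :
    ∃ g : Gam S, 0 < ((g : ℚˣ) : ℚ) ∧ ∀ p : S, ‖(g • x).2 p‖ = 1 := by
  have hn : ∀ p : S, ∃ n : ℤ, ‖x.2 p‖ = (((p : Nat.Primes) : ℕ) : ℝ) ^ (-n) := fun p => by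
    obtain ⟨n, hn⟩ := Padic.padicNormE.image (hx p)
    exact ⟨n, by rw [hn]; push_cast; rfl⟩
  choose n hn using hn
  refine ⟨⟨primeProd S (-n), primeProd_mem S _⟩, ?_, fun p => ?_⟩
  · change (0 : ℚ) < primeProd S (-n)
    rw [primeProd_val]
    exact Finset.prod_pos fun p _ => zpow_pos (by exact_mod_cast p.1.2.pos) _
  · have : (((p : Nat.Primes) : ℕ) : ℝ) ≠ 0 := by exact_mod_cast p.1.2.ne_zero
    rw [Gam_smul_snd, norm_mul, norm_primeProd_mem, hn, ← zpow_add₀ this]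
    simp

theorem ae_gam_smul_fst {P : ℝ → Prop} (h : ∀ᵐ y : ℝ, P y) :
    ∀ᵐ x ∂haarA S, ∀ g : Gam S, P ((g • x).1) := by
  refine ae_all_iff.2 fun g => ?_
  have h1 : ∀ᵐ x ∂haarA S, P x.1 := Measure.quasiMeasurePreserving_fst.ae h
  have := (measurePreserving_smul g (haarA S)).quasiMeasurePreserving.ae h1
  exact this

theorem L2even_apply_neg (f : L2even) : ∀ᵐ y : ℝ,
    (f : Lp ℂ 2 (volume : Measure ℝ)) (-y) = (f : Lp ℂ 2 (volume : Measure ℝ)) y := by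
  have h : Lp.compMeasurePreserving (fun x : ℝ => -x) (Measure.measurePreserving_neg volume)
    (f : Lp ℂ 2 (volume : Measure ℝ)) = f := f.2
  have h1 := Lp.coeFn_compMeasurePreserving (f : Lp ℂ 2 (volume : Measure ℝ))
    (Measure.measurePreserving_neg volume)
  rw [h] at h1
  filter_upwards [h1] with y hy
  exact hy.symm

/-- Reindexing of the sum over the positive elements of `Γ` which defines the class of `1_{R_S} ⊗ f`. -/
theorem hasSum_oneTensor_iff {f : ℝ → ℂ} {x : Adele S} (hx : ∀ p : S, x.2 p ≠ 0)
    (hf : ∀ g : Gam S, f (-(g • x).1) = f (g • x).1) (c : ℂ) :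
    HasSum (fun g : {g : Gam S // 0 < ((g : ℚˣ) : ℚ)} => oneTensor S f ((g : Gam S) • x)) c ↔
      HasSum (fun n : SInt S => f (n * modA S x)) c := by
  -- the terms which do not vanish are those with `g ∈ g0 ℕ`, where `g0` moves `x` to `R_S^* × ℝ`
  obtain ⟨g0, hg0, hu⟩ := exists_gam_unit hx
  let e : SInt S → {g : Gam S // 0 < ((g : ℚˣ) : ℚ)} := fun n => ⟨natGam n * g0, by
    rw [Subgroup.coe_mul, Units.val_mul, natGam_val]
    exact mul_pos (by exact_mod_cast SInt_pos n) hg0⟩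
  have he : Function.Injective e := by
    intro m n hmn
    have h1 : natGam m = natGam n := mul_right_cancel (congrArg Subtype.val hmn)
    have h2 : (((natGam m : Gam S) : ℚˣ) : ℚ) = ((natGam n : Gam S) : ℚˣ) := by rw [h1]
    rw [natGam_val, natGam_val] at h2
    exact Subtype.ext (by exact_mod_cast h2)
  have hmod : |(g0 • x).1| = modA S x := by
    rw [← modA_smul S g0 x, modA, Finset.prod_eq_one fun p _ => hu p, mul_one]
  rw [← he.hasSum_iff]
  · have : ((fun g : {g : Gam S // 0 < ((g : ℚˣ) : ℚ)} => oneTensor S f ((g : Gam S) • x)) ∘ e)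
        = fun n : SInt S => f (n * modA S x) := by
      ext n
      have h1 : ((e n : Gam S) • x) = natGam n • g0 • x := mul_smul _ _ _
      have h2 : ∀ p : S, ‖(natGam n • g0 • x).2 p‖ ≤ 1 := fun p => by
        rw [Gam_smul_snd, norm_mul, hu, mul_one, natGam_val, Rat.cast_natCast]
        exact_mod_cast Padic.norm_int_le_one (p := (p : Nat.Primes)) ((n : ℕ) : ℤ)
      have h3 : f ((natGam n • g0 • x).1) = f |(natGam n • g0 • x).1| := by
        rcases abs_choice (natGam n • g0 • x).1 with h | h
        · rw [h]
        · rw [h, ← mul_smul, hf]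
      rw [Function.comp_apply, h1, oneTensor,
        Set.indicator_of_mem (show (natGam n • g0 • x).2 ∈ {y | ∀ p, ‖y p‖ ≤ 1} from h2),
        Pi.one_apply, one_mul, h3, Gam_smul_fst, abs_mul, hmod, natGam_val, Rat.cast_natCast,
        abs_of_pos (SInt_pos n)]
    rw [this]
  · intro g hg
    rw [oneTensor, Set.indicator_of_notMem, zero_mul]
    intro hmem
    refine hg ?_
    obtain ⟨n, hn⟩ := exists_natGam (g := (g : Gam S) * g0⁻¹) (by
      rw [Subgroup.coe_mul, Units.val_mul, Subgroup.coe_inv, Units.val_inv_eq_inv_val]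
      exact mul_pos g.2 (inv_pos.2 hg0)) fun p => by
        have h1 : ‖((g : Gam S) • x).2 p‖ ≤ 1 := hmem p
        have h2 : (g : Gam S) • x = ((g : Gam S) * g0⁻¹) • g0 • x := by
          rw [← mul_smul, inv_mul_cancel_right]
        rwa [h2, Gam_smul_snd, norm_mul, hu, mul_one] at h1
    exact ⟨n, Subtype.ext (by rw [show (e n : Gam S) = natGam n * g0 from rfl, hn, inv_mul_cancel_right])⟩

variable (S)

/-- The sum over `Γ_+` reduces to a sum over integers, which is `sumOp` up to the factor `|x|^{1/2}`. -/
theorem isEta_etaS : IsEta S (etaS S) := by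
  intro f
  have h1 := ae_modA S (hasSum_sumOp S (wInf f))
  have h2 : ∀ᵐ u ∂dstar, ∀ n : SInt S,
      wInf f (n * u) = (((n * u) ^ (1 / 2 : ℝ) : ℝ) : ℂ) * (f : Lp ℂ 2 (volume : Measure ℝ)) (n * u) := by
    refine ae_all_iff.2 fun n => ?_
    have hmp : MeasurePreserving (fun u : ℝ => ((n : ℕ) : ℝ) * u) dstar dstar :=
      ⟨measurable_const_mul _, map_mul_dstar (SInt_pos n)⟩
    exact hmp.quasiMeasurePreserving.ae (isWInf_wInf f)
  filter_upwards [h1, ae_modA S h2, isWS_wS S (etaS S f), ae_modA_pos S, ae_isUnit S,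
    ae_gam_smul_fst (L2even_apply_neg f)] with x h1 h2 h3 hp hx hev
  rw [hasSum_oneTensor_iff hx.2 hev]
  rw [wS_etaS] at h3
  rw [h3] at h1
  have hr : (((modA S x) ^ (1 / 2 : ℝ) : ℝ) : ℂ) ≠ 0 := by
    exact_mod_cast (Real.rpow_pos_of_pos hp _).ne'
  rw [← hasSum_mul_left_iff hr]
  refine Eq.mp (congrArg (fun F => HasSum F _) (funext fun n => ?_)) h1
  rw [h2 n, Real.mul_rpow (SInt_pos n).le hp.le, Complex.ofReal_mul, ← mul_assoc, ← mul_assoc,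
    ← Complex.ofReal_mul, ← Real.rpow_add (SInt_pos n)]
  norm_num

end Eta

end Spaces

/-! ### The unitaries `V_S` and `U_S` -/

section Multiplication

variable {μ : Measure ℝ}

theorem ofReal_norm_sq (z : ℂ) : ENNReal.ofReal (‖z‖ ^ 2) = ‖z‖ₑ ^ 2 := by
  rw [ENNReal.ofReal_pow (norm_nonneg _), ofReal_norm]

theorem map_withDensity_inv {φ : ℝ → ℂ} (hφ : Measurable φ) (h0 : ∀ s, φ s ≠ 0) :
    Measure.map id ((volume.withDensity fun s => ENNReal.ofReal (‖φ s‖ ^ 2)).withDensity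
      fun s => ‖(φ s)⁻¹‖ₑ ^ 2) = (volume : Measure ℝ) := by
  rw [Measure.map_id, ← withDensity_mul _ (by fun_prop) (by fun_prop)]
  refine (withDensity_congr_ae (g := 1) (Eventually.of_forall fun s => ?_)).trans withDensity_one
  rw [Pi.mul_apply, ofReal_norm_sq, ← mul_pow, ← enorm_mul, mul_inv_cancel₀ (h0 s)]
  simp

/-- Division by `φ` as a unitary from `L²(ℝ)` to `L²(ℝ, |φ(s)|² ds)`. -/
def divEquiv {φ : ℝ → ℂ} (hφ : Measurable φ) (h0 : ∀ s, φ s ≠ 0) :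
    Lp ℂ 2 (volume : Measure ℝ) ≃ₗᵢ[ℂ]
      Lp ℂ 2 ((volume : Measure ℝ).withDensity fun s => ENNReal.ofReal (‖φ s‖ ^ 2)) :=
  weightedEquiv (φ := id) (m := fun s => (φ s)⁻¹) (ψ := id) (n := φ) measurable_id hφ.inv
    (map_withDensity_inv hφ h0)
    (isWeightedComp_of_eq measurable_id hφ (by simp only [Measure.map_id, ofReal_norm_sq]))
    (Eventually.of_forall fun s => ⟨mul_inv_cancel₀ (h0 s), rfl⟩)
    (Eventually.of_forall fun s => ⟨inv_mul_cancel₀ (h0 s), rfl⟩)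

theorem divEquiv_apply_of_ae {φ : ℝ → ℂ} (hφ : Measurable φ) (h0 : ∀ s, φ s ≠ 0)
    {h : Lp ℂ 2 (volume : Measure ℝ)} {k : ℝ → ℂ} (hk : h =ᵐ[volume] k) :
    divEquiv hφ h0 h =ᵐ[(volume : Measure ℝ).withDensity fun s => ENNReal.ofReal (‖φ s‖ ^ 2)]
      fun s => (φ s)⁻¹ * k s :=
  (isWeightedComp_of_eq measurable_id hφ.inv (map_withDensity_inv hφ h0)).coeFn_op_of_ae hk

theorem map_withDensity_scale (μ : Measure ℝ) {c : ℝ≥0∞} {k : ℂ} (h : c * ‖k‖ₑ ^ 2 = 1) :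
    Measure.map id ((c • μ).withDensity fun _ => ‖k‖ₑ ^ 2) = μ := by
  rw [Measure.map_id, withDensity_const, smul_smul, mul_comm, h, one_smul]

/-- Multiplication by a constant `k` as a unitary from `L²(μ)` to `L²(c μ)`, where `c |k|² = 1`. -/
def scaleEquiv (μ : Measure ℝ) {c : ℝ≥0∞} {k : ℂ} (h : c * ‖k‖ₑ ^ 2 = 1) :
    Lp ℂ 2 μ ≃ₗᵢ[ℂ] Lp ℂ 2 (c • μ) :=
  have hk : k ≠ 0 := by rintro rfl; simp at h
  weightedEquiv (φ := id) (m := fun _ => k) (ψ := id) (n := fun _ => k⁻¹) measurable_id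
    measurable_const (map_withDensity_scale μ h)
    (isWeightedComp_of_eq measurable_id measurable_const (by
      rw [Measure.map_id, withDensity_const]
      have h1 : ‖k⁻¹‖ₑ ^ 2 * ‖k‖ₑ ^ 2 = 1 := by
        rw [← mul_pow, ← enorm_mul, inv_mul_cancel₀ hk]; simp
      have h2 : ‖k‖ₑ ^ 2 ≠ 0 := by simpa using hk
      have h3 : ‖k‖ₑ ^ 2 ≠ ∞ := by simp
      congr 1
      rw [← ENNReal.mul_left_inj h2 h3, h1, h]))
    (Eventually.of_forall fun s => ⟨inv_mul_cancel₀ hk, rfl⟩)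
    (Eventually.of_forall fun s => ⟨mul_inv_cancel₀ hk, rfl⟩)

theorem scaleEquiv_apply (μ : Measure ℝ) {c : ℝ≥0∞} {k : ℂ} (h : c * ‖k‖ₑ ^ 2 = 1) (f : Lp ℂ 2 μ) :
    scaleEquiv μ h f =ᵐ[c • μ] fun s => k * f s :=
  (isWeightedComp_of_eq measurable_id measurable_const (map_withDensity_scale μ h)).coeFn_op f

end Multiplication

section Euler

variable (S : Finset Nat.Primes)

theorem continuous_half_sub : Continuous fun s : ℝ => (1 / 2 - Complex.I * s : ℂ) := by fun_prop

theorem one_sub_ne_zero (p : Nat.Primes) (s : ℝ) :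
    (1 - ((p : ℕ) : ℂ) ^ (-(1 / 2 - Complex.I * s))) ≠ 0 := by
  intro h
  have h1 := norm_natPow_lt (z := 1 / 2 - Complex.I * s) (by rw [half_sub_re]; norm_num) p.2
  rw [← sub_eq_zero.1 h, norm_one] at h1
  exact lt_irrefl _ h1

theorem finiteEuler_ne_zero (s : ℝ) : finiteEuler S s ≠ 0 :=
  Finset.prod_ne_zero_iff.2 fun p _ => inv_ne_zero (one_sub_ne_zero p s)

theorem continuous_finiteEuler : Continuous (finiteEuler S) := by
  refine continuous_finsetProd _ fun p _ => Continuous.inv₀ ?_ (one_sub_ne_zero p)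
  have hp : (((p : Nat.Primes) : ℕ) : ℂ) ≠ 0 := by exact_mod_cast p.1.2.ne_zero
  exact continuous_const.sub (Continuous.const_cpow (by fun_prop) (Or.inl hp))

theorem Gammaℝ_half_ne_zero (s : ℝ) : Complex.Gammaℝ (1 / 2 - Complex.I * s) ≠ 0 :=
  Complex.Gammaℝ_ne_zero_of_re_pos (by rw [half_sub_re]; norm_num)

theorem fullEuler_ne_zero (s : ℝ) : fullEuler S s ≠ 0 :=
  mul_ne_zero (Gammaℝ_half_ne_zero s) (finiteEuler_ne_zero S s)

theorem continuous_fullEuler : Continuous (fullEuler S) := by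
  refine Continuous.mul ?_ (continuous_finiteEuler S)
  have h := (Complex.differentiable_Gammaℝ_inv.continuous.comp continuous_half_sub).inv₀
    fun s => inv_ne_zero (Gammaℝ_half_ne_zero s)
  exact h.congr fun s => inv_inv _

theorem volume_ae_of_mS {P : ℝ → Prop} (h : ∀ᵐ s ∂mS S, P s) : ∀ᵐ s : ℝ, P s := by
  rw [mS, ae_withDensity_iff (by have := (continuous_fullEuler S).measurable; fun_prop)] at h
  filter_upwards [h] with s hs
  refine hs ?_
  simpa using fullEuler_ne_zero S s

theorem mS_ae_of_volume {P : ℝ → Prop} (h : ∀ᵐ s : ℝ, P s) : ∀ᵐ s ∂mS S, P s :=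
  withDensity_absolutelyContinuous _ _ h

/-- The unitary `(2π)^{-1/2} V_S`. -/
def VU : HS S ≃ₗᵢ[ℂ] Lp ℂ 2 (mS S) :=
  ((wS S).trans FmuU).trans (divEquiv (continuous_fullEuler S).measurable (fullEuler_ne_zero S))

/-- The operator `V_S`. -/
def VS : HS S ≃L[ℂ] Lp ℂ 2 (mS S) :=
  (VU S).toContinuousLinearEquiv.trans
    (ContinuousLinearEquiv.smulLeft (Units.mk0 _ sqrt_two_pi_ne))

theorem VS_eq_smul (ξ : HS S) : VS S ξ = ((Real.sqrt (2 * Real.pi) : ℝ) : ℂ) • VU S ξ := rfl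

theorem norm_VS (ξ : HS S) : ‖VS S ξ‖ = Real.sqrt (2 * Real.pi) * ‖ξ‖ := by
  rw [VS_eq_smul, norm_smul, LinearIsometryEquiv.norm_map, Complex.norm_real,
    Real.norm_of_nonneg (Real.sqrt_nonneg _)]

theorem VS_apply (ξ : HS S) :
    VS S ξ =ᵐ[mS S] fun s => (fullEuler S s)⁻¹ * Fmu (wS S ξ) s := by
  have e : VS S ξ = divEquiv (continuous_fullEuler S).measurable (fullEuler_ne_zero S)
      (Fmu (wS S ξ)) := by
    rw [VS_eq_smul, Fmu_apply, map_smul]; rfl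
  rw [e]
  exact divEquiv_apply_of_ae _ _ (EventuallyEq.refl _ _)

/-- The finite Euler factors cancel in `V_S ∘ η_S`. -/
theorem VS_etaS (f : L2even) :
    VS S (etaS S f) =ᵐ[mS S]
      fun s => (Complex.Gammaℝ (1 / 2 - Complex.I * s))⁻¹ * Fmu (wInf f) s := by
  filter_upwards [VS_apply S (etaS S f), mS_ae_of_volume S (Fmu_sumOp S (wInf f))] with s h1 h2
  rw [h1, wS_etaS, h2, fullEuler]
  have := finiteEuler_ne_zero S s
  have := Gammaℝ_half_ne_zero s
  field_simp

end Euler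

section Gaussian

theorem integral_dstar (f : ℝ → ℂ) : ∫ u, f u ∂dstar = ∫ u in Set.Ioi 0, ((u⁻¹ : ℝ) : ℂ) * f u := by
  rw [dstar, integral_withDensity_eq_integral_toReal_smul (by fun_prop) (by simp)]
  refine setIntegral_congr_fun measurableSet_Ioi fun u hu => ?_
  simp only [Complex.real_smul]
  rw [ENNReal.toReal_ofReal (inv_nonneg.2 (le_of_lt hu))]

theorem integrable_dstar {f : ℝ → ℂ}
    (h : IntegrableOn (fun u => ((u⁻¹ : ℝ) : ℂ) * f u) (Set.Ioi 0)) : Integrable f dstar := by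
  rw [dstar, integrable_withDensity_iff_integrable_smul' (by fun_prop) (by simp)]
  refine h.congr_fun (fun u hu => ?_) measurableSet_Ioi
  simp only [Complex.real_smul]
  rw [ENNReal.toReal_ofReal (inv_nonneg.2 (le_of_lt hu))]

/-- The Mellin transform of `exp(-π u²)`. -/
theorem mellin_gaussian {z : ℂ} (hz : 0 < z.re) :
    ∫ u in Set.Ioi (0 : ℝ), (u : ℂ) ^ (z - 1) * ((Real.exp (-Real.pi * u ^ 2) : ℝ) : ℂ)
      = 1 / 2 * Complex.Gammaℝ z := by
  have h1 := Complex.integral_cpow_mul_exp_neg_mul_Ioi (a := z / 2) (r := Real.pi)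
    (by simpa using hz) Real.pi_pos
  rw [← integral_comp_rpow_Ioi_of_pos (p := 2) (by norm_num)] at h1
  have h2 : ((1 / (Real.pi : ℂ)) ^ (z / 2) : ℂ) = (Real.pi : ℂ) ^ (-z / 2) := by
    rw [one_div, Complex.inv_cpow _ _ (by
      rw [Complex.arg_ofReal_of_nonneg Real.pi_pos.le]; exact Real.pi_pos.ne), ← Complex.cpow_neg,
      neg_div]
  rw [Complex.Gammaℝ_def, ← h2, ← h1, ← integral_const_mul]
  refine setIntegral_congr_fun measurableSet_Ioi fun u hu => ?_
  have hu' : (0 : ℝ) < u := hu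
  have huc : (u : ℂ) ≠ 0 := by exact_mod_cast hu'.ne'
  have h3 : ((u ^ (2 : ℝ) : ℝ) : ℂ) ^ (z / 2 - 1) = (u : ℂ) ^ (z - 2) := by
    rw [Real.rpow_two, sq, Complex.ofReal_mul, Complex.mul_cpow_ofReal_nonneg hu'.le hu'.le,
      ← Complex.cpow_add _ _ huc]
    ring_nf
  have h4 : (u : ℂ) ^ (z - 1) = (u : ℂ) ^ (z - 2) * u := by
    rw [show z - 1 = (z - 2) + 1 by ring, Complex.cpow_add _ _ huc, Complex.cpow_one]
  simp only [h3, h4, Complex.real_smul]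
  norm_num
  ring

theorem coeFn_xiInf : ((xiInf : L2even) : Lp ℂ 2 (volume : Measure ℝ)) =ᵐ[volume]
    fun x : ℝ => ((2 ^ (1 / 4 : ℝ) * Real.exp (-Real.pi * x ^ 2) : ℝ) : ℂ) :=
  memLp_gaussian.coeFn_toLp

/-- The Mellin transform of the Gaussian is the archimedean Euler factor. -/
theorem Fmu_wInf_xiInf : Fmu (wInf xiInf) =ᵐ[volume] fun s : ℝ =>
    (((2 : ℝ) ^ (-(3 / 4) : ℝ) : ℝ) : ℂ) * Complex.Gammaℝ (1 / 2 - Complex.I * s) := by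
  have h1 : wInf xiInf =ᵐ[dstar] fun u : ℝ => ((u ^ (1 / 2 : ℝ) : ℝ) : ℂ) *
      ((2 ^ (1 / 4 : ℝ) * Real.exp (-Real.pi * u ^ 2) : ℝ) : ℂ) := by
    filter_upwards [isWInf_wInf xiInf, ae_dstar_of_ae coeFn_xiInf] with u h1 h2
    rw [h1, h2]
  have h2 : Integrable (wInf xiInf) dstar := by
    refine Integrable.congr (integrable_dstar ?_) h1.symm
    have h3 := ((integrableOn_rpow_mul_exp_neg_mul_sq Real.pi_pos (s := -(1 / 2))
      (by norm_num)).const_mul ((2 : ℝ) ^ (1 / 4 : ℝ))).ofReal (𝕜 := ℂ)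
    refine IntegrableOn.congr_fun h3 (fun u hu => ?_) measurableSet_Ioi
    have hu' : (0 : ℝ) < u := hu
    have h4 : u ^ (-(1 / 2) : ℝ) = u⁻¹ * u ^ (1 / 2 : ℝ) := by
      rw [← Real.rpow_neg_one u, ← Real.rpow_add hu']; norm_num
    change (((2 : ℝ) ^ (1 / 4 : ℝ) * (u ^ (-(1 / 2) : ℝ) * Real.exp (-Real.pi * u ^ 2)) : ℝ) : ℂ) = _
    rw [h4]
    push_cast
    ring
  filter_upwards [isMultFourier_Fmu _ h2] with s hs
  have h5 : (((2 : ℝ) ^ (-(3 / 4) : ℝ) : ℝ) : ℂ)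
      = (((2 : ℝ) ^ (1 / 4 : ℝ) : ℝ) : ℂ) * (1 / 2) := by
    have : (2 : ℝ) ^ (-(3 / 4) : ℝ) = 2 ^ (1 / 4 : ℝ) * 2 ^ (-1 : ℝ) := by
      rw [← Real.rpow_add (by norm_num)]; norm_num
    rw [this, Real.rpow_neg_one]
    push_cast
    ring
  rw [hs, h5, mul_assoc, ← mellin_gaussian (by rw [half_sub_re]; norm_num), ← integral_const_mul]
  have h6 : ∫ u, wInf xiInf u * (u : ℂ) ^ (-(Complex.I * s)) ∂dstar
      = ∫ u, (((u ^ (1 / 2 : ℝ) : ℝ) : ℂ) *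
      ((2 ^ (1 / 4 : ℝ) * Real.exp (-Real.pi * u ^ 2) : ℝ) : ℂ))
        * (u : ℂ) ^ (-(Complex.I * s)) ∂dstar := by
    refine integral_congr_ae ?_
    filter_upwards [h1] with u hu
    rw [hu]
  rw [h6, integral_dstar]
  refine setIntegral_congr_fun measurableSet_Ioi fun u hu => ?_
  have hu' : (0 : ℝ) < u := hu
  have huc : (u : ℂ) ≠ 0 := by exact_mod_cast hu'.ne'
  have h7 : (u : ℂ) ^ (1 / 2 - Complex.I * s - 1) = ((u⁻¹ : ℝ) : ℂ) * ((u ^ (1 / 2 : ℝ) : ℝ) : ℂ)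
      * (u : ℂ) ^ (-(Complex.I * s)) := by
    rw [Complex.ofReal_cpow hu'.le, Complex.ofReal_inv, ← Complex.cpow_neg_one,
      ← Complex.cpow_add _ _ huc, ← Complex.cpow_add _ _ huc]
    congr 1
    push_cast
    ring
  simp only [h7]
  push_cast
  ring

theorem VS_xi (S : Finset Nat.Primes) : VS S (etaS S xiInf) =ᵐ[mS S]
    fun _ => (((2 : ℝ) ^ (-(3 / 4) : ℝ) : ℝ) : ℂ) := by
  filter_upwards [VS_etaS S xiInf, mS_ae_of_volume S Fmu_wInf_xiInf] with s h1 h2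
  have := Gammaℝ_half_ne_zero s
  rw [h1, h2, mul_left_comm, inv_mul_cancel₀ this, mul_one]

end Gaussian

section CanonicalForm

variable (S : Finset Nat.Primes)

theorem two_rpow_ne : (((2 : ℝ) ^ (-(3 / 4) : ℝ) : ℝ) : ℂ) ≠ 0 := by
  exact_mod_cast (Real.rpow_pos_of_pos two_pos _).ne'

/-- The measure `m_S` is finite, since the constant `V_S ξ_S ≠ 0` is in `L²(m_S)`. -/
theorem mS_univ_ne_top : mS S Set.univ ≠ ∞ := by
  have h : MemLp (fun _ : ℝ => (((2 : ℝ) ^ (-(3 / 4) : ℝ) : ℝ) : ℂ)) 2 (mS S) :=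
    (memLp_congr_ae (VS_xi S)).1 (Lp.memLp _)
  rw [memLp_const_iff (by norm_num) (by norm_num)] at h
  exact (h.resolve_left two_rpow_ne).ne

theorem mS_univ_ne_zero : mS S Set.univ ≠ 0 := by
  intro h
  have h1 : ∀ᵐ s ∂mS S, False := by rw [ae_iff]; simpa using h
  have h2 := volume_ae_of_mS S h1
  rw [ae_iff] at h2
  simp at h2

instance : IsFiniteMeasure (mS S) := ⟨(mS_univ_ne_top S).lt_top⟩

theorem etaS_xi_ne_zero : etaS S xiInf ≠ 0 := by
  intro h
  have h1 := VS_xi S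
  rw [h, map_zero] at h1
  have h2 : ∀ᵐ s ∂mS S, False := by
    filter_upwards [h1, Lp.coeFn_zero ℂ 2 (mS S)] with s h1 h2
    rw [h2] at h1
    exact two_rpow_ne h1.symm
  rw [ae_iff] at h2
  exact mS_univ_ne_zero S (by simpa using h2)

/-- The norm of `ξ_S` in terms of the mass of `m_S`. -/
theorem norm_etaS_xi :
    ((2 : ℝ) ^ (3 / 4 : ℝ) * ‖etaS S xiInf‖ * Real.sqrt (2 * Real.pi)) ^ 2 = (mS S Set.univ).toReal := by
  have h1 : ENNReal.ofReal (‖VS S (etaS S xiInf)‖ ^ 2)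
      = ENNReal.ofReal (((2 : ℝ) ^ (-(3 / 4) : ℝ)) ^ 2) * mS S Set.univ := by
    rw [Lp_norm_sq, lintegral_congr_ae (g := fun _ => ENNReal.ofReal (((2 : ℝ) ^ (-(3 / 4) : ℝ)) ^ 2))]
    · rw [lintegral_const]
    · filter_upwards [VS_xi S] with s hs
      rw [hs, ← ofReal_norm_sq, Complex.norm_real, Real.norm_of_nonneg (by positivity)]
  have h2 := congrArg ENNReal.toReal h1
  rw [ENNReal.toReal_mul, ENNReal.toReal_ofReal (by positivity), ENNReal.toReal_ofReal (by positivity),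
    norm_VS] at h2
  have h3 : (2 : ℝ) ^ (3 / 4 : ℝ) * 2 ^ (-(3 / 4) : ℝ) = 1 := by
    rw [← Real.rpow_add two_pos]; norm_num
  calc _ = ((2 : ℝ) ^ (3 / 4 : ℝ)) ^ 2 * (Real.sqrt (2 * Real.pi) * ‖etaS S xiInf‖) ^ 2 := by ring
    _ = ((2 : ℝ) ^ (3 / 4 : ℝ) * 2 ^ (-(3 / 4) : ℝ)) ^ 2 * (mS S Set.univ).toReal := by rw [h2]; ring
    _ = _ := by rw [h3]; ring

theorem canonical_const : (mS S Set.univ)⁻¹ *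
    ‖(((2 : ℝ) ^ (3 / 4 : ℝ) * ‖etaS S xiInf‖ * Real.sqrt (2 * Real.pi) : ℝ) : ℂ)‖ₑ ^ 2 = 1 := by
  rw [← ofReal_norm_sq, Complex.norm_real, Real.norm_eq_abs, sq_abs, norm_etaS_xi,
    ENNReal.ofReal_toReal (mS_univ_ne_top S)]
  exact ENNReal.inv_mul_cancel (mS_univ_ne_zero S) (mS_univ_ne_top S)

/-- The unitary `2^{3/4} ‖ξ_S‖ V_S` onto `L²` of the probability measure proportional to `m_S`. -/
def US : HS S ≃ₗᵢ[ℂ] Lp ℂ 2 ((mS S Set.univ)⁻¹ • mS S) :=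
  (VU S).trans (scaleEquiv (mS S) (canonical_const S))

theorem ae_smul_mS {P : ℝ → Prop} : (∀ᵐ s ∂((mS S Set.univ)⁻¹ • mS S), P s) ↔ ∀ᵐ s ∂mS S, P s :=
  Measure.ae_ennreal_smul_measure_iff (by simp [mS_univ_ne_top S])

theorem US_apply (ξ : HS S) : US S ξ =ᵐ[mS S]
    fun s => (((2 : ℝ) ^ (3 / 4 : ℝ) * ‖etaS S xiInf‖ : ℝ) : ℂ) * VS S ξ s := by
  have h1 := (ae_smul_mS S).1 (scaleEquiv_apply (mS S) (canonical_const S) (VU S ξ))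
  filter_upwards [h1, Lp.coeFn_smul ((Real.sqrt (2 * Real.pi) : ℝ) : ℂ) (VU S ξ)] with s h1 h2
  rw [VS_eq_smul, h2]
  refine h1.trans ?_
  rw [Pi.smul_apply, smul_eq_mul]
  push_cast
  ring

theorem US_xi : US S ((‖etaS S xiInf‖⁻¹ : ℂ) • etaS S xiInf) =ᵐ[(mS S Set.univ)⁻¹ • mS S] fun _ => 1 := by
  rw [map_smul]
  have h0 : ((‖etaS S xiInf‖ : ℝ) : ℂ) ≠ 0 := by
    exact_mod_cast norm_ne_zero_iff.2 (etaS_xi_ne_zero S)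
  have h1 := (ae_smul_mS S).2 (US_apply S (etaS S xiInf))
  filter_upwards [h1, (ae_smul_mS S).2 (VS_xi S),
    Lp.coeFn_smul (‖etaS S xiInf‖⁻¹ : ℂ) (US S (etaS S xiInf))] with s h1 h2 h3
  rw [h3, Pi.smul_apply, h1, h2, smul_eq_mul]
  have h4 : (((2 : ℝ) ^ (3 / 4 : ℝ) : ℝ) : ℂ) * (((2 : ℝ) ^ (-(3 / 4) : ℝ) : ℝ) : ℂ) = 1 := by
    rw [← Complex.ofReal_mul, ← Real.rpow_add two_pos]; norm_num
  rw [Complex.ofReal_mul, mul_right_comm, h4, one_mul, inv_mul_cancel₀ h0]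

instance : IsProbabilityMeasure ((mS S Set.univ)⁻¹ • mS S) :=
  ⟨by rw [Measure.smul_apply, smul_eq_mul, ENNReal.inv_mul_cancel (mS_univ_ne_zero S) (mS_univ_ne_top S)]⟩

end CanonicalForm

/-! ### Decay of the Euler factors and determination by moments -/

section GammaDecay

/-- `|Γ(x + i y)|` is bounded by `Γ(x)` for `x > 0`. -/
theorem norm_Gamma_le {z : ℂ} (hz : 0 < z.re) : ‖Complex.Gamma z‖ ≤ Real.Gamma z.re := by
  rw [Complex.Gamma_eq_integral hz, Complex.GammaIntegral, Real.Gamma_eq_integral hz]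
  refine (norm_integral_le_integral_norm _).trans (le_of_eq ?_)
  refine setIntegral_congr_fun measurableSet_Ioi fun t ht => ?_
  have ht' : (0 : ℝ) < t := ht
  simp only [norm_mul]
  rw [Complex.norm_cpow_eq_rpow_re_of_pos ht', Complex.norm_real,
    Real.norm_of_nonneg (Real.exp_pos _).le]
  simp

/-- Induction on `n` with the functional equation `Γ(z + 1) = z Γ(z)`. -/
theorem pow_mul_norm_Gamma_le {z : ℂ} (hz : 0 < z.re) (n : ℕ) :
    |z.im| ^ n * ‖Complex.Gamma z‖ ≤ Real.Gamma (z.re + n) := by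
  induction n generalizing z with
  | zero => simpa using norm_Gamma_le hz
  | succ n ih =>
    have hz0 : z ≠ 0 := fun h => by simp [h] at hz
    have h1 := ih (z := z + 1) (by simp; linarith)
    rw [Complex.Gamma_add_one z hz0, norm_mul] at h1
    simp only [Complex.add_im, Complex.one_im, add_zero, Complex.add_re, Complex.one_re] at h1
    calc |z.im| ^ (n + 1) * ‖Complex.Gamma z‖
        = |z.im| ^ n * (|z.im| * ‖Complex.Gamma z‖) := by ring
      _ ≤ |z.im| ^ n * (‖z‖ * ‖Complex.Gamma z‖) := by
          gcongr; exact Complex.abs_im_le_norm z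
      _ ≤ Real.Gamma (z.re + 1 + n) := h1
      _ = _ := by push_cast; ring_nf

theorem Gamma_add_nat_le {x : ℝ} (hx : 0 < x) (hx1 : x ≤ 1) (n : ℕ) :
    Real.Gamma (x + n) ≤ n.factorial * Real.Gamma x := by
  induction n with
  | zero => simp
  | succ n ih =>
    have h : Real.Gamma (x + (n + 1 : ℕ)) = (x + n) * Real.Gamma (x + n) := by
      rw [← Real.Gamma_add_one (by positivity)]; push_cast; ring_nf
    rw [h, Nat.factorial_succ]
    push_cast
    have h2 : 0 ≤ Real.Gamma x := Real.Gamma_nonneg_of_nonneg hx.le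
    calc (x + n) * Real.Gamma (x + n) ≤ (n + 1) * (n.factorial * Real.Gamma x) := by
          exact mul_le_mul (by linarith) ih (Real.Gamma_nonneg_of_nonneg (by positivity))
            (by positivity)
      _ = _ := by ring

/-- Exponential decay of the Gamma function on vertical lines. The functional equation gives
`|y|^n |Γ(x + iy)| ≤ Γ(x + n) ≤ n! Γ(x)`, and the exponential series with argument `|y| / 2` is then
bounded by a geometric series. -/
theorem norm_Gamma_le_exp {z : ℂ} (hz : 0 < z.re) (hz1 : z.re ≤ 1) :
    ‖Complex.Gamma z‖ ≤ 2 * Real.Gamma z.re * Real.exp (-(|z.im| / 2)) := by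
  have h1 : HasSum (fun n : ℕ => (|z.im| / 2) ^ n / n.factorial * ‖Complex.Gamma z‖)
      (Real.exp (|z.im| / 2) * ‖Complex.Gamma z‖) := by
    rw [Real.exp_eq_exp_ℝ]
    exact (NormedSpace.expSeries_div_hasSum_exp (|z.im| / 2)).mul_right _
  have h2 := (hasSum_geometric_of_lt_one (r := (1 / 2 : ℝ)) (by norm_num) (by norm_num)).mul_right
    (Real.Gamma z.re)
  have h3 := hasSum_le (fun n : ℕ => ?_) h1 h2
  · rw [Real.exp_neg, ← div_eq_mul_inv, le_div_iff₀ (Real.exp_pos _), mul_comm]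
    refine h3.trans (le_of_eq ?_)
    norm_num
  · have h4 := (pow_mul_norm_Gamma_le hz n).trans (Gamma_add_nat_le hz hz1 n)
    have hf : (0 : ℝ) < n.factorial := by positivity
    calc (|z.im| / 2) ^ n / n.factorial * ‖Complex.Gamma z‖
        = (1 / 2) ^ n * ((|z.im| ^ n * ‖Complex.Gamma z‖) / n.factorial) := by
          rw [div_pow, div_pow, one_pow]; ring
      _ ≤ (1 / 2) ^ n * Real.Gamma z.re := by
          gcongr
          rw [div_le_iff₀ hf]; linarith

variable (S : Finset Nat.Primes)

theorem norm_finiteEuler_le (s : ℝ) :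
    ‖finiteEuler S s‖ ≤ ∏ p : S, (1 - (((p : Nat.Primes) : ℕ) : ℝ) ^ (-(1 / 2) : ℝ))⁻¹ := by
  rw [finiteEuler, norm_prod]
  refine Finset.prod_le_prod (fun _ _ => norm_nonneg _) fun p _ => ?_
  rw [eulerFactor, norm_inv]
  have hp : 0 < ((p : Nat.Primes) : ℕ) := p.1.2.pos
  have h1 : (((p : Nat.Primes) : ℕ) : ℝ) ^ (-(1 / 2) : ℝ) < 1 :=
    Real.rpow_lt_one_of_one_lt_of_neg (by exact_mod_cast p.1.2.one_lt) (by norm_num)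
  refine inv_anti₀ (by linarith) ?_
  have h2 := norm_sub_norm_le (1 : ℂ) ((((p : Nat.Primes) : ℕ) : ℂ) ^ (-(1 / 2 - Complex.I * s)))
  rw [Complex.norm_natCast_cpow_of_pos hp, Complex.neg_re, half_sub_re, norm_one] at h2
  exact h2

/-- The product of the Euler factors decays exponentially on the critical line. -/
theorem exists_fullEuler_bound : ∃ C, ∀ s : ℝ, ‖fullEuler S s‖ ≤ C * Real.exp (-(|s| / 4)) := by
  refine ⟨Real.pi ^ (-(1 / 4) : ℝ) * (2 * Real.Gamma (1 / 4))
    * ∏ p : S, (1 - (((p : Nat.Primes) : ℕ) : ℝ) ^ (-(1 / 2) : ℝ))⁻¹, fun s => ?_⟩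
  have hre : ((1 / 2 - Complex.I * s : ℂ) / 2).re = 1 / 4 := by simp; norm_num
  have him : ((1 / 2 - Complex.I * s : ℂ) / 2).im = -(s / 2) := by simp [neg_div]
  have h1 := norm_Gamma_le_exp (z := (1 / 2 - Complex.I * s : ℂ) / 2) (by rw [hre]; norm_num)
    (by rw [hre]; norm_num)
  rw [hre, him] at h1
  have h2 : ‖(Real.pi : ℂ) ^ (-(1 / 2 - Complex.I * s : ℂ) / 2)‖ = Real.pi ^ (-(1 / 4) : ℝ) := by
    rw [Complex.norm_cpow_eq_rpow_re_of_pos Real.pi_pos, neg_div, Complex.neg_re, hre]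
  have h3 : Real.exp (-(|(-(s / 2))| / 2)) = Real.exp (-(|s| / 4)) := by
    rw [abs_neg, abs_div, abs_two]; ring_nf
  rw [h3] at h1
  have hP := (norm_nonneg _).trans (norm_finiteEuler_le S s)
  rw [fullEuler, norm_mul, Complex.Gammaℝ_def, norm_mul, h2]
  calc _ ≤ Real.pi ^ (-(1 / 4) : ℝ) * (2 * Real.Gamma (1 / 4) * Real.exp (-(|s| / 4)))
        * ∏ p : S, (1 - (((p : Nat.Primes) : ℕ) : ℝ) ^ (-(1 / 2) : ℝ))⁻¹ := by
        gcongr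
        exact norm_finiteEuler_le S s
    _ = _ := by ring

end GammaDecay

section Moments

theorem pow_abs_le_exp {b : ℝ} (hb : 0 < b) (n : ℕ) (s : ℝ) :
    |s| ^ n ≤ n.factorial / b ^ n * Real.exp (b * |s|) := by
  have h := Real.pow_div_factorial_le_exp (b * |s|) (by positivity) n
  rw [div_le_iff₀ (by positivity), mul_pow] at h
  rw [div_mul_eq_mul_div, le_div_iff₀ (by positivity)]
  linarith

theorem integrable_exp_of_lt {q : ℝ → ℂ} {a : ℝ}
    (hq : Integrable (fun s => ((Real.exp (a * |s|) : ℝ) : ℂ) * q s))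
    (hqm : AEStronglyMeasurable q) {b : ℝ} (hb : b < a) (n : ℕ) :
    Integrable fun s => ((|s| ^ n * Real.exp (b * |s|) : ℝ) : ℂ) * q s := by
  have hab : 0 < a - b := by linarith
  refine (hq.norm.const_mul (n.factorial / (a - b) ^ n)).mono' ?_ (Eventually.of_forall fun s => ?_)
  · exact (Continuous.aestronglyMeasurable (by fun_prop)).mul hqm
  · rw [norm_mul, norm_mul, Complex.norm_real, Complex.norm_real, Real.norm_of_nonneg (by positivity),
      Real.norm_of_nonneg (by positivity)]
    calc |s| ^ n * Real.exp (b * |s|) * ‖q s‖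
        ≤ (n.factorial / (a - b) ^ n * Real.exp ((a - b) * |s|)) * Real.exp (b * |s|) * ‖q s‖ := by
          gcongr; exact pow_abs_le_exp hab n s
      _ = n.factorial / (a - b) ^ n * (Real.exp ((a - b) * |s| + b * |s|) * ‖q s‖) := by
          rw [Real.exp_add]; ring
      _ = _ := by rw [← add_mul, sub_add_cancel]

/-- If all the moments of `e^{its} q(s)` vanish, then so do those of `e^{i(t+r)s} q(s)` for `r` less than
the exponential decay rate of `q`, by expanding `e^{irs}`. -/
theorem moments_shift {q : ℝ → ℂ} {a : ℝ}
    (hq : Integrable fun s => ((Real.exp (a * |s|) : ℝ) : ℂ) * q s) (hqm : AEStronglyMeasurable q)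
    {t r : ℝ} (hr : |r| < a)
    (h : ∀ n : ℕ, ∫ s : ℝ, (s : ℂ) ^ n * (Complex.exp (Complex.I * (t * s)) * q s) = 0) (n : ℕ) :
    ∫ s : ℝ, (s : ℂ) ^ n * (Complex.exp (Complex.I * ((t + r) * s)) * q s) = 0 := by
  have hnorm : ∀ s : ℝ, ‖Complex.exp (Complex.I * (t * s))‖ = 1 := fun s => by
    rw [← Complex.ofReal_mul, Complex.norm_exp_I_mul_ofReal]
  have key := hasSum_integral_of_dominated_convergence (μ := (volume : Measure ℝ))
    (F := fun (m : ℕ) (s : ℝ) => (Complex.I * r * s) ^ m / m.factorial *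
      ((s : ℂ) ^ n * (Complex.exp (Complex.I * (t * s)) * q s)))
    (f := fun s : ℝ => (s : ℂ) ^ n * (Complex.exp (Complex.I * ((t + r) * s)) * q s))
    (fun m s => (|r| * |s|) ^ m / m.factorial * (|s| ^ n * ‖q s‖)) ?_ ?_ ?_ ?_ ?_
  · refine key.unique ?_
    convert hasSum_zero with m
    have e : ∀ s : ℝ, (Complex.I * r * s) ^ m / m.factorial *
        ((s : ℂ) ^ n * (Complex.exp (Complex.I * (t * s)) * q s))
        = ((Complex.I * r) ^ m / m.factorial) *
          ((s : ℂ) ^ (m + n) * (Complex.exp (Complex.I * (t * s)) * q s)) := fun s => by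
      rw [mul_pow, pow_add]; ring
    simp only [e]
    rw [integral_const_mul, h, mul_zero]
  · intro m
    exact (Continuous.aestronglyMeasurable (by fun_prop)).mul
      ((Continuous.aestronglyMeasurable (by fun_prop)).mul
        ((Continuous.aestronglyMeasurable (by fun_prop)).mul hqm))
  · intro m
    refine Eventually.of_forall fun s => le_of_eq ?_
    rw [norm_mul, norm_mul, norm_mul, hnorm, norm_div, norm_pow, norm_pow, norm_mul, norm_mul]
    simp
  · refine Eventually.of_forall fun s => ?_
    exact (NormedSpace.expSeries_div_hasSum_exp (|r| * |s|)).summable.mul_right _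
  · have e : ∀ s : ℝ, ∑' m : ℕ, (|r| * |s|) ^ m / m.factorial * (|s| ^ n * ‖q s‖)
        = ‖((|s| ^ n * Real.exp (|r| * |s|) : ℝ) : ℂ) * q s‖ := fun s => by
      rw [tsum_mul_right, (NormedSpace.expSeries_div_hasSum_exp (|r| * |s|)).tsum_eq,
        ← Real.exp_eq_exp_ℝ, norm_mul, Complex.norm_real, Real.norm_of_nonneg (by positivity)]
      ring
    simp only [e]
    exact (integrable_exp_of_lt hq hqm hr n).norm
  · refine Eventually.of_forall fun s => ?_
    have h1 := (NormedSpace.expSeries_div_hasSum_exp (Complex.I * r * s)).mul_right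
      ((s : ℂ) ^ n * (Complex.exp (Complex.I * (t * s)) * q s))
    rw [← Complex.exp_eq_exp_ℂ] at h1
    have e : Complex.exp (Complex.I * r * s) *
        ((s : ℂ) ^ n * (Complex.exp (Complex.I * (t * s)) * q s))
        = (s : ℂ) ^ n * (Complex.exp (Complex.I * ((t + r) * s)) * q s) := by
      rw [mul_left_comm, ← mul_assoc (Complex.exp _), ← Complex.exp_add]
      ring_nf
    rw [← e]
    exact h1

/-- A function with exponential decay all of whose moments vanish is zero: its Fourier transform
vanishes. -/
theorem ae_eq_zero_of_moments {q : ℝ → ℂ} {a : ℝ} (ha : 0 < a)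
    (hq : Integrable fun s => ((Real.exp (a * |s|) : ℝ) : ℂ) * q s) (hq2 : MemLp q 2)
    (h : ∀ n : ℕ, ∫ s : ℝ, (s : ℂ) ^ n * q s = 0) : q =ᵐ[volume] 0 := by
  have hqm := hq2.aestronglyMeasurable
  have hall : ∀ (r : ℝ), |r| < a → ∀ N : ℕ, ∀ n : ℕ,
      ∫ s : ℝ, (s : ℂ) ^ n * (Complex.exp (Complex.I * (((N * r : ℝ) : ℂ) * s)) * q s) = 0 := by
    intro r hr N
    induction N with
    | zero => intro n; simpa using h n
    | succ N ih =>
      intro n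
      have := moments_shift hq hqm hr ih n
      rw [← this]
      congr 1
      ext s
      push_cast
      ring_nf
  have hF : ∀ w : ℝ, 𝓕 q w = 0 := by
    intro w
    -- reach the frequency `-2π w` by `N` steps smaller than the decay rate `a`
    obtain ⟨N, hN⟩ := exists_nat_gt (|(-2 * Real.pi * w)| / a)
    have hN0 : (0 : ℝ) < N := lt_of_le_of_lt (by positivity) hN
    have := hall ((-2 * Real.pi * w) / N) (by
      have := (div_lt_iff₀ ha).1 hN
      rw [abs_div, Nat.abs_cast, div_lt_iff₀ hN0]
      linarith) N 0
    rw [mul_div_cancel₀ _ hN0.ne'] at this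
    rw [Real.fourier_real_eq_integral_exp_smul, ← this]
    congr 1
    ext s
    rw [pow_zero, one_mul, smul_eq_mul]
    congr 2
    push_cast
    ring
  have hqi : Integrable q := by
    have := integrable_exp_of_lt hq hqm ha 0
    simpa using this
  have h1 := Lp_fourier_eq_integral (hq2.toLp q) (hqi.congr hq2.coeFn_toLp.symm)
  have h2 : (𝓕 (hq2.toLp q) : Lp ℂ 2 (volume : Measure ℝ)) = 0 := by
    rw [Lp.eq_zero_iff_ae_eq_zero]
    filter_upwards [h1] with w hw
    rw [hw, Real.fourier_congr_ae hq2.coeFn_toLp, hF]; rfl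
  have h3 : hq2.toLp q = 0 := by
    rw [← norm_eq_zero, ← Lp.norm_fourier_eq, h2, norm_zero]
  rw [Lp.eq_zero_iff_ae_eq_zero] at h3
  exact hq2.coeFn_toLp.symm.trans h3

end Moments

/-! ### The scaling operator in the canonical form -/

section Generator

variable {μ : Measure ℝ} {h k : Lp ℂ 2 μ} {E : ℝ → Lp ℂ 2 μ}

theorem tendsto_slope_exp (s : ℝ) (z : ℂ) :
    Tendsto (fun t : ℝ => (t : ℂ)⁻¹ * (Complex.exp (Complex.I * (t * s : ℝ)) * z - z)) (𝓝[≠] 0)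
      (𝓝 (Complex.I * (s * z))) := by
  have h1 : HasDerivAt (fun t : ℝ => Complex.exp (Complex.I * (t * s : ℝ)) * z)
      (Complex.exp (Complex.I * ((0 : ℝ) * s : ℝ)) * (Complex.I * (s : ℝ)) * z) 0 := by
    refine HasDerivAt.mul_const ?_ z
    refine HasDerivAt.cexp ?_
    refine HasDerivAt.const_mul Complex.I ?_
    have := ((hasDerivAt_id (0 : ℝ)).mul_const s).ofReal_comp
    simpa using this
  have h2 := hasDerivAt_iff_tendsto_slope_zero.1 h1
  simp only [zero_add, zero_mul, Complex.ofReal_zero, mul_zero, Complex.exp_zero, one_mul,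
    Complex.real_smul, Complex.ofReal_inv, mul_assoc] at h2
  exact h2

theorem slope_ae (hE : ∀ t, E t =ᵐ[μ] fun s => Complex.exp (Complex.I * (t * s : ℝ)) * h s) (t : ℝ) :
    ((t : ℂ)⁻¹ • (E t - h) : Lp ℂ 2 μ) =ᵐ[μ]
      fun s => (t : ℂ)⁻¹ * (Complex.exp (Complex.I * (t * s : ℝ)) * h s - h s) := by
  filter_upwards [hE t, Lp.coeFn_smul (t : ℂ)⁻¹ (E t - h), Lp.coeFn_sub (E t) h] with s h1 h2 h3
  rw [h2, Pi.smul_apply, h3, Pi.sub_apply, h1, smul_eq_mul]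

/-- The generator of the group of multiplications by `e^{its}` in `L²(μ)` is the multiplication by `s`,
with its natural domain. -/
theorem tendsto_slope_iff (hE : ∀ t, E t =ᵐ[μ] fun s => Complex.exp (Complex.I * (t * s : ℝ)) * h s) :
    Tendsto (fun t : ℝ => (t : ℂ)⁻¹ • (E t - h)) (𝓝[≠] 0) (𝓝 (Complex.I • k)) ↔
      k =ᵐ[μ] fun s : ℝ => (s : ℂ) * h s := by
  constructor
  · intro H
    obtain ⟨ns, hns, hae⟩ := (tendstoInMeasure_of_tendsto_Lp H).exists_seq_tendsto_ae'
    have h1 := ae_all_iff.2 fun i => slope_ae hE (ns i)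
    filter_upwards [hae, h1, Lp.coeFn_smul Complex.I k] with s ha h1 h2
    have h3 := tendsto_nhds_unique ha (((tendsto_slope_exp s (h s)).comp hns).congr fun i =>
      (h1 i).symm)
    rw [h2, Pi.smul_apply, smul_eq_mul] at h3
    exact mul_left_cancel₀ Complex.I_ne_zero h3
  · intro hk
    rw [tendsto_iff_norm_sub_tendsto_zero]
    have hlim : Tendsto (fun t : ℝ => ∫⁻ s, ‖(t : ℂ)⁻¹ * (Complex.exp (Complex.I * (t * s : ℝ)) * h s - h s)
        - Complex.I * (s * h s)‖ₑ ^ 2 ∂μ) (𝓝[≠] 0) (𝓝 (∫⁻ s, 0 ∂μ)) := by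
      have hm := (Lp.stronglyMeasurable h).measurable
      refine tendsto_lintegral_filter_of_dominated_convergence (fun s => (2 * ‖k s‖ₑ) ^ 2) ?_ ?_ ?_ ?_
      · exact Eventually.of_forall fun t => by fun_prop
      · refine eventually_mem_nhdsWithin.mono fun t ht => ?_
        filter_upwards [hk] with s hs
        have ht' : (t : ℝ) ≠ 0 := ht
        gcongr
        have h5 : ∀ x : ℝ, (2 : ℝ≥0∞) * ENNReal.ofReal x = ENNReal.ofReal (2 * x) := fun x => by
          rw [ENNReal.ofReal_mul (by norm_num), ENNReal.ofReal_ofNat]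
        rw [hs, ← ofReal_norm, ← ofReal_norm, h5]
        refine ENNReal.ofReal_le_ofReal ?_
        refine (norm_sub_le _ _).trans ?_
        have e1 : (t : ℂ)⁻¹ * (Complex.exp (Complex.I * (t * s : ℝ)) * h s - h s)
            = (t : ℂ)⁻¹ * (Complex.exp (Complex.I * (t * s : ℝ)) - 1) * h s := by ring
        have e2 := Real.norm_exp_I_mul_ofReal_sub_one_le (x := t * s)
        rw [e1, norm_mul, norm_mul, norm_mul, norm_mul, Complex.norm_I, norm_inv, Complex.norm_real,
          Complex.norm_real, one_mul, two_mul]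
        have e3 : ‖t‖⁻¹ * ‖Complex.exp (Complex.I * (t * s : ℝ)) - 1‖ ≤ ‖s‖ := by
          rw [inv_mul_le_iff₀ (norm_pos_iff.2 ht'), ← norm_mul]
          exact e2
        gcongr
      · simp only [mul_pow]
        rw [lintegral_const_mul' _ _ (by simp), ← Lp_norm_sq]
        exact ENNReal.mul_ne_top (by simp) ENNReal.ofReal_ne_top
      · refine Eventually.of_forall fun s => ?_
        have h1 := ((tendsto_slope_exp s (h s)).sub_const (Complex.I * (s * h s)))
        rw [sub_self] at h1
        have h2 := ENNReal.Tendsto.pow (n := 2) h1.enorm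
        simpa using h2
    rw [lintegral_zero] at hlim
    have h2 : Tendsto (fun t : ℝ => ENNReal.ofReal (‖(t : ℂ)⁻¹ • (E t - h) - Complex.I • k‖ ^ 2))
        (𝓝[≠] 0) (𝓝 0) := by
      refine hlim.congr fun t => ?_
      rw [Lp_norm_sq]
      refine lintegral_congr_ae ?_
      filter_upwards [slope_ae hE t, hk, Lp.coeFn_smul Complex.I k,
        Lp.coeFn_sub ((t : ℂ)⁻¹ • (E t - h)) (Complex.I • k)] with s h1 h2 h3 h4
      rw [h4, Pi.sub_apply, h1, h3, Pi.smul_apply, h2, smul_eq_mul]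
    have h3 := (ENNReal.tendsto_toReal ENNReal.zero_ne_top).comp h2
    have h4 := h3.sqrt
    simpa [Function.comp_def, ENNReal.toReal_ofReal] using h4

end Generator

section Canonical

variable (S : Finset Nat.Primes)

/-- The probability measure proportional to `m_S`. -/
abbrev probS : Measure ℝ := (mS S Set.univ)⁻¹ • mS S

theorem modC_scaleClass (t : ℝ) : modC S (scaleClass S t) = Real.exp t := by
  rw [scaleClass, modC_mk]
  simp [modA, MulEquiv.prodUnits]

/-- The archimedean scaling group on the space of invariant vectors. -/
def scaleHS (t : ℝ) (ξ : HS S) : HS S := ⟨theta S (scaleClass S t) ξ, theta_mem S _ ξ⟩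

theorem US_scaleHS (ξ : HS S) (t : ℝ) :
    US S (scaleHS S t ξ) =ᵐ[probS S] fun s => Complex.exp (Complex.I * (t * s : ℝ)) * US S ξ s := by
  rw [EventuallyEq, ae_smul_mS]
  have h1 := mS_ae_of_volume S (Fmu_dil (modC_pos S (scaleClass S t)) (wS S ξ))
  filter_upwards [US_apply S ξ, US_apply S (scaleHS S t ξ), VS_apply S ξ, VS_apply S (scaleHS S t ξ),
    h1] with s h1 h2 h3 h4 h5
  rw [h1, h2, h3, h4, scaleHS, wS_theta, h5, modC_scaleClass, cpow_exp]
  have : (t : ℂ) * (Complex.I * s) = Complex.I * (t * s : ℝ) := by push_cast; ring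
  rw [this]
  ring

/-- In the canonical form the scaling group is the group of multiplications by `e^{its}`, hence its
generator is the multiplication by the variable. -/
theorem isGeneratorValue_iff (ξ ζ : HS S) :
    IsGeneratorValue S ξ ζ ↔ US S ζ =ᵐ[probS S] fun s : ℝ => (s : ℂ) * US S ξ s := by
  rw [← tendsto_slope_iff (US_scaleHS S ξ)]
  have e1 : (fun t : ℝ => (t : ℂ)⁻¹ • (theta S (scaleClass S t) (ξ : L2X S) - (ξ : L2X S)))
      = fun t : ℝ => (((t : ℂ)⁻¹ • (scaleHS S t ξ - ξ) : HS S) : L2X S) := rfl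
  have e2 : (fun t : ℝ => (t : ℂ)⁻¹ • (US S (scaleHS S t ξ) - US S ξ))
      = fun t : ℝ => US S ((t : ℂ)⁻¹ • (scaleHS S t ξ - ξ)) := by
    ext1 t; rw [map_smul, map_sub]
  have e3 : Complex.I • US S ζ = US S (Complex.I • ζ) := by rw [map_smul]
  have e4 : (Complex.I • (ζ : L2X S)) = ((Complex.I • ζ : HS S) : L2X S) := rfl
  rw [IsGeneratorValue, e1, e2, e3, e4]
  rw [← tendsto_subtype_rng (f := fun t : ℝ => (t : ℂ)⁻¹ • (scaleHS S t ξ - ξ))]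
  exact ((US S).toHomeomorph.isInducing.tendsto_nhds_iff
    (f := fun t : ℝ => (t : ℂ)⁻¹ • (scaleHS S t ξ - ξ)))

theorem isGeneratorValue_scalingOp (ξ : (scalingOp S).domain) :
    IsGeneratorValue S ξ (scalingOp S ξ) := ξ.2.choose_spec

theorem mem_domain_of {ξ ζ : HS S} (h : US S ζ =ᵐ[probS S] fun s : ℝ => (s : ℂ) * US S ξ s) :
    ∃ hξ : ξ ∈ (scalingOp S).domain, scalingOp S ⟨ξ, hξ⟩ = ζ := by
  have h1 := (isGeneratorValue_iff S ξ ζ).2 h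
  exact ⟨⟨ζ, h1⟩, (isGeneratorValue_scalingOp S ⟨ξ, ⟨ζ, h1⟩⟩).unique S h1⟩

theorem US_scalingOp (ξ : (scalingOp S).domain) :
    US S (scalingOp S ξ) =ᵐ[probS S] fun s : ℝ => (s : ℂ) * US S (ξ : HS S) s :=
  (isGeneratorValue_iff S _ _).1 (isGeneratorValue_scalingOp S ξ)

theorem mem_domain_of_memLp {ξ : HS S} (h : MemLp (fun s : ℝ => (s : ℂ) * US S ξ s) 2 (probS S)) :
    ξ ∈ (scalingOp S).domain := by
  refine (mem_domain_of S (ξ := ξ) (ζ := (US S).symm (h.toLp _)) ?_).1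
  rw [LinearIsometryEquiv.apply_symm_apply]
  exact h.coeFn_toLp

theorem isCanonicalForm_US :
    IsCanonicalForm (scalingOp S) ((‖etaS S xiInf‖⁻¹ : ℂ) • etaS S xiInf) (probS S) (US S) where
  isProbabilityMeasure := inferInstance
  mem_domain_iff ξ :=
    ⟨fun h => (memLp_congr_ae (US_scalingOp S ⟨ξ, h⟩)).1 (Lp.memLp _), mem_domain_of_memLp S⟩
  map_operator := US_scalingOp S
  map_vector := US_xi S

theorem scalingOp_symmetric (x y : (scalingOp S).domain) :
    inner ℂ (scalingOp S x) (y : HS S) = inner ℂ (x : HS S) (scalingOp S y) := by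
  rw [← (US S).inner_map_map, ← (US S).inner_map_map, L2.inner_def, L2.inner_def]
  refine integral_congr_ae ?_
  filter_upwards [US_scalingOp S x, US_scalingOp S y] with s h1 h2
  rw [h1, h2]
  simp only [RCLike.inner_apply, map_mul, Complex.conj_ofReal]
  ring

/-- The resolvent at `∓ i` is the multiplication by `(s ± i)⁻¹` in the canonical form. -/
theorem exists_resolvent {c : ℝ} (hc : |c| = 1) (y : HS S) :
    ∃ x : (scalingOp S).domain, scalingOp S x + (c * Complex.I) • (x : HS S) = y := by
  have h0 : ∀ s : ℝ, (s : ℂ) + c * Complex.I ≠ 0 := fun s h => by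
    have := congrArg Complex.im h
    simp only [Complex.add_im, Complex.ofReal_im, Complex.mul_im, Complex.ofReal_re, Complex.I_im,
      mul_one, Complex.I_re, mul_zero, add_zero, zero_add, Complex.zero_im] at this
    simp [this] at hc
  have h1 : ∀ s : ℝ, ‖((s : ℂ) + c * Complex.I)⁻¹‖ ≤ 1 := fun s => by
    rw [norm_inv]
    refine inv_le_one_of_one_le₀ ?_
    have := Complex.abs_im_le_norm ((s : ℂ) + c * Complex.I)
    simpa [hc] using this
  have h2 : ∀ s : ℝ, ‖(s : ℂ) * ((s : ℂ) + c * Complex.I)⁻¹‖ ≤ 1 := fun s => by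
    rw [norm_mul, norm_inv, ← div_eq_mul_inv, div_le_one (norm_pos_iff.2 (h0 s))]
    have := Complex.abs_re_le_norm ((s : ℂ) + c * Complex.I)
    simpa using this
  have hm := Lp.aestronglyMeasurable (US S y)
  have m1 : MemLp (fun s : ℝ => ((s : ℂ) + c * Complex.I)⁻¹ * US S y s) 2 (probS S) := by
    refine MemLp.of_le (Lp.memLp (US S y)) ((Measurable.aestronglyMeasurable (by fun_prop)).mul hm)
      (Eventually.of_forall fun s => ?_)
    rw [norm_mul]
    exact mul_le_of_le_one_left (norm_nonneg _) (h1 s)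
  have m2 : MemLp (fun s : ℝ => (s : ℂ) * (((s : ℂ) + c * Complex.I)⁻¹ * US S y s)) 2 (probS S) := by
    refine MemLp.of_le (Lp.memLp (US S y)) ((Measurable.aestronglyMeasurable (by fun_prop)).mul
      ((Measurable.aestronglyMeasurable (by fun_prop)).mul hm)) (Eventually.of_forall fun s => ?_)
    rw [← mul_assoc, norm_mul]
    exact mul_le_of_le_one_left (norm_nonneg _) (h2 s)
  obtain ⟨hx, hD⟩ := mem_domain_of S (ξ := (US S).symm (m1.toLp _)) (ζ := (US S).symm (m2.toLp _)) (by
    rw [LinearIsometryEquiv.apply_symm_apply, LinearIsometryEquiv.apply_symm_apply]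
    filter_upwards [m1.coeFn_toLp, m2.coeFn_toLp] with s h1 h2
    rw [h1, h2])
  refine ⟨⟨_, hx⟩, ?_⟩
  rw [hD]
  apply (US S).injective
  rw [map_add, map_smul, LinearIsometryEquiv.apply_symm_apply, LinearIsometryEquiv.apply_symm_apply]
  rw [Lp.ext_iff]
  filter_upwards [m1.coeFn_toLp, m2.coeFn_toLp, Lp.coeFn_add (m2.toLp _) ((c * Complex.I) • m1.toLp _),
    Lp.coeFn_smul (c * Complex.I) (m1.toLp _)] with s h1 h2 h3 h4
  rw [h3, Pi.add_apply, h4, Pi.smul_apply, h1, h2, smul_eq_mul, ← add_mul, ← mul_assoc,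
    mul_inv_cancel₀ (h0 s), one_mul]

end Canonical

/-! ### The cyclic pair and its grading -/

section Cyclic

variable (S : Finset Nat.Primes)

theorem memLp_mS_iff {f : ℝ → ℂ} (hf : Measurable f) :
    MemLp f 2 (mS S) ↔ MemLp (fun s => f s * (‖fullEuler S s‖ : ℂ)) 2 := by
  have hm := (continuous_fullEuler S).measurable
  rw [memLp_two_iff hf.aestronglyMeasurable, memLp_two_iff (by fun_prop), mS,
    lintegral_withDensity_eq_lintegral_mul _ (by fun_prop) (by fun_prop)]
  have : ∀ s, ‖f s * (‖fullEuler S s‖ : ℂ)‖ₑ ^ 2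
      = ENNReal.ofReal (‖fullEuler S s‖ ^ 2) * ‖f s‖ₑ ^ 2 := fun s => by
    rw [ofReal_norm_sq, enorm_mul, mul_pow, mul_comm]
    congr 2
    rw [← ofReal_norm, Complex.norm_real, norm_norm, ofReal_norm]
  simp only [this, Pi.mul_apply]

theorem memLp_probS_iff {f : ℝ → ℂ} : MemLp f 2 (probS S) ↔ MemLp f 2 (mS S) := by
  refine ⟨fun h => ?_, fun h => h.smul_measure (by simp [mS_univ_ne_zero S])⟩
  have := h.smul_measure (c := mS S Set.univ) (mS_univ_ne_top S)
  rwa [smul_smul, ENNReal.mul_inv_cancel (mS_univ_ne_zero S) (mS_univ_ne_top S), one_smul] at this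

theorem integrable_exp_neg_mul_abs {c : ℝ} (hc : 0 < c) :
    Integrable fun s : ℝ => Real.exp (-c * |s|) := by
  rw [← integrableOn_univ, ← Set.Iic_union_Ioi (a := (0 : ℝ))]
  refine IntegrableOn.union ?_ ?_
  · refine (integrableOn_exp_mul_Iic hc 0).congr_fun (fun s hs => ?_) measurableSet_Iic
    have hs' : s ≤ 0 := hs
    simp only [abs_of_nonpos hs']
    ring_nf
  · refine (exp_neg_integrableOn_Ioi 0 hc).congr_fun (fun s hs => ?_) measurableSet_Ioi
    have hs' : 0 < s := hs
    simp only [abs_of_pos hs']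

/-- The density of `m_S` beats small exponentials. -/
theorem memLp_exp_fullEuler {b : ℝ} (hb : b < 1 / 4) :
    MemLp (fun s : ℝ => ((Real.exp (b * |s|) : ℝ) : ℂ) * (‖fullEuler S s‖ : ℂ)) 2 := by
  obtain ⟨C, hC⟩ := exists_fullEuler_bound S
  have hm := (continuous_fullEuler S).measurable
  have hint : MemLp (fun s : ℝ => Real.exp (-((1 / 4 - b) * |s|))) 2 := by
    rw [memLp_two_iff_integrable_sq (by fun_prop)]
    have h1 := integrable_exp_neg_mul_abs (c := 2 * (1 / 4 - b)) (by linarith)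
    refine h1.congr (Eventually.of_forall fun s => ?_)
    simp only
    rw [← Real.exp_nat_mul]
    congr 1
    push_cast
    ring
  refine (hint.const_mul C).mono (by fun_prop) (Eventually.of_forall fun s => ?_)
  rw [norm_mul, Complex.norm_real, Complex.norm_real, norm_norm, Real.norm_of_nonneg (Real.exp_pos _).le]
  refine le_trans ?_ (le_abs_self _)
  calc _ ≤ Real.exp (b * |s|) * (C * Real.exp (-(|s| / 4))) := by gcongr; exact hC s
    _ = C * (Real.exp (b * |s|) * Real.exp (-(|s| / 4))) := by ring
    _ = _ := by rw [← Real.exp_add]; ring_nf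

theorem memLp_pow (n : ℕ) : MemLp (fun s : ℝ => (s : ℂ) ^ n) 2 (probS S) := by
  have hm := (continuous_fullEuler S).measurable
  rw [memLp_probS_iff, memLp_mS_iff S (by fun_prop)]
  refine ((memLp_exp_fullEuler S (b := 1 / 8) (by norm_num)).const_mul
    ((n.factorial / (1 / 8) ^ n : ℝ) : ℂ)).mono (by fun_prop) (Eventually.of_forall fun s => ?_)
  have h1 := pow_abs_le_exp (b := 1 / 8) (by norm_num) n s
  rw [norm_mul, norm_mul, norm_mul, ← mul_assoc, norm_pow, Complex.norm_real, Complex.norm_real,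
    Complex.norm_real, Complex.norm_real, Real.norm_of_nonneg (Real.exp_pos (1 / 8 * |s|)).le,
    Real.norm_eq_abs s, Real.norm_of_nonneg (by positivity : (0 : ℝ) ≤ n.factorial / (1 / 8) ^ n)]
  gcongr

/-- The vectors `𝕊^n ξ_S / ‖ξ_S‖`: in the canonical form they are the powers of the variable. -/
def cyclicVec (n : ℕ) : HS S := (US S).symm ((memLp_pow S n).toLp _)

theorem US_cyclicVec (n : ℕ) : US S (cyclicVec S n) =ᵐ[probS S] fun s : ℝ => (s : ℂ) ^ n := by
  rw [cyclicVec, LinearIsometryEquiv.apply_symm_apply]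
  exact (memLp_pow S n).coeFn_toLp

theorem cyclicVec_mem (n : ℕ) : ∃ h : cyclicVec S n ∈ (scalingOp S).domain,
    scalingOp S ⟨cyclicVec S n, h⟩ = cyclicVec S (n + 1) := by
  refine mem_domain_of S ?_
  filter_upwards [US_cyclicVec S n, US_cyclicVec S (n + 1)] with s h1 h2
  rw [h1, h2, pow_succ']

theorem cyclicVec_zero : cyclicVec S 0 = (‖etaS S xiInf‖⁻¹ : ℂ) • etaS S xiInf := by
  apply (US S).injective
  rw [Lp.ext_iff]
  filter_upwards [US_cyclicVec S 0, US_xi S] with s h1 h2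
  rw [h1, h2, pow_zero]

/-- Polynomials are dense in `L²(m_S)`, the density of `m_S` being exponentially decreasing. -/
theorem dense_cyclicVec : Dense (Submodule.span ℂ (Set.range (cyclicVec S)) : Set (HS S)) := by
  rw [Submodule.dense_iff_topologicalClosure_eq_top, Submodule.topologicalClosure_eq_top_iff,
    Submodule.eq_bot_iff]
  intro x hx
  set h : ℝ → ℂ := fun s => US S x s with hh
  have hhm : Measurable h := (Lp.stronglyMeasurable (US S x)).measurable
  have hm := (continuous_fullEuler S).measurable
  have hg : MemLp (fun s => h s * (‖fullEuler S s‖ : ℂ)) 2 := by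
    rw [← memLp_mS_iff S hhm, ← memLp_probS_iff]
    exact Lp.memLp _
  have hmom : ∀ n : ℕ,
      ∫ s : ℝ, (s : ℂ) ^ n * (h s * (‖fullEuler S s‖ : ℂ) * (‖fullEuler S s‖ : ℂ)) = 0 := by
    intro n
    have h1 := (Submodule.mem_orthogonal _ _).1 hx (cyclicVec S n) (Submodule.subset_span ⟨n, rfl⟩)
    rw [← (US S).inner_map_map, L2.inner_def] at h1
    have h2 : ∫ s, inner ℂ (US S (cyclicVec S n) s) (US S x s) ∂(probS S)
        = ∫ s, (s : ℂ) ^ n * h s ∂(probS S) := by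
      refine integral_congr_ae ?_
      filter_upwards [US_cyclicVec S n] with s hs
      rw [hs, RCLike.inner_apply, map_pow, Complex.conj_ofReal, mul_comm]
    rw [h2, integral_smul_measure, smul_eq_zero] at h1
    have h3 := h1.resolve_left (by
      rw [ENNReal.toReal_eq_zero_iff]
      simp [mS_univ_ne_zero S, mS_univ_ne_top S])
    rw [mS, integral_withDensity_eq_integral_toReal_smul (by fun_prop) (by simp)] at h3
    rw [← h3]
    congr 1
    ext s
    rw [ENNReal.toReal_ofReal (by positivity), Complex.real_smul]
    push_cast
    ring
  have hq := ae_eq_zero_of_moments (a := 1 / 8) (by norm_num) ?_ ?_ hmom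
  · have h1 : US S x = 0 := by
      rw [Lp.eq_zero_iff_ae_eq_zero, EventuallyEq, ae_smul_mS]
      refine mS_ae_of_volume S ?_
      filter_upwards [hq] with s hs
      have : (‖fullEuler S s‖ : ℂ) ≠ 0 := by
        exact_mod_cast norm_ne_zero_iff.2 (fullEuler_ne_zero S s)
      simpa [this] using hs
    exact (US S).map_eq_zero_iff.1 h1
  · have := hg.integrable_mul (memLp_exp_fullEuler S (b := 1 / 8) (by norm_num))
    refine this.congr (Eventually.of_forall fun s => ?_)
    simp only [Pi.mul_apply]
    ring
  · obtain ⟨C, hC⟩ := exists_fullEuler_bound S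
    refine (hg.const_mul (C : ℂ)).mono (by fun_prop) (Eventually.of_forall fun s => ?_)
    have h1 : ‖fullEuler S s‖ ≤ |C| := by
      refine (hC s).trans ((le_abs_self _).trans ?_)
      rw [abs_mul, Real.abs_exp]
      exact mul_le_of_le_one_right (abs_nonneg _) (Real.exp_le_one_iff.2 (by
        have := abs_nonneg s; linarith))
    rw [norm_mul, norm_mul (C : ℂ), mul_comm, Complex.norm_real, Complex.norm_real, norm_norm,
      Real.norm_eq_abs]
    gcongr

theorem dense_domain : Dense ((scalingOp S).domain : Set (HS S)) := by
  refine (dense_cyclicVec S).mono ?_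
  rw [SetLike.coe_subset_coe, Submodule.span_le]
  rintro _ ⟨n, rfl⟩
  exact (cyclicVec_mem S n).1

/-- Selfadjointness from symmetry and the surjectivity of `𝕊 ± i`. -/
theorem isSelfAdjoint_scalingOp : IsSelfAdjoint (scalingOp S) := by
  refine isSelfAdjoint_of_surjective (dense_domain S) (scalingOp_symmetric S) (fun y => ?_) fun y => ?_
  · simpa using exists_resolvent S (c := 1) (by simp) y
  · obtain ⟨x, hx⟩ := exists_resolvent S (c := -1) (by simp) y
    refine ⟨x, ?_⟩
    rw [← hx, sub_eq_add_neg, ← neg_smul]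
    simp

instance : NullSingletonClass (probS S) := ⟨fun x => by
  have h : ∀ᵐ s ∂(probS S), s ≠ x := by
    rw [ae_smul_mS]
    exact mS_ae_of_volume S (Measure.ae_ne volume x)
  rw [ae_iff] at h
  simpa using h⟩

/-- In finite dimension the scaling operator would have an eigenvector, while the multiplication by the
variable has none since the measure has no atoms. -/
theorem not_finiteDimensional : ¬ FiniteDimensional ℂ (HS S) := by
  intro hfin
  have htop : (scalingOp S).domain = ⊤ := by
    have h1 := (dense_domain S).closure_eq
    rw [(Submodule.closed_of_finiteDimensional (scalingOp S).domain).closure_eq] at h1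
    exact SetLike.coe_injective (by rw [h1]; rfl)
  have : Nontrivial (HS S) := ⟨⟨etaS S xiInf, 0, etaS_xi_ne_zero S⟩⟩
  let T : Module.End ℂ (HS S) := (scalingOp S).toFun ∘ₗ
    LinearMap.codRestrict (scalingOp S).domain LinearMap.id fun x => htop ▸ Submodule.mem_top
  obtain ⟨c, hc⟩ := Module.End.exists_eigenvalue T
  obtain ⟨x, hx⟩ := hc.exists_hasEigenvector
  have hx1 : scalingOp S ⟨x, htop ▸ Submodule.mem_top⟩ = c • x := hx.apply_eq_smul
  refine hx.2 ((US S).map_eq_zero_iff.1 ?_)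
  rw [Lp.eq_zero_iff_ae_eq_zero]
  have h1 := US_scalingOp S ⟨x, htop ▸ Submodule.mem_top⟩
  rw [hx1, map_smul] at h1
  have h2 : ∀ᵐ s ∂(probS S), s ≠ c.re := Measure.ae_ne _ _
  filter_upwards [h1, h2, Lp.coeFn_smul c (US S x)] with s h1 h2 h3
  rw [h3, Pi.smul_apply, smul_eq_mul] at h1
  by_contra h0
  have := mul_right_cancel₀ h0 h1
  exact h2 (by rw [this, Complex.ofReal_re])

theorem isCyclicPair : IsCyclicPair (scalingOp S) ((‖etaS S xiInf‖⁻¹ : ℂ) • etaS S xiInf) where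
  infinite_dimensional := not_finiteDimensional S
  dense_domain := dense_domain S
  selfAdjoint := isSelfAdjoint_scalingOp S
  norm_eq_one := by
    rw [norm_smul, norm_inv, Complex.norm_real, norm_norm,
      inv_mul_cancel₀ (norm_ne_zero_iff.2 (etaS_xi_ne_zero S))]
  cyclic := ⟨cyclicVec S, cyclicVec_zero S, cyclicVec_mem S, dense_cyclicVec S⟩

end Cyclic

section Even

variable (S : Finset Nat.Primes)

open ComplexConjugate in
/-- The Euler factors are real on the real axis. In particular the density of `m_S` is even. -/
theorem fullEuler_neg (s : ℝ) : fullEuler S (-s) = conj (fullEuler S s) := by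
  have hz : (1 / 2 - Complex.I * ((-s : ℝ) : ℂ)) = conj (1 / 2 - Complex.I * (s : ℂ)) := by
    simp [Complex.conj_ofReal, map_ofNat]
  have hpow : ∀ (x : ℝ) (z : ℂ), 0 < x → (x : ℂ) ^ conj z = conj ((x : ℂ) ^ z) := fun x z hx => by
    rw [Complex.cpow_conj _ _ (by rw [Complex.arg_ofReal_of_nonneg hx.le]; exact Real.pi_pos.ne),
      Complex.conj_ofReal]
  rw [fullEuler, fullEuler, finiteEuler, finiteEuler, hz, map_mul, map_prod]
  congr 1
  · rw [Complex.Gammaℝ_def, Complex.Gammaℝ_def, map_mul, ← hpow _ _ Real.pi_pos, ← Complex.Gamma_conj]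
    simp only [map_neg, map_sub, map_div₀, map_ofNat]
  · refine Finset.prod_congr rfl fun p _ => ?_
    have hp : (0 : ℝ) < ((p : Nat.Primes) : ℕ) := by exact_mod_cast p.1.2.pos
    have h1 : ∀ z : ℂ, eulerFactor (p : Nat.Primes) (conj z) = conj (eulerFactor (p : Nat.Primes) z) := by
      intro z
      have := hpow _ (-z) hp
      rw [Complex.ofReal_natCast] at this
      rw [eulerFactor, eulerFactor, map_inv₀, map_sub, map_one, ← map_neg, this]
    exact h1 _

theorem measurePreserving_neg_probS : MeasurePreserving (fun s : ℝ => -s) (probS S) (probS S) := by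
  have hm := (continuous_fullEuler S).measurable
  have h1 : MeasurePreserving (fun s : ℝ => -s) (mS S) (mS S) := by
    refine ⟨measurable_neg, ?_⟩
    have h2 := map_withDensity_comp (μ := (volume : Measure ℝ)) (φ := fun s : ℝ => -s)
      measurable_neg (f := fun s => ENNReal.ofReal (‖fullEuler S s‖ ^ 2)) (by fun_prop)
    simp only [fullEuler_neg, RCLike.norm_conj] at h2
    rw [(Measure.measurePreserving_neg (volume : Measure ℝ)).map_eq] at h2
    exact h2
  exact h1.smul_measure _

/-- An isometric involution is selfadjoint. -/
theorem isSelfAdjoint_of_involutive {H : Type*} [NormedAddCommGroup H] [InnerProductSpace ℂ H]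
    [CompleteSpace H] (T : H →L[ℂ] H) (hn : ∀ x, ‖T x‖ = ‖x‖) (h2 : ∀ x, T (T x) = x) :
    IsSelfAdjoint T := by
  rw [ContinuousLinearMap.isSelfAdjoint_iff_isSymmetric]
  intro x y
  have h : ∀ x y, inner ℂ (T x) (T y) = inner ℂ x y := fun x y =>
    LinearIsometry.inner_map_map ⟨T.toLinearMap, hn⟩ x y
  have := h x (T y)
  rwa [h2] at this

/-- The reflection `h(s) ↦ h(-s)`. -/
def reflection : Lp ℂ 2 (probS S) →ₗᵢ[ℂ] Lp ℂ 2 (probS S) :=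
  Lp.compMeasurePreservingₗᵢ ℂ (fun s : ℝ => -s) (measurePreserving_neg_probS S)

theorem reflection_apply (g : Lp ℂ 2 (probS S)) :
    reflection S g =ᵐ[probS S] fun s => g (-s) :=
  Lp.coeFn_compMeasurePreserving g (measurePreserving_neg_probS S)

theorem reflection_reflection (g : Lp ℂ 2 (probS S)) : reflection S (reflection S g) = g := by
  rw [Lp.ext_iff]
  filter_upwards [reflection_apply S (reflection S g),
    (measurePreserving_neg_probS S).quasiMeasurePreserving.ae (reflection_apply S g)] with s h1 h2
  rw [h1, h2, neg_neg]

/-- The grading of the cyclic pair: the reflection `h(s) ↦ h(-s)` in the canonical form. -/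
def gradingS : HS S →L[ℂ] HS S :=
  ((US S).symm : Lp ℂ 2 (probS S) →L[ℂ] HS S) ∘L (reflection S).toContinuousLinearMap ∘L
    (US S : HS S →L[ℂ] Lp ℂ 2 (probS S))

theorem US_gradingS (ξ : HS S) : US S (gradingS S ξ) = reflection S (US S ξ) := by
  change US S ((US S).symm (reflection S (US S ξ))) = _
  rw [LinearIsometryEquiv.apply_symm_apply]

theorem VS_gradingS (ξ : HS S) : VS S (gradingS S ξ) =ᵐ[mS S] fun s => VS S ξ (-s) := by
  have h1 := (ae_smul_mS S).1 (reflection_apply S (US S ξ))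
  have hq := (measurePreserving_neg_probS S).quasiMeasurePreserving
  have h2 := (ae_smul_mS S).1 (hq.ae ((ae_smul_mS S).2 (US_apply S ξ)))
  have h0 : (((2 : ℝ) ^ (3 / 4 : ℝ) * ‖etaS S xiInf‖ : ℝ) : ℂ) ≠ 0 := by
    have := norm_pos_iff.2 (etaS_xi_ne_zero S)
    exact_mod_cast (by positivity : (2 : ℝ) ^ (3 / 4 : ℝ) * ‖etaS S xiInf‖ ≠ 0)
  filter_upwards [h1, h2, US_apply S (gradingS S ξ)] with s h1 h2 h3
  rw [US_gradingS, h1, h2] at h3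
  exact (mul_left_cancel₀ h0 h3).symm

theorem isGrading_gradingS :
    IsGrading (scalingOp S) ((‖etaS S xiInf‖⁻¹ : ℂ) • etaS S xiInf) (gradingS S) := by
  have hsq : ∀ x, gradingS S (gradingS S x) = x := fun x => by
    apply (US S).injective
    rw [US_gradingS, US_gradingS, reflection_reflection]
  have hq := (measurePreserving_neg_probS S).quasiMeasurePreserving
  refine ⟨hsq, isSelfAdjoint_of_involutive _ (fun x => ?_) hsq, fun x => mem_domain_of S ?_, ?_⟩
  · rw [← (US S).norm_map, US_gradingS, LinearIsometry.norm_map, LinearIsometryEquiv.norm_map]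
  · rw [map_neg, US_gradingS, US_gradingS]
    filter_upwards [Lp.coeFn_neg (reflection S (US S (scalingOp S x))),
      reflection_apply S (US S (scalingOp S x)), reflection_apply S (US S x),
      hq.ae (US_scalingOp S x)] with s h1 h2 h3 h4
    rw [h1, Pi.neg_apply, h2, h3, h4]
    push_cast
    ring
  · apply (US S).injective
    rw [US_gradingS, Lp.ext_iff]
    filter_upwards [reflection_apply S (US S ((‖etaS S xiInf‖⁻¹ : ℂ) • etaS S xiInf)), US_xi S,
      hq.ae (US_xi S)] with s h1 h2 h3
    rw [h1, h2, h3]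

end Even

/-! ### The Fourier transform of `ℚ_p` -/

section LocalFourier

variable {p : ℕ} [hp : Fact p.Prime]

theorem map_mul_haarP {a : ℚ_[p]} (ha : a ≠ 0) :
    Measure.map (fun x => a * x) (haarP p) = ENNReal.ofReal ‖a‖⁻¹ • haarP p := by
  let e : ℚ_[p] ≃ₜ+ ℚ_[p] :=
    { Equiv.mulLeft₀ a ha with
      map_add' := mul_add _
      continuous_toFun := continuous_const_mul _
      continuous_invFun := continuous_const_mul _ }
  have h := fun s : Set ℚ_[p] => addEquivAddHaarChar_smul_preimage (haarP p) (X := s) e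
  have hc : (addEquivAddHaarChar e : ℝ≥0∞) * ENNReal.ofReal ‖a‖⁻¹ = 1 := by
    have h1 := h (Metric.closedBall 0 1)
    have h2 : e ⁻¹' Metric.closedBall 0 1 = {x | ‖a * x‖ ≤ 1} := by
      ext x; simp only [Set.mem_preimage, mem_closedBall_zero_iff]; rfl
    rwa [h2, haarP_mul_le_one p ha, haarP_closedBall_one, ENNReal.smul_def, smul_eq_mul] at h1
  ext s hs
  rw [Measure.map_apply (measurable_const_mul a) hs, Measure.smul_apply, smul_eq_mul]
  have h2 := h s
  rw [ENNReal.smul_def, smul_eq_mul] at h2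
  rw [← h2, ← mul_assoc, mul_comm (ENNReal.ofReal _), hc, one_mul]
  rfl

/-- Change of variable for the Haar measure of `ℚ_p`. -/
theorem integral_mul_haarP {a : ℚ_[p]} (ha : a ≠ 0) (f : ℚ_[p] → ℂ) :
    ∫ x, f (a * x) ∂haarP p = ((‖a‖⁻¹ : ℝ) : ℂ) * ∫ x, f x ∂haarP p := by
  have h1 : MeasurableEmbedding fun x : ℚ_[p] => a * x := (Homeomorph.mulLeft₀ a ha).measurableEmbedding
  rw [← h1.integral_map, map_mul_haarP ha, integral_smul_measure,
    ENNReal.toReal_ofReal (by positivity), Complex.real_smul]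

/-- Schwartz–Bruhat functions on `ℚ_p`. -/
def IsSB (φ : ℚ_[p] → ℂ) : Prop := IsLocallyConstant φ ∧ HasCompactSupport φ

namespace IsSB

variable {φ χ : ℚ_[p] → ℂ}

theorem integrable (h : IsSB φ) : Integrable φ (haarP p) :=
  h.1.continuous.integrable_of_hasCompactSupport h.2

theorem exists_period (h : IsSB φ) : ∃ δ > 0, ∀ x k : ℚ_[p], ‖k‖ < δ → φ (x + k) = φ x := by
  obtain ⟨δ, hδ, H⟩ := lebesgue_number_lemma_of_metric (c := fun y : ℂ => φ ⁻¹' {y}) h.2.isCompact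
    (fun y => h.1.isOpen_fiber y) (fun x _ => Set.mem_iUnion.2 ⟨φ x, rfl⟩)
  have H' : ∀ x ∈ tsupport φ, ∀ k, ‖k‖ < δ → φ (x + k) = φ x := by
    intro x hx k hk
    obtain ⟨y, hy⟩ := H x hx
    have h1 : φ (x + k) = y := hy (by simpa using hk)
    have h2 : φ x = y := hy (Metric.mem_ball_self hδ)
    rw [h1, h2]
  refine ⟨δ, hδ, fun x k hk => ?_⟩
  by_cases hx : x ∈ tsupport φ
  · exact H' x hx k hk
  by_cases hx' : x + k ∈ tsupport φ
  · have := H' (x + k) hx' (-k) (by rwa [norm_neg])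
    rw [add_neg_cancel_right] at this
    exact this.symm
  · rw [image_eq_zero_of_notMem_tsupport hx, image_eq_zero_of_notMem_tsupport hx']

theorem exists_radius (h : IsSB φ) : ∃ R > 0, ∀ x : ℚ_[p], R < ‖x‖ → φ x = 0 := by
  obtain ⟨R, hR, H⟩ := h.2.isCompact.isBounded.exists_pos_norm_le
  exact ⟨R, hR, fun x hx => image_eq_zero_of_notMem_tsupport fun hm => (H x hm).not_gt hx⟩

/-- Invariance under a ball and vanishing outside a ball characterize the Schwartz–Bruhat functions. -/
theorem of_bounds {δ R : ℝ} (hδ : 0 < δ) (h1 : ∀ x k : ℚ_[p], ‖k‖ < δ → φ (x + k) = φ x)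
    (h2 : ∀ x : ℚ_[p], R < ‖x‖ → φ x = 0) : IsSB φ := by
  constructor
  · rw [IsLocallyConstant.iff_eventually_eq]
    intro x
    filter_upwards [Metric.ball_mem_nhds x hδ] with y hy
    have := h1 x (y - x) (by rwa [← dist_eq_norm])
    rwa [add_sub_cancel] at this
  · refine HasCompactSupport.intro (isCompact_closedBall (0 : ℚ_[p]) R) fun x hx => h2 x ?_
    simpa using hx

theorem comp_mul (h : IsSB φ) {a : ℚ_[p]} (ha : a ≠ 0) : IsSB fun x => φ (a * x) :=
  ⟨h.1.comp_continuous (continuous_const_mul a),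
    h.2.comp_homeomorph (Homeomorph.mulLeft₀ a ha)⟩

end IsSB

theorem exists_padic_norm_lt {δ : ℝ} (hδ : 0 < δ) : ∃ a : ℚ_[p], a ≠ 0 ∧ ‖a‖ < δ := by
  obtain ⟨a, h0, h1⟩ := NormedField.exists_norm_lt ℚ_[p] hδ
  exact ⟨a, norm_pos_iff.1 h0, h1⟩

/-- The characteristic function of `ℤ_p`. -/
abbrev oneZp (p : ℕ) [Fact p.Prime] : ℚ_[p] → ℂ := {x : ℚ_[p] | ‖x‖ ≤ 1}.indicator 1

theorem oneZp_of_le {x : ℚ_[p]} (h : ‖x‖ ≤ 1) : oneZp p x = 1 :=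
  Set.indicator_of_mem (s := {x : ℚ_[p] | ‖x‖ ≤ 1}) h 1

theorem oneZp_of_not_le {x : ℚ_[p]} (h : ¬ ‖x‖ ≤ 1) : oneZp p x = 0 :=
  Set.indicator_of_notMem (s := {x : ℚ_[p] | ‖x‖ ≤ 1}) h 1

theorem oneZp_congr {x y : ℚ_[p]} (h : ‖x‖ ≤ 1 ↔ ‖y‖ ≤ 1) : oneZp p x = oneZp p y := by
  by_cases hy : ‖y‖ ≤ 1
  · rw [oneZp_of_le hy, oneZp_of_le (h.2 hy)]
  · rw [oneZp_of_not_le hy, oneZp_of_not_le (mt h.1 hy)]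

theorem measurableSet_Zp : MeasurableSet {x : ℚ_[p] | ‖x‖ ≤ 1} :=
  measurableSet_le measurable_norm measurable_const

theorem haarP_Zp : haarP p {x : ℚ_[p] | ‖x‖ ≤ 1} = 1 := by
  rw [← haarP_closedBall_one p]; congr 1; ext; simp

theorem integral_oneZp : ∫ x, oneZp p x ∂haarP p = 1 := by
  have h := integral_indicator_const (μ := haarP p) (1 : ℂ) (measurableSet_Zp (p := p))
  rw [measureReal_def, haarP_Zp] at h
  rw [ENNReal.toReal_one, one_smul] at h
  exact h

theorem isSB_oneZp : IsSB (oneZp p) := by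
  refine IsSB.of_bounds (δ := 1) (R := 1) one_pos (fun x k hk => ?_) fun x hx => ?_
  · have h : ‖x + k‖ ≤ 1 ↔ ‖x‖ ≤ 1 := by
      constructor
      · intro h
        have := (Padic.nonarchimedean (x + k) (-k)).trans (max_le h (by rw [norm_neg]; exact hk.le))
        rwa [add_neg_cancel_right] at this
      · intro h
        exact (Padic.nonarchimedean x k).trans (max_le h hk.le)
    exact oneZp_congr h
  · exact oneZp_of_not_le (not_le.2 hx)

variable {ψ : AddChar ℚ_[p] Circle}

/-- The Fourier transform of `ℚ_p` for the character `ψ`. -/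
abbrev locF (ψ : AddChar ℚ_[p] Circle) (φ : ℚ_[p] → ℂ) : ℚ_[p] → ℂ :=
  Fourier.fourierIntegral ψ (haarP p) φ

theorem locF_apply (φ : ℚ_[p] → ℂ) (w : ℚ_[p]) :
    locF ψ φ w = ∫ v, (ψ (-(v * w)) : ℂ) * φ v ∂haarP p := rfl

theorem locF_mul {a : ℚ_[p]} (ha : a ≠ 0) (φ : ℚ_[p] → ℂ) (w : ℚ_[p]) :
    locF ψ (fun x => φ (a * x)) w = ((‖a‖⁻¹ : ℝ) : ℂ) * locF ψ φ (a⁻¹ * w) := by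
  rw [locF_apply, locF_apply, ← integral_mul_haarP ha]
  congr 1
  ext v
  congr 4
  field_simp

namespace IsNormalizedChar

variable (hψ : IsNormalizedChar p ψ)
include hψ

/-- A normalized character is trivial on `ℤ_p`: the Fourier transform of `1_{ℤ_p}`, evaluated at `1`, is
not changed by the translations by `ℤ_p`. -/
theorem eq_one {a : ℚ_[p]} (ha : ‖a‖ ≤ 1) : ψ a = 1 := by
  have h1 : oneZp p ∘ (fun v => v + a) = oneZp p := by
    ext x
    have h : ‖x + a‖ ≤ 1 ↔ ‖x‖ ≤ 1 := by
      constructor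
      · intro h
        have := (Padic.nonarchimedean (x + a) (-a)).trans (max_le h (by rwa [norm_neg]))
        rwa [add_neg_cancel_right] at this
      · intro h
        exact (Padic.nonarchimedean x a).trans (max_le h ha)
    exact oneZp_congr h
  have h2 := Fourier.fourierIntegral_comp_add_right ψ (haarP p) (oneZp p) a
  rw [h1, hψ.fourier_one] at h2
  have h3 := congrFun h2 1
  simp only [Set.indicator, Set.mem_ofPred_eq, norm_one, le_refl, if_true, Pi.one_apply, mul_one] at h3
  rw [Circle.smul_def, smul_eq_mul, mul_one] at h3
  exact Circle.coe_injective (by rw [← h3, Circle.coe_one])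

/-- Conversely `ℤ_p` is its own annihilator: the Fourier transform of `1_{ℤ_p}` is `1` on the annihilator
of `ℤ_p`. -/
theorem norm_le_of_forall {y : ℚ_[p]} (h : ∀ z : ℚ_[p], ‖z‖ ≤ 1 → ψ (z * y) = 1) : ‖y‖ ≤ 1 := by
  by_contra hy
  have h1 := congrFun hψ.fourier_one y
  have h2 : locF ψ (oneZp p) y = ∫ x, oneZp p x ∂haarP p := by
    rw [locF_apply]
    congr 1
    ext v
    by_cases hv : ‖v‖ ≤ 1
    · rw [← neg_mul, h (-v) (by rwa [norm_neg])]; simp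
    · rw [oneZp_of_not_le hv, mul_zero]
  rw [integral_oneZp] at h2
  rw [show Fourier.fourierIntegral ψ (haarP p) ({x : ℚ_[p] | ‖x‖ ≤ 1}.indicator (1 : ℚ_[p] → ℂ)) y = 1
    from h2] at h1
  simp [Set.indicator, hy] at h1

variable {φ χ : ℚ_[p] → ℂ}

/-- The transform exchanges the periods and the support of `φ`: it is invariant under small translations
since `φ` has compact support, and it has compact support since `φ` is invariant under small
translations. -/
theorem isSB_locF (h : IsSB φ) : IsSB (locF ψ φ) := by
  obtain ⟨δ, hδ, hper⟩ := h.exists_period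
  obtain ⟨R, hR, hrad⟩ := h.exists_radius
  obtain ⟨a, ha, haδ⟩ := exists_padic_norm_lt (p := p) hδ
  refine IsSB.of_bounds (δ := R⁻¹) (R := ‖a‖⁻¹) (inv_pos.2 hR) (fun w k hk => ?_) fun w hw => ?_
  · rw [locF_apply, locF_apply]
    congr 1
    ext v
    by_cases hv : R < ‖v‖
    · rw [hrad v hv]; simp
    · have : ψ (-(v * k)) = 1 := by
        refine hψ.eq_one ?_
        rw [norm_neg, norm_mul]
        calc _ ≤ R * R⁻¹ := mul_le_mul (not_lt.1 hv) hk.le (norm_nonneg _) hR.le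
          _ = 1 := mul_inv_cancel₀ hR.ne'
      rw [mul_add, neg_add, AddChar.map_add_eq_mul, this, mul_one]
  · by_contra h0
    have h1 : ‖a * w‖ ≤ 1 := by
      refine hψ.norm_le_of_forall fun z hz => ?_
      have h2 := congrFun (Fourier.fourierIntegral_comp_add_right ψ (haarP p) φ (z * a)) w
      have h3 : φ ∘ (fun v => v + z * a) = φ := by
        ext v
        refine hper v _ ?_
        rw [norm_mul]
        exact (mul_le_of_le_one_left (norm_nonneg _) hz).trans_lt haδ
      rw [h3, Circle.smul_def, smul_eq_mul] at h2
      have h4 : (ψ (z * a * w) : ℂ) = 1 := mul_right_cancel₀ h0 (by rw [one_mul]; exact h2.symm)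
      rw [← mul_assoc]
      exact Circle.coe_injective (by rw [h4, Circle.coe_one])
    rw [norm_mul] at h1
    have h5 := norm_pos_iff.2 ha
    rw [inv_lt_iff_one_lt_mul₀' h5] at hw
    linarith

/-- Fourier inversion for Schwartz–Bruhat functions. The transform of `φ` is supported in a ball, the
characteristic function of which has an explicit transform. -/
theorem locF_locF (h : IsSB φ) (x : ℚ_[p]) : locF ψ (locF ψ φ) x = φ (-x) := by
  obtain ⟨δ, hδ, hper⟩ := h.exists_period
  obtain ⟨R, hR, hrad⟩ := (isSB_locF hψ h).exists_radius
  obtain ⟨b, hb, hbδ⟩ := exists_padic_norm_lt (p := p) (lt_min hδ (inv_pos.2 hR))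
  have hbpos := norm_pos_iff.2 hb
  have hbR : R < ‖b⁻¹‖ := by
    rw [norm_inv, lt_inv_comm₀ hR hbpos]; exact hbδ.trans_le (min_le_right _ _)
  set g : ℚ_[p] → ℂ := fun y => (ψ (-(y * x)) : ℂ) * oneZp p (b * y) with hg
  have hgi : Integrable g (haarP p) := by
    refine ((isSB_oneZp.comp_mul hb).integrable).bdd_mul (c := 1) ?_ ?_
    · exact (continuous_subtype_val.comp (hψ.continuous.comp
        (continuous_id.mul continuous_const).neg)).aestronglyMeasurable
    · exact Eventually.of_forall fun y => (Circle.norm_coe _).le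
  have h1 : locF ψ (locF ψ φ) x = ∫ y, locF ψ φ y • g y ∂haarP p := by
    rw [locF_apply]
    congr 1
    ext y
    by_cases hy : R < ‖y‖
    · rw [hrad y hy]; simp
    · have : oneZp p (b * y) = 1 := by
        refine oneZp_of_le ?_
        rw [norm_inv] at hbR
        have h6 := mul_le_mul_of_nonneg_left ((not_lt.1 hy).trans hbR.le) hbpos.le
        rwa [mul_inv_cancel₀ hbpos.ne', ← norm_mul] at h6
      rw [hg, smul_eq_mul]
      simp only [this]
      ring
  have h2 : ∀ v, locF ψ g v = ((‖b‖⁻¹ : ℝ) : ℂ) * oneZp p (b⁻¹ * (v + x)) := by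
    intro v
    have := locF_mul (ψ := ψ) hb (oneZp p) (v + x)
    rw [show locF ψ (oneZp p) = oneZp p from hψ.fourier_one] at this
    rw [← this, locF_apply, locF_apply]
    congr 1
    ext y
    rw [hg]
    simp only
    rw [← mul_assoc, ← Circle.coe_mul, ← AddChar.map_add_eq_mul]
    congr 4
    ring
  have h3 : ∫ y, locF ψ φ y • g y ∂haarP p = ∫ v, φ v • locF ψ g v ∂haarP p := by
    have h5 := VectorFourier.integral_fourierIntegral_smul_eq_flip (μ := haarP p) (ν := haarP p)
      (L := LinearMap.mul ℚ_[p] ℚ_[p]) hψ.continuous continuous_mul h.integrable hgi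
    rwa [show (LinearMap.mul ℚ_[p] ℚ_[p]).flip = LinearMap.mul ℚ_[p] ℚ_[p] from
      LinearMap.ext fun v => LinearMap.ext fun w => mul_comm _ _] at h5
  have h4 : ∀ v, φ v • locF ψ g v = φ (-x) * (((‖b‖⁻¹ : ℝ) : ℂ) * oneZp p (b⁻¹ * (v + x))) := by
    intro v
    rw [h2, smul_eq_mul]
    by_cases hv : ‖b⁻¹ * (v + x)‖ ≤ 1
    · congr 1
      have h5 : ‖v + x‖ < δ := by
        rw [norm_mul, norm_inv, inv_mul_le_iff₀ hbpos, mul_one] at hv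
        exact hv.trans_lt (hbδ.trans_le (min_le_left _ _))
      have := hper (-x) (v + x) h5
      rw [← this]
      congr 1
      ring
    · rw [oneZp_of_not_le hv, mul_zero, mul_zero, mul_zero]
  rw [h1, h3]
  simp only [h4]
  rw [integral_const_mul, integral_const_mul,
    integral_add_right_eq_self (fun v => oneZp p (b⁻¹ * v)) x, integral_mul_haarP (inv_ne_zero hb),
    integral_oneZp, norm_inv, inv_inv, mul_one, ← Complex.ofReal_mul, inv_mul_cancel₀ hbpos.ne']
  simp

open ComplexConjugate in
/-- Plancherel formula for Schwartz–Bruhat functions. -/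
theorem plancherel (h : IsSB φ) (h' : IsSB χ) :
    ∫ y, conj (locF ψ φ y) * locF ψ χ y ∂haarP p = ∫ x, conj (φ x) * χ x ∂haarP p := by
  have h1 := VectorFourier.integral_sesq_fourierIntegral_eq_neg_flip (μ := haarP p) (ν := haarP p)
    (L := LinearMap.mul ℚ_[p] ℚ_[p]) (f := φ) (g := locF ψ χ) (innerSL ℂ (E := ℂ)) hψ.continuous
    continuous_mul h.integrable (isSB_locF hψ h').integrable
  simp only [innerSL_apply_apply, RCLike.inner_apply] at h1
  have h2 : ∀ x, VectorFourier.fourierIntegral ψ (haarP p) (-(LinearMap.mul ℚ_[p] ℚ_[p]).flip)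
      (locF ψ χ) x = χ x := by
    intro x
    have h3 := locF_locF hψ h' (-x)
    rw [neg_neg] at h3
    rw [← h3]
    change ∫ v, (ψ (-((-(LinearMap.mul ℚ_[p] ℚ_[p]).flip) v x)) : ℂ) * locF ψ χ v ∂haarP p =
      ∫ v, (ψ (-(v * (-x))) : ℂ) * locF ψ χ v ∂haarP p
    congr 1
    ext v
    simp [mul_comm]
  simp only [h2] at h1
  simp only [mul_comm (conj _)]
  exact h1

end IsNormalizedChar
end LocalFourier

/-! ### Classes in `L²(X_S)` of functions on the adeles -/

section Classes

variable (S : Finset Nat.Primes)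

theorem proj_smul (g : Gam S) (x : Adele S) : proj S (g • x) = proj S x := Quotient.sound ⟨g, rfl⟩

/-- The function on `X_S` induced by the sum of a function over the orbits of `Γ`. -/
def sumX {M : Type*} [AddCommMonoid M] [TopologicalSpace M] [T2Space M] (h : Adele S → M) : X S → M :=
  Quotient.lift (fun x => ∑' g : Gam S, h (g • x)) (by
    rintro x y ⟨g, rfl⟩
    change ∑' k : Gam S, h (k • g • y) = ∑' k : Gam S, h (k • y)
    simp only [← mul_smul]
    exact (Equiv.mulRight g).tsum_eq fun k : Gam S => h (k • y))

theorem sumX_proj {M : Type*} [AddCommMonoid M] [TopologicalSpace M] [T2Space M] (h : Adele S → M)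
    (x : Adele S) : sumX S h (proj S x) = ∑' g : Gam S, h (g • x) := rfl

variable {S} {h h₁ h₂ : Adele S → ℂ}

theorem measurable_sumX (hm : Measurable h) : Measurable (sumX S h) := by
  refine measurable_from_quotient.2 ?_
  exact Measurable.tsum fun g : Gam S => hm.comp (measurable_const_smul g)

theorem measurable_sumX_enorm (hm : Measurable h) : Measurable (sumX S fun x => ‖h x‖ₑ) := by
  refine measurable_from_quotient.2 ?_
  exact Measurable.tsum fun g : Gam S => hm.enorm.comp (measurable_const_smul g)

/-- The sum of `h` over the orbits of `Γ` converges absolutely in `L²`. -/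
structure HasClass (h : Adele S → ℂ) : Prop where
  measurable : Measurable h
  lintegral_lt_top : ∫⁻ x in fundDomain S, (∑' g : Gam S, ‖h (g • x)‖ₑ) ^ 2 ∂haarA S < ∞

namespace HasClass

theorem lintegral_muX_lt_top (hh : HasClass h) :
    ∫⁻ x, sumX S (fun x => ‖h x‖ₑ) x ^ 2 ∂muX S < ∞ := by
  rw [lintegral_muX S ((measurable_sumX_enorm hh.measurable).pow_const 2)]
  exact ENNReal.mul_lt_top (ENNReal.inv_lt_top.2 (vol_ne_zero S).bot_lt) hh.lintegral_lt_top

theorem ae_ne_top (hh : HasClass h) : ∀ᵐ x ∂haarA S, ∑' g : Gam S, ‖h (g • x)‖ₑ ≠ ∞ := by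
  have h1 : ∀ᵐ x ∂muX S, sumX S (fun x => ‖h x‖ₑ) x ≠ ∞ := by
    filter_upwards [ae_lt_top ((measurable_sumX_enorm hh.measurable).pow_const 2)
      hh.lintegral_muX_lt_top.ne] with x hx h0
    simp [h0] at hx
  exact ae_proj S h1

theorem ae_summable (hh : HasClass h) : ∀ᵐ x ∂haarA S, Summable fun g : Gam S => h (g • x) := by
  filter_upwards [hh.ae_ne_top] with x hx
  exact Summable.of_enorm hx

theorem memLp (hh : HasClass h) : MemLp (sumX S h) 2 (muX S) := by
  rw [memLp_two_iff (measurable_sumX hh.measurable).aestronglyMeasurable]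
  refine (lintegral_mono fun x => ?_).trans_lt hh.lintegral_muX_lt_top
  induction x using Quotient.inductionOn with
  | h x =>
    change ‖∑' g : Gam S, h (g • x)‖ₑ ^ 2 ≤ (∑' g : Gam S, ‖h (g • x)‖ₑ) ^ 2
    gcongr
    exact enorm_tsum_le_tsum_enorm

/-- The class in `L²(X_S)` of a function on the adeles. -/
def cls (hh : HasClass h) : L2X S := hh.memLp.toLp _

theorem coeFn_cls (hh : HasClass h) :
    ∀ᵐ x ∂haarA S, hh.cls (proj S x) = ∑' g : Gam S, h (g • x) :=
  ae_proj S hh.memLp.coeFn_toLp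

theorem isClassOf_cls (hh : HasClass h) : IsClassOf S h hh.cls := by
  filter_upwards [hh.coeFn_cls, hh.ae_summable] with x h1 h2
  rw [h1]
  exact h2.hasSum

end HasClass

theorem ext_of_ae_proj {ξ ζ : L2X S} (h : ∀ᵐ x ∂haarA S, ξ (proj S x) = ζ (proj S x)) : ξ = ζ := by
  rw [Lp.ext_iff]
  exact ae_of_ae_proj S (measurableSet_eq_fun (Lp.stronglyMeasurable ξ).measurable
    (Lp.stronglyMeasurable ζ).measurable) (ae_restrict_of_ae h)

theorem IsClassOf.unique {ξ ζ : L2X S} (h1 : IsClassOf S h ξ) (h2 : IsClassOf S h ζ) :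
    ξ = ζ := by
  refine ext_of_ae_proj ?_
  filter_upwards [h1, h2] with x h1 h2 using h1.unique h2

/-- Unfolding of an integral over the adeles. -/
theorem lintegral_unfold {N : X S → ℝ≥0∞} (hN : Measurable N) {f : Adele S → ℝ≥0∞} (hf : Measurable f) :
    ∫⁻ x, N (proj S x) * f x ∂haarA S
      = ∫⁻ x in fundDomain S, N (proj S x) * ∑' g : Gam S, f (g • x) ∂haarA S := by
  rw [(isFundamentalDomain S).lintegral_eq_tsum'' (fun x => N (proj S x) * f x), ← lintegral_tsum]
  · refine lintegral_congr fun x => ?_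
    simp only [proj_smul]
    rw [ENNReal.tsum_mul_left]
  · intro g
    exact (((hN.comp (measurable_proj S)).mul hf).comp (measurable_const_smul g)).aemeasurable

theorem integral_unfold {w : X S → ℂ} (hw : Measurable w) (hm : Measurable h)
    (hi : Integrable (fun x => w (proj S x) * h x) (haarA S)) :
    ∫ x, w (proj S x) * h x ∂haarA S
      = ∫ x in fundDomain S, w (proj S x) * ∑' g : Gam S, h (g • x) ∂haarA S := by
  have hm' : Measurable fun x => w (proj S x) * h x := (hw.comp (measurable_proj S)).mul hm
  rw [(isFundamentalDomain S).integral_eq_tsum'' _ hi, ← integral_tsum]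
  · congr 1
    ext x
    simp only [proj_smul]
    rw [tsum_mul_left]
  · intro g
    exact (hm'.comp (measurable_const_smul g)).aestronglyMeasurable
  · have h1 := (isFundamentalDomain S).lintegral_eq_tsum'' (fun x => ‖w (proj S x) * h x‖ₑ)
    rw [← h1]
    exact hi.2.ne

theorem ennreal_mul_le (a b : ℝ≥0∞) : a * b ≤ a ^ 2 + b ^ 2 := by
  rcases le_total a b with h | h
  · exact (mul_le_mul_left h b).trans (by rw [← sq]; exact le_add_self)
  · exact (mul_le_mul_right h a).trans (by rw [← sq]; exact le_self_add)

theorem lintegral_mul_lt_top {N : X S → ℝ≥0∞} (hN : Measurable N)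
    (hN2 : ∫⁻ x, N x ^ 2 ∂muX S < ∞) (hh : HasClass h) :
    ∫⁻ x, N (proj S x) * ‖h x‖ₑ ∂haarA S < ∞ := by
  rw [lintegral_unfold hN hh.measurable.enorm]
  rw [lintegral_muX S (hN.pow_const 2)] at hN2
  have h1 : ∫⁻ x in fundDomain S, N (proj S x) ^ 2 ∂haarA S < ∞ :=
    ENNReal.lt_top_of_mul_ne_top_right hN2.ne (ENNReal.inv_ne_zero.2 (vol_ne_top S))
  refine (lintegral_mono fun x => ennreal_mul_le _ _).trans_lt ?_
  have hN' : Measurable fun x => N (proj S x) ^ 2 := (hN.comp (measurable_proj S)).pow_const 2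
  rw [lintegral_add_left hN']
  exact ENNReal.add_lt_top.2 ⟨h1, hh.lintegral_lt_top⟩

open ComplexConjugate

/-- Functions on `X_S` in `L²` pair with functions having a class. -/
theorem integrable_conj_mul (ξ : L2X S) (hh : HasClass h) :
    Integrable (fun x => conj (ξ (proj S x)) * h x) (haarA S) := by
  have hm := (Lp.stronglyMeasurable ξ).measurable
  refine ⟨?_, ?_⟩
  · exact ((Complex.continuous_conj.measurable.comp (hm.comp (measurable_proj S))).mul
      hh.measurable).aestronglyMeasurable
  · rw [hasFiniteIntegral_iff_enorm]
    have h1 := lintegral_mul_lt_top hm.enorm (by rw [← Lp_norm_sq]; exact ENNReal.ofReal_lt_top) hh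
    refine (lintegral_congr fun x => ?_).trans_lt h1
    rw [enorm_mul, RCLike.enorm_conj]

/-- The scalar product with a class is an integral over the adeles. -/
theorem inner_cls (ξ : L2X S) (hh : HasClass h) :
    inner ℂ ξ hh.cls = (((vol S)⁻¹).toReal : ℂ) * ∫ x, conj (ξ (proj S x)) * h x ∂haarA S := by
  have hm := (Lp.stronglyMeasurable ξ).measurable
  have hm' : Measurable fun x => conj (ξ x) := Complex.continuous_conj.measurable.comp hm
  rw [integral_unfold (w := fun x => conj (ξ x)) hm' hh.measurable (integrable_conj_mul ξ hh),
    L2.inner_def]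
  have h1 : ∫ x, inner ℂ (ξ x) (hh.cls x) ∂muX S = ∫ x, conj (ξ x) * sumX S h x ∂muX S := by
    refine integral_congr_ae ?_
    filter_upwards [hh.memLp.coeFn_toLp] with x hx
    rw [HasClass.cls, hx, RCLike.inner_apply, mul_comm]
  have h2 : Measurable fun x => conj (ξ x) * sumX S h x := hm'.mul (measurable_sumX hh.measurable)
  rw [h1, integral_muX S h2]
  rfl

/-- The Gram matrix of the classes. -/
theorem inner_cls_cls (hh₁ : HasClass h₁) (hh₂ : HasClass h₂) :
    inner ℂ hh₁.cls hh₂.cls = (((vol S)⁻¹).toReal : ℂ) *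
      ∑' g : Gam S, ∫ x, conj (h₁ (g • x)) * h₂ x ∂haarA S := by
  rw [inner_cls, ← integral_tsum]
  · congr 1
    refine integral_congr_ae ?_
    filter_upwards [hh₁.coeFn_cls] with x hx
    rw [hx, Complex.conj_tsum, tsum_mul_right]
  · intro g
    exact ((Complex.continuous_conj.measurable.comp (hh₁.measurable.comp
      (measurable_const_smul g))).mul hh₂.measurable).aestronglyMeasurable
  · have h1 := lintegral_mul_lt_top (measurable_sumX_enorm hh₁.measurable)
      hh₁.lintegral_muX_lt_top hh₂
    refine ne_of_lt (lt_of_eq_of_lt ?_ h1)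
    rw [← lintegral_tsum]
    · refine lintegral_congr fun x => ?_
      rw [sumX_proj, ← ENNReal.tsum_mul_right]
      refine tsum_congr fun g => ?_
      rw [enorm_mul, RCLike.enorm_conj]
    · intro g
      exact ((Complex.continuous_conj.measurable.comp (hh₁.measurable.comp
        (measurable_const_smul g))).mul hh₂.measurable).enorm.aemeasurable

end Classes

/-! ### Pure tensors of Schwartz–Bruhat functions -/

section SchwartzBruhat

variable {S : Finset Nat.Primes}

/-- The element `-1` of `Γ`. -/
def negGam (S : Finset Nat.Primes) : Gam S := ⟨-1, fun p _ => by simp⟩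

theorem negGam_smul (x : Adele S) : negGam S • x = -x := by
  refine Prod.ext ?_ (funext fun p => ?_)
  · rw [Gam_smul_fst]; simp [negGam]
  · rw [Gam_smul_snd]; simp [negGam]

/-- `Γ` is the product of `Γ_+` and the signs. -/
def signEquiv (S : Finset Nat.Primes) : {g : Gam S // 0 < ((g : ℚˣ) : ℚ)} × Bool ≃ Gam S where
  toFun q := if q.2 then q.1 else negGam S * q.1
  invFun g := if h : 0 < ((g : ℚˣ) : ℚ) then (⟨g, h⟩, true) else
    (⟨negGam S * g, by
      have h1 : ((g : ℚˣ) : ℚ) ≠ 0 := (g : ℚˣ).ne_zero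
      have h2 : ((g : ℚˣ) : ℚ) < 0 := lt_of_le_of_ne (not_lt.1 h) h1
      simp [negGam, h2]⟩, false)
  left_inv := by
    rintro ⟨⟨g, hg⟩, b⟩
    cases b
    · have h1 : ¬ 0 < (((negGam S * g : Gam S) : ℚˣ) : ℚ) := by
        simp only [negGam, Subgroup.coe_mul, Units.val_neg, neg_mul, one_mul, not_lt, Left.neg_nonpos_iff]
        exact hg.le
      simp only [Bool.false_eq_true, if_false, h1, dif_neg, not_false_eq_true]
      refine Prod.ext (Subtype.ext ?_) rfl
      refine Subtype.ext (Units.ext ?_)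
      simp [negGam]
    · simp [hg]
  right_inv := by
    intro g
    by_cases h : 0 < ((g : ℚˣ) : ℚ)
    · simp [h]
    · simp only [h, dif_neg, not_false_eq_true, Bool.false_eq_true, if_false]
      refine Subtype.ext (Units.ext ?_)
      simp [negGam]

theorem signEquiv_smul (g : {g : Gam S // 0 < ((g : ℚˣ) : ℚ)}) (x : Adele S) :
    signEquiv S (g, true) • x = (g : Gam S) • x ∧ signEquiv S (g, false) • x = -((g : Gam S) • x) := by
  refine ⟨rfl, ?_⟩
  change (negGam S * (g : Gam S)) • x = _
  rw [mul_smul, negGam_smul]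

theorem tsum_enorm_eq {ι : Type*} {f : ι → ℂ} {c : ℂ} (hf : HasSum f c)
    (h0 : ∀ i, f i = ((‖f i‖ : ℝ) : ℂ)) : ∑' i, ‖f i‖ₑ = ‖c‖ₑ := by
  have hs : Summable fun i => ‖f i‖ := hf.summable.norm
  have h1 : ((∑' i, ‖f i‖ : ℝ) : ℂ) = c := by
    rw [Complex.ofReal_tsum, ← hf.tsum_eq]
    exact tsum_congr fun i => (h0 i).symm
  have h2 : 0 ≤ ∑' i, ‖f i‖ := tsum_nonneg fun i => norm_nonneg _
  rw [← h1, ← ofReal_norm, Complex.norm_real, Real.norm_of_nonneg h2,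
    ENNReal.ofReal_tsum_of_nonneg (fun i => norm_nonneg _) hs]
  exact tsum_congr fun i => (ofReal_norm _).symm

/-- The element of `L²(ℝ)^{ev}` given by an even square integrable function. -/
def mkEven {f : ℝ → ℂ} (hf : MemLp f 2) (he : ∀ x, f (-x) = f x) : L2even :=
  ⟨hf.toLp _, by
    rw [L2even, LinearMap.mem_eqLocus, LinearMap.id_apply]
    refine (Lp.toLp_compMeasurePreserving hf (Measure.measurePreserving_neg volume)).trans ?_
    rw [MemLp.toLp_eq_toLp_iff]
    exact Eventually.of_forall fun x => he x⟩

theorem oneTensor_neg {f : ℝ → ℂ} (he : ∀ x, f (-x) = f x) (x : Adele S) :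
    oneTensor S f (-x) = oneTensor S f x := by
  rw [oneTensor, oneTensor, Prod.fst_neg, he]
  congr 1
  simp only [Set.indicator, Set.mem_ofPred_eq, Prod.snd_neg, Pi.neg_apply, norm_neg, Pi.one_apply]

/-- The sum over the orbits of `Γ` of `1_{R_S} ⊗ f` is square integrable, for `f` nonnegative and even. -/
theorem hasClass_oneTensor {f : ℝ → ℂ} (hm : Measurable f) (hf : MemLp f 2)
    (he : ∀ x, f (-x) = f x) (h0 : ∀ x, f x = ((‖f x‖ : ℝ) : ℂ)) : HasClass (oneTensor S f) := by
  have hmeas : Measurable (oneTensor S f) := by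
    refine Measurable.mul ?_ (hm.comp measurable_fst)
    refine (measurable_one.indicator ?_).comp measurable_snd
    have : {y : (p : S) → ℚ_[(p : Nat.Primes)] | ∀ p, ‖y p‖ ≤ 1} = ⋂ p, {y | ‖y p‖ ≤ 1} := by
      ext y; simp
    rw [this]
    exact MeasurableSet.iInter fun p => measurableSet_le (measurable_pi_apply p).norm measurable_const
  refine ⟨hmeas, ?_⟩
  have h1 := isEta_etaS S (mkEven hf he)
  have h2 : ∀ᵐ x ∂haarA S, ∑' g : Gam S, ‖oneTensor S f (g • x)‖ₑ
      = 2 * ‖(etaS S (mkEven hf he) : L2X S) (proj S x)‖ₑ := by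
    filter_upwards [h1, ae_gam_smul_fst (S := S) hf.coeFn_toLp] with x h1 h2
    have h3 : ∀ g : Gam S, oneTensor S ((mkEven hf he : L2even) : Lp ℂ 2 (volume : Measure ℝ)) (g • x)
        = oneTensor S f (g • x) := fun g => by
      rw [oneTensor, oneTensor]; congr 1; exact h2 g
    simp only [h3] at h1
    rw [← (signEquiv S).tsum_eq,
      ENNReal.tsum_prod (f := fun g b => ‖oneTensor S f (signEquiv S (g, b) • x)‖ₑ),
      ← tsum_enorm_eq h1, ← ENNReal.tsum_mul_left]
    · refine tsum_congr fun g => ?_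
      rw [tsum_bool, (signEquiv_smul g x).1, (signEquiv_smul g x).2, oneTensor_neg he, two_mul]
    · intro g
      rw [oneTensor, h0]
      simp only [Set.indicator]
      split_ifs <;> simp
  rw [lintegral_congr_ae (ae_restrict_of_ae (h2.mono fun x hx => by rw [hx]))]
  have h3 : ∫⁻ x, (2 * ‖(etaS S (mkEven hf he) : L2X S) x‖ₑ) ^ 2 ∂muX S < ∞ := by
    simp only [mul_pow]
    rw [lintegral_const_mul' _ _ (by simp), ← Lp_norm_sq]
    exact ENNReal.mul_lt_top (by simp) ENNReal.ofReal_lt_top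
  rw [lintegral_muX S ((((Lp.stronglyMeasurable _).measurable.enorm).const_mul 2).pow_const 2)] at h3
  exact ENNReal.lt_top_of_mul_ne_top_right h3.ne (ENNReal.inv_ne_zero.2 (vol_ne_top S))

/-- Domination up to a translation by an element of `Γ`. -/
theorem HasClass.of_le {h k : Adele S → ℂ} (hk : HasClass k) (hm : Measurable h) {C : ℝ≥0∞} (hC : C ≠ ∞)
    (g₀ : Gam S) (hle : ∀ x, ‖h x‖ₑ ≤ C * ‖k (g₀ • x)‖ₑ) : HasClass h := by
  refine ⟨hm, ?_⟩
  refine (lintegral_mono (g := fun x => C ^ 2 * (∑' g : Gam S, ‖k (g • x)‖ₑ) ^ 2) fun x => ?_).trans_lt ?_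
  · change _ ≤ C ^ 2 * (∑' g : Gam S, ‖k (g • x)‖ₑ) ^ 2
    rw [← mul_pow]
    refine pow_le_pow_left' ?_ 2
    calc ∑' g : Gam S, ‖h (g • x)‖ₑ ≤ ∑' g : Gam S, C * ‖k (g₀ • g • x)‖ₑ :=
          ENNReal.tsum_le_tsum fun g => hle _
      _ = C * ∑' g : Gam S, ‖k ((g₀ * g) • x)‖ₑ := by
          rw [ENNReal.tsum_mul_left]; simp only [mul_smul]
      _ = C * ∑' g : Gam S, ‖k (g • x)‖ₑ := by
          exact congrArg (C * ·) ((Equiv.mulLeft g₀).tsum_eq fun g : Gam S => ‖k (g • x)‖ₑ)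
  · rw [lintegral_const_mul' _ _ (by simp [hC])]
    exact ENNReal.mul_lt_top (ENNReal.pow_lt_top hC.lt_top) hk.lintegral_lt_top

/-- The dilation of a Schwartz function. -/
def dilSchwartz {a : ℝ} (ha : a ≠ 0) (f : SchwartzMap ℝ ℂ) : SchwartzMap ℝ ℂ :=
  SchwartzMap.compCLMOfContinuousLinearEquiv ℂ (ContinuousLinearEquiv.smulLeft (Units.mk0 a ha)) f

theorem dilSchwartz_apply {a : ℝ} (ha : a ≠ 0) (f : SchwartzMap ℝ ℂ) (x : ℝ) :
    dilSchwartz ha f x = f (a * x) := rfl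

theorem fourier_dilSchwartz {a : ℝ} (ha : a ≠ 0) (f : SchwartzMap ℝ ℂ) (w : ℝ) :
    (𝓕 (dilSchwartz ha f) : SchwartzMap ℝ ℂ) w
      = ((|a|⁻¹ : ℝ) : ℂ) * (𝓕 f : SchwartzMap ℝ ℂ) (a⁻¹ * w) := by
  rw [SchwartzMap.fourier_coe, SchwartzMap.fourier_coe, Real.fourier_real_eq_integral_exp_smul,
    Real.fourier_real_eq_integral_exp_smul]
  have h1 := Measure.integral_comp_mul_left
    (fun v : ℝ => Complex.exp ((-2 * Real.pi * v * (a⁻¹ * w) : ℝ) * Complex.I) • f v) a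
  rw [abs_inv, Complex.real_smul] at h1
  rw [← h1]
  congr 1
  ext v
  rw [dilSchwartz_apply]
  congr 4
  field_simp

variable (S) in
/-- The data of a pure tensor of Schwartz–Bruhat functions. -/
structure SBData where
  /-- the archimedean component -/
  inf : SchwartzMap ℝ ℂ
  /-- the finite components -/
  fin : (p : S) → ℚ_[(p : Nat.Primes)] → ℂ
  isSB : ∀ p, IsSB (fin p)

namespace SBData

/-- The pure tensor as a function on the adeles. -/
def fn (D : SBData S) : Adele S → ℂ := tensor S D.inf D.fin

theorem fn_apply (D : SBData S) (x : Adele S) : D.fn x = D.inf x.1 * ∏ p : S, D.fin p (x.2 p) := rfl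

theorem measurable_fn (D : SBData S) : Measurable D.fn := by
  refine Measurable.mul (D.inf.continuous.measurable.comp measurable_fst) ?_
  refine Finset.measurable_fun_prod _ fun p _ => ?_
  exact (D.isSB p).1.continuous.measurable.comp ((measurable_pi_apply p).comp measurable_snd)

theorem exists_bound {p : ℕ} [Fact p.Prime] {φ : ℚ_[p] → ℂ} (h : IsSB φ) : ∃ (C : ℝ) (n : ℕ), 0 ≤ C ∧
    ∀ x, ‖φ x‖ ≤ C ∧ (φ x ≠ 0 → ‖x‖ ≤ (p : ℝ) ^ n) := by
  obtain ⟨C, hC⟩ := h.2.exists_bound_of_continuous h.1.continuous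
  obtain ⟨R, hR, H⟩ := h.exists_radius
  have hp : (1 : ℝ) < p := by exact_mod_cast (Fact.out : p.Prime).one_lt
  obtain ⟨n, hn⟩ := pow_unbounded_of_one_lt R hp
  refine ⟨C, n, (norm_nonneg _).trans (hC 0), fun x => ⟨hC x, fun hx => ?_⟩⟩
  by_contra hcon
  exact hx (H x (hn.trans (not_le.1 hcon)))

/-- A Schwartz–Bruhat function is dominated by a translate under `Γ` of `1_{R_S} ⊗ f`. -/
theorem hasClass (D : SBData S) : HasClass D.fn := by
  choose C n hC hb using fun p : S => exists_bound (D.isSB p)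
  -- the element `∏ p ^ n_p` moves the supports of the components into `ℤ_p`
  let g₀ : Gam S := ⟨primeProd S fun p => (n p : ℤ), primeProd_mem S _⟩
  have ha : (((g₀ : ℚˣ) : ℚ) : ℝ) ≠ 0 := by exact_mod_cast (g₀ : ℚˣ).ne_zero
  set φ := dilSchwartz (inv_ne_zero ha) D.inf with hφ
  set f : ℝ → ℂ := fun t => ((‖φ t‖ + ‖φ (-t)‖ : ℝ) : ℂ) with hf
  have hf2 : MemLp f 2 := by
    have h1 : MemLp φ 2 := φ.memLp 2 volume
    have h2 := h1.norm.add (h1.norm.comp_measurePreserving (Measure.measurePreserving_neg volume))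
    exact h2.ofReal
  have hfm : Measurable f := by
    have := φ.continuous.measurable
    fun_prop
  have hfe : ∀ t, f (-t) = f t := fun t => by rw [hf]; simp only [neg_neg]; rw [add_comm]
  have hf0 : ∀ t, f t = ((‖f t‖ : ℝ) : ℂ) := fun t => by
    rw [hf]; simp only
    rw [Complex.norm_real, Real.norm_of_nonneg (by positivity)]
  refine (hasClass_oneTensor hfm hf2 hfe hf0).of_le D.measurable_fn
    (C := ENNReal.ofReal (∏ p, C p)) ENNReal.ofReal_ne_top g₀ fun x => ?_
  by_cases hx : D.fn x = 0
  · simp [hx]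
  have hx' : ∀ p, D.fin p (x.2 p) ≠ 0 := fun p hp0 => hx (by
    rw [fn_apply, Finset.prod_eq_zero (Finset.mem_univ p) hp0, mul_zero])
  have hmem : (g₀ • x).2 ∈ {y : (p : S) → ℚ_[(p : Nat.Primes)] | ∀ p, ‖y p‖ ≤ 1} := fun p => by
    have hpr : (0 : ℝ) < ((p : Nat.Primes) : ℕ) := by exact_mod_cast p.1.2.pos
    rw [Gam_smul_snd, norm_mul]
    change ‖((primeProd S (fun p => (n p : ℤ)) : ℚ) : ℚ_[(p : Nat.Primes)])‖ * _ ≤ 1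
    rw [norm_primeProd_mem, zpow_neg, zpow_natCast, inv_mul_le_iff₀ (pow_pos hpr _), mul_one]
    exact (hb p _).2 (hx' p)
  rw [oneTensor, Set.indicator_of_mem hmem, Pi.one_apply, one_mul, ← ofReal_norm, ← ofReal_norm,
    ← ENNReal.ofReal_mul (Finset.prod_nonneg fun p _ => hC p), fn_apply, norm_mul, norm_prod, mul_comm]
  refine ENNReal.ofReal_le_ofReal ?_
  have h1 : ‖D.inf x.1‖ ≤ ‖f (g₀ • x).1‖ := by
    rw [hf]; simp only
    rw [Complex.norm_real, Real.norm_of_nonneg (by positivity), hφ, dilSchwartz_apply, Gam_smul_fst,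
      inv_mul_cancel_left₀ ha]
    exact le_add_of_nonneg_right (norm_nonneg _)
  exact mul_le_mul (Finset.prod_le_prod (fun _ _ => norm_nonneg _) fun p _ => (hb p _).1) h1
    (norm_nonneg _) (Finset.prod_nonneg fun p _ => hC p)

/-- The class in `L²(X_S)` of a pure tensor. -/
def toL2 (D : SBData S) : L2X S := D.hasClass.cls

theorem isClassOf_toL2 (D : SBData S) : IsClassOf S D.fn D.toL2 := D.hasClass.isClassOf_cls

end SBData
end SchwartzBruhat

/-! ### Gram matrix and density of the classes of the pure tensors -/

open scoped ContDiff

section Hat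

variable {S : Finset Nat.Primes}

open ComplexConjugate

theorem integral_tensor (f : ℝ → ℂ) (g : (p : S) → ℚ_[(p : Nat.Primes)] → ℂ) :
    ∫ x, tensor S f g x ∂haarA S = (∫ t, f t) * ∏ p : S, ∫ y, g p y ∂haarP (p : Nat.Primes) := by
  rw [← integral_fintype_prod_eq_prod (fun (p : S) (y : ℚ_[(p : Nat.Primes)]) => g p y)]
  exact integral_prod_mul (μ := (volume : Measure ℝ)) (ν := haarFin S) f
    fun y : (p : S) → ℚ_[(p : Nat.Primes)] => ∏ p : S, g p (y p)

theorem inv_idele_fst (a : (Adele S)ˣ) : ((a⁻¹ : (Adele S)ˣ) : Adele S).1 = (a : Adele S).1⁻¹ := by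
  refine eq_inv_of_mul_eq_one_left ?_
  have := congrArg Prod.fst a.inv_mul
  rwa [Prod.fst_mul, Prod.fst_one] at this

theorem inv_idele_snd (a : (Adele S)ˣ) (p : S) :
    ((a⁻¹ : (Adele S)ˣ) : Adele S).2 p = ((a : Adele S).2 p)⁻¹ := by
  refine eq_inv_of_mul_eq_one_left ?_
  have := congrFun (congrArg Prod.snd a.inv_mul) p
  rwa [Prod.snd_mul, Prod.snd_one, Pi.mul_apply, Pi.one_apply] at this

namespace SBData

/-- The pure tensor `x ↦ D(a x)`, for an idele `a`. -/
def mul (D : SBData S) (a : (Adele S)ˣ) : SBData S where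
  inf := dilSchwartz (idele_fst_ne S a) D.inf
  fin p x := D.fin p ((a : Adele S).2 p * x)
  isSB p := (D.isSB p).comp_mul (idele_snd_ne S a p)

theorem mul_fn (D : SBData S) (a : (Adele S)ˣ) (x : Adele S) : (D.mul a).fn x = D.fn (a * x) := rfl

theorem toL2_eq {D : SBData S} {ξ : L2X S} (h : IsClassOf S D.fn ξ) : D.toL2 = ξ :=
  D.isClassOf_toL2.unique h

/-- An idele class acts on the classes of pure tensors by scaling the tensor. -/
theorem theta_toL2 (D : SBData S) (a : (Adele S)ˣ) :
    theta S (QuotientGroup.mk a) D.toL2 = ((modA S a ^ (1 / 2 : ℝ) : ℝ) : ℂ) • (D.mul a).toL2 := by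
  refine ext_of_ae_proj ?_
  have hq : Measure.QuasiMeasurePreserving (mulIdele S a) (haarA S) (haarA S) :=
    ⟨(mulIdele S a).toHomeomorph.measurable, by
      rw [map_mulIdele]; exact Measure.smul_absolutelyContinuous⟩
  filter_upwards [ae_proj S (theta_apply S (QuotientGroup.mk a) D.toL2),
    ae_proj S (Lp.coeFn_smul ((modA S a ^ (1 / 2 : ℝ) : ℝ) : ℂ) (D.mul a).toL2),
    hq.ae D.hasClass.coeFn_cls, (D.mul a).hasClass.coeFn_cls] with x h1 h2 h3 h4
  rw [h1, h2, Pi.smul_apply, smul_eq_mul, act_mk, modC_mk]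
  congr 1
  refine h3.trans (Eq.trans (tsum_congr fun g => ?_) h4.symm)
  rw [mul_fn, mulIdele_apply, mul_smul_comm]

variable {ψ : (p : S) → AddChar ℚ_[(p : Nat.Primes)] Circle}

/-- The Fourier transform of a pure tensor. -/
def hat (hψ : ∀ p : S, IsNormalizedChar (p : Nat.Primes) (ψ p)) (D : SBData S) : SBData S where
  inf := 𝓕 D.inf
  fin p := locF (ψ p) (D.fin p)
  isSB p := (hψ p).isSB_locF (D.isSB p)

variable (hψ : ∀ p : S, IsNormalizedChar (p : Nat.Primes) (ψ p))

/-- The Fourier transform of `D(a x)` is `|a|⁻¹` times the transform of `D` at `a⁻¹ x`. -/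
theorem hat_mul_fn (D : SBData S) (a : (Adele S)ˣ) (x : Adele S) :
    ((D.mul a).hat hψ).fn x = (((modA S a)⁻¹ : ℝ) : ℂ) * (D.hat hψ).fn ((a⁻¹ : (Adele S)ˣ) * x) := by
  have h1 : ∀ p : S, locF (ψ p) (fun y => D.fin p ((a : Adele S).2 p * y)) (x.2 p)
      = ((‖(a : Adele S).2 p‖⁻¹ : ℝ) : ℂ) * locF (ψ p) (D.fin p) (((a : Adele S).2 p)⁻¹ * x.2 p) :=
    fun p => locF_mul (idele_snd_ne S a p) _ _
  change (𝓕 (dilSchwartz (idele_fst_ne S a) D.inf) : SchwartzMap ℝ ℂ) x.1 *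
    ∏ p : S, locF (ψ p) (fun y => D.fin p ((a : Adele S).2 p * y)) (x.2 p)
    = _ * ((𝓕 D.inf : SchwartzMap ℝ ℂ) (((a⁻¹ : (Adele S)ˣ) : Adele S).1 * x.1) *
      ∏ p : S, locF (ψ p) (D.fin p) (((a⁻¹ : (Adele S)ˣ) : Adele S).2 p * x.2 p))
  rw [fourier_dilSchwartz, inv_idele_fst]
  simp only [h1, inv_idele_snd, Finset.prod_mul_distrib]
  rw [modA, mul_inv, Complex.ofReal_mul, ← Finset.prod_inv_distrib, Complex.ofReal_prod]
  ring

theorem hat_hat_fn (D : SBData S) (x : Adele S) : ((D.hat hψ).hat hψ).fn x = D.fn (-x) := by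
  have h1 : ∀ p : S, locF (ψ p) (locF (ψ p) (D.fin p)) (x.2 p) = D.fin p (-x.2 p) :=
    fun p => (hψ p).locF_locF (D.isSB p) _
  have h2 : (𝓕 (𝓕 D.inf) : SchwartzMap ℝ ℂ) x.1 = D.inf (-x.1) := by
    have h3 : (𝓕⁻ (𝓕 D.inf) : SchwartzMap ℝ ℂ) = D.inf := FourierTransform.fourierInv_fourier_eq _
    have h4 : (𝓕⁻ (𝓕 D.inf) : SchwartzMap ℝ ℂ) (-x.1) = D.inf (-x.1) := by rw [h3]
    rw [← h4, SchwartzMap.fourier_coe, SchwartzMap.fourierInv_coe, Real.fourierInv_eq_fourier_neg,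
      neg_neg]
  change (𝓕 (𝓕 D.inf) : SchwartzMap ℝ ℂ) x.1 * ∏ p : S, locF (ψ p) (locF (ψ p) (D.fin p)) (x.2 p) = _
  simp only [h1, h2]
  rfl

theorem plancherel (D E : SBData S) :
    ∫ x, conj ((D.hat hψ).fn x) * (E.hat hψ).fn x ∂haarA S = ∫ x, conj (D.fn x) * E.fn x ∂haarA S := by
  have key : ∀ D E : SBData S, ∫ x, conj (D.fn x) * E.fn x ∂haarA S
      = (∫ t, conj (D.inf t) * E.inf t) *
        ∏ p : S, ∫ y, conj (D.fin p y) * E.fin p y ∂haarP (p : Nat.Primes) := fun D E => by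
    rw [← integral_tensor]
    congr 1
    ext x
    rw [fn_apply, fn_apply, tensor, map_mul, map_prod, Finset.prod_mul_distrib]
    ring
  rw [key, key]
  congr 1
  · have h := SchwartzMap.integral_inner_fourier_fourier D.inf E.inf
    simp only [RCLike.inner_apply] at h
    simp only [mul_comm (conj _)]
    exact h
  · exact Finset.prod_congr rfl fun p _ => (hψ p).plancherel (D.isSB p) (E.isSB p)

/-- The Fourier transform preserves the Gram matrix of the classes, by the local Plancherel formulas
and the product formula. -/
theorem inner_hat (D E : SBData S) :
    inner ℂ D.toL2 E.toL2 = inner ℂ (D.hat hψ).toL2 (E.hat hψ).toL2 := by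
  rw [toL2, toL2, toL2, toL2, inner_cls_cls, inner_cls_cls]
  congr 1
  -- `∑_g ⟨D(g x), E(x)⟩`: the Fourier transform of `D(g x)` is the transform of `D` at `g⁻¹ x`
  rw [← (Equiv.inv (Gam S)).tsum_eq]
  refine tsum_congr fun g => ?_
  have h1 : ∀ x, D.fn ((Equiv.inv (Gam S)) g • x) = (D.mul (principal S g)⁻¹).fn x := fun x => by
    rw [mul_fn, ← map_inv, principal_mul]; rfl
  have h2 : ∀ x, (D.hat hψ).fn (g • x) = ((D.mul (principal S g)⁻¹).hat hψ).fn x := fun x => by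
    rw [hat_mul_fn, inv_inv, principal_mul, ← map_inv, modA_principal, inv_one, Complex.ofReal_one,
      one_mul]
  simp only [h1, h2]
  exact (plancherel hψ _ _).symm

/-- The square of the Fourier transform is `x ↦ -x`, which is trivial on classes since `-1 ∈ Γ`. -/
theorem hat_hat_toL2 (D : SBData S) : ((D.hat hψ).hat hψ).toL2 = D.toL2 := by
  refine toL2_eq ?_
  filter_upwards [D.isClassOf_toL2] with x hx
  rw [← (Equiv.mulLeft (negGam S)).hasSum_iff] at hx
  refine Eq.mp (congrArg (fun F => HasSum F _) (funext fun g => ?_)) hx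
  rw [hat_hat_fn, ← negGam_smul, ← mul_smul]
  rfl

end SBData
end Hat

section Density

variable {S : Finset Nat.Primes}

/-- The compact open subsets of a space. -/
abbrev compactOpens (α : Type*) [TopologicalSpace α] : Set (Set α) := {s | IsCompact s ∧ IsOpen s}

theorem isPiSystem_compactOpens (α : Type*) [TopologicalSpace α] [T2Space α] :
    IsPiSystem (compactOpens α) :=
  fun _ hs _ ht _ => ⟨hs.1.inter ht.1, hs.2.inter ht.2⟩

variable {p : ℕ} [Fact p.Prime]

theorem closedBall_mem_compactOpens (x : ℚ_[p]) {r : ℝ} (hr : r ≠ 0) :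
    Metric.closedBall x r ∈ compactOpens ℚ_[p] :=
  ⟨isCompact_closedBall x r, IsUltrametricDist.isOpen_closedBall x hr⟩

theorem generateFrom_compactOpens :
    MeasurableSpace.generateFrom (compactOpens ℚ_[p]) = padicMeasurableSpace p := by
  have h : TopologicalSpace.IsTopologicalBasis (compactOpens ℚ_[p]) := by
    refine TopologicalSpace.isTopologicalBasis_of_isOpen_of_nhds (fun s hs => hs.2) fun x u hx hu => ?_
    obtain ⟨r, hr, hru⟩ := Metric.nhds_basis_closedBall.mem_iff.1 (hu.mem_nhds hx)
    exact ⟨_, closedBall_mem_compactOpens x hr.ne', Metric.mem_closedBall_self hr.le, hru⟩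
  exact h.borel_eq_generateFrom.symm

theorem isCountablySpanning_compactOpens : IsCountablySpanning (compactOpens ℚ_[p]) := by
  refine ⟨fun n : ℕ => Metric.closedBall 0 (n + 1), fun n => closedBall_mem_compactOpens 0 (by positivity), ?_⟩
  rw [Set.eq_univ_iff_forall]
  intro x
  obtain ⟨n, hn⟩ := exists_nat_ge ‖x‖
  exact Set.mem_iUnion.2 ⟨n, by rw [mem_closedBall_zero_iff]; linarith⟩

theorem isSB_indicator {s : Set ℚ_[p]} (hs : s ∈ compactOpens ℚ_[p]) :
    IsSB (s.indicator (1 : ℚ_[p] → ℂ)) := by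
  refine ⟨(IsLocallyConstant.iff_eventually_eq _).2 fun x => ?_, ?_⟩
  · by_cases hx : x ∈ s
    · filter_upwards [hs.2.mem_nhds hx] with y hy
      rw [Set.indicator_of_mem hy, Set.indicator_of_mem hx]; rfl
    · filter_upwards [hs.1.isClosed.isOpen_compl.mem_nhds hx] with y hy
      rw [Set.indicator_of_notMem hy, Set.indicator_of_notMem hx]
  · exact HasCompactSupport.intro hs.1 fun x hx => Set.indicator_of_notMem hx _

theorem sphere_mem_compactOpens : Metric.sphere (0 : ℚ_[p]) 1 ∈ compactOpens ℚ_[p] :=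
  ⟨isCompact_sphere 0 1, IsUltrametricDist.isOpen_sphere 0 one_ne_zero⟩

variable (S) in
/-- The compact open boxes in the product of the `ℚ_p`. -/
def boxes : Set (Set ((p : S) → ℚ_[(p : Nat.Primes)])) :=
  Set.univ.pi '' Set.univ.pi fun p : S => compactOpens ℚ_[(p : Nat.Primes)]

theorem unitsFin_mem_boxes : unitsFin S ∈ boxes S := by
  refine ⟨fun p => Metric.sphere 0 1, fun p _ => sphere_mem_compactOpens, ?_⟩
  ext y
  simp [unitsFin, Set.mem_pi]

theorem isPiSystem_boxes : IsPiSystem (boxes S) :=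
  IsPiSystem.pi fun _ => isPiSystem_compactOpens _

theorem generateFrom_boxes : MeasurableSpace.generateFrom (boxes S) = MeasurableSpace.pi :=
  generateFrom_eq_pi (fun _ => generateFrom_compactOpens) fun _ => isCountablySpanning_compactOpens

/-- A function on `ℝ × R_S^*` whose integrals over the products of measurable sets with compact open
boxes vanish is zero. -/
theorem ae_eq_zero_of_boxes {w : Adele S → ℂ}
    (hw : Integrable w ((volume : Measure ℝ).prod ((haarFin S).restrict (unitsFin S))))
    (h : ∀ I, MeasurableSet I → ∀ B ∈ boxes S,
      ∫ x in I ×ˢ B, w x ∂((volume : Measure ℝ).prod ((haarFin S).restrict (unitsFin S))) = 0) :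
    w =ᵐ[(volume : Measure ℝ).prod ((haarFin S).restrict (unitsFin S))] 0 := by
  have hr : ((volume : Measure ℝ).prod ((haarFin S).restrict (unitsFin S))).restrict
      (Set.univ ×ˢ unitsFin S) = (volume : Measure ℝ).prod ((haarFin S).restrict (unitsFin S)) := by
    rw [← Measure.prod_restrict, Measure.restrict_univ, Measure.restrict_restrict
        (measurableSet_unitsFin S), Set.inter_self]
  generalize hρ : (volume : Measure ℝ).prod ((haarFin S).restrict (unitsFin S)) = ρ at *
  have huniv : ∫ x, w x ∂ρ = 0 := by
    rw [← h Set.univ MeasurableSet.univ _ unitsFin_mem_boxes, hr]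
  have hgen : (inferInstance : MeasurableSpace (Adele S)) = MeasurableSpace.generateFrom
      (Set.image2 (· ×ˢ ·) {I : Set ℝ | MeasurableSet I} (boxes S)) := by
    refine (generateFrom_eq_prod (MeasurableSpace.generateFrom_measurableSet) generateFrom_boxes
      isCountablySpanning_measurableSet ?_).symm
    exact IsCountablySpanning.pi fun _ => isCountablySpanning_compactOpens
  have hpi : IsPiSystem (Set.image2 (· ×ˢ ·) {I : Set ℝ | MeasurableSet I} (boxes S)) :=
    MeasurableSpace.isPiSystem_measurableSet.prod isPiSystem_boxes
  have key : ∀ s, MeasurableSet s → ∫ x in s, w x ∂ρ = 0 := by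
    intro s hs
    induction s, hs using MeasurableSpace.induction_on_inter hgen hpi with
    | empty => simp
    | basic t ht =>
      obtain ⟨I, hI, B, hB, rfl⟩ := ht
      exact h I hI B hB
    | compl t ht ih => rw [setIntegral_compl ht hw, huniv, ih, sub_zero]
    | iUnion f hd hf ih =>
      rw [integral_iUnion hf hd hw.integrableOn]
      simp only [ih, tsum_zero]
  exact hw.ae_eq_zero_of_forall_setIntegral_eq_zero fun s hs _ => key s hs

/-- The tensor product of a test function on `ℝ` and of the characteristic function of a compact open
box. -/
def boxData {g : ℝ → ℝ} (hg : ContDiff ℝ ∞ g) (hs : HasCompactSupport g)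
    {b : (p : S) → Set ℚ_[(p : Nat.Primes)]} (hb : ∀ p : S, b p ∈ compactOpens ℚ_[(p : Nat.Primes)]) :
    SBData S where
  inf := (hs.comp_left (g := Complex.ofReal) Complex.ofReal_zero).toSchwartzMap
    (Complex.ofRealCLM.contDiff.comp hg)
  fin p := (b p).indicator 1
  isSB p := isSB_indicator (hb p)

theorem boxData_fn {g : ℝ → ℝ} (hg : ContDiff ℝ ∞ g) (hs : HasCompactSupport g)
    {b : (p : S) → Set ℚ_[(p : Nat.Primes)]} (hb : ∀ p : S, b p ∈ compactOpens ℚ_[(p : Nat.Primes)])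
    (x : Adele S) :
    (boxData hg hs hb).fn x = (g x.1 : ℂ) * (Set.univ.pi b).indicator 1 x.2 := by
  rw [SBData.fn_apply]
  change (g x.1 : ℂ) * ∏ p : S, (b p).indicator 1 (x.2 p) = _
  congr 1
  by_cases hx : x.2 ∈ Set.univ.pi b
  · rw [Set.indicator_of_mem hx]
    exact Finset.prod_eq_one fun p _ => Set.indicator_of_mem (hx p trivial) _
  · rw [Set.indicator_of_notMem hx]
    simp only [Set.mem_pi, Set.mem_univ, true_imp_iff, not_forall] at hx
    obtain ⟨p, hp⟩ := hx
    exact Finset.prod_eq_zero (Finset.mem_univ p) (Set.indicator_of_notMem hp _)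

open ComplexConjugate

/-- The classes of the pure tensors span a dense subspace of `L²(X_S)`. -/
theorem dense_toL2 :
    Dense (Submodule.span ℂ (Set.range (SBData.toL2 (S := S))) : Set (L2X S)) := by
  rw [Submodule.dense_iff_topologicalClosure_eq_top, Submodule.topologicalClosure_eq_top_iff,
    Submodule.eq_bot_iff]
  intro ξ hξ
  rw [Submodule.mem_orthogonal'] at hξ
  have hvol : (((vol S)⁻¹).toReal : ℂ) ≠ 0 := by
    have := ENNReal.toReal_ne_zero.2
      ⟨ENNReal.inv_ne_zero.2 (vol_ne_top S), ENNReal.inv_ne_top.2 (vol_ne_zero S)⟩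
    exact_mod_cast this
  set w : Adele S → ℂ := fun x => conj (ξ (proj S x)) with hw
  have h0 : ∀ D : SBData S, ∫ x, w x * D.fn x ∂haarA S = 0 := fun D => by
    have h1 := hξ _ (Submodule.subset_span (Set.mem_range_self D))
    rw [SBData.toL2, inner_cls] at h1
    exact (mul_eq_zero.1 h1).resolve_left hvol
  have hi : ∀ D : SBData S, Integrable (fun x => w x * D.fn x) (haarA S) :=
    fun D => integrable_conj_mul ξ D.hasClass
  -- for a fixed box, the partial integrals of `w` vanish
  have h2 : ∀ {χ : ℝ → ℝ} (hχ : ContDiff ℝ ∞ χ) (hs : HasCompactSupport χ)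
      {b : (p : S) → Set ℚ_[(p : Nat.Primes)]} (hb : ∀ p : S, b p ∈ compactOpens ℚ_[(p : Nat.Primes)]),
      ∀ᵐ t : ℝ, ∫ y, w (t, y) * (boxData hχ hs hb).fn (t, y) ∂haarFin S = 0 := by
    intro χ hχ hs b hb
    have h3 := hi (boxData hχ hs hb)
    rw [haarA_eq] at h3
    refine ae_eq_zero_of_integral_contDiff_smul_eq_zero h3.integral_prod_left.locallyIntegrable
      fun g hg hgs => ?_
    have h4 := hi (boxData (hg.mul hχ) hgs.mul_right hb)
    have h5 := h0 (boxData (hg.mul hχ) hgs.mul_right hb)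
    rw [haarA_eq] at h4 h5
    rw [integral_prod _ h4] at h5
    rw [← h5]
    refine integral_congr_ae (Eventually.of_forall fun t => ?_)
    change g t • ∫ y, w (t, y) * (boxData hχ hs hb).fn (t, y) ∂haarFin S = _
    rw [← integral_smul]
    refine integral_congr_ae (Eventually.of_forall fun y => ?_)
    change g t • (w (t, y) * (boxData hχ hs hb).fn (t, y)) = w (t, y) * _
    rw [boxData_fn, boxData_fn, Complex.real_smul]
    push_cast
    ring
  have hsph : ∀ p : S, Metric.sphere 0 1 ∈ compactOpens ℚ_[(p : Nat.Primes)] :=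
    fun p => sphere_mem_compactOpens
  have hunits : unitsFin S = Set.univ.pi fun p : S => Metric.sphere (0 : ℚ_[(p : Nat.Primes)]) 1 := by
    ext y; simp [unitsFin, Set.mem_pi]
  have hρ : (volume : Measure ℝ).prod ((haarFin S).restrict (unitsFin S))
      = (haarA S).restrict (Set.univ ×ˢ unitsFin S) := by
    rw [haarA_eq, ← Measure.prod_restrict, Measure.restrict_univ]
  have hmu : MeasurableSet ((Set.univ : Set ℝ) ×ˢ unitsFin S) :=
    MeasurableSet.univ.prod (measurableSet_unitsFin S)
  have h3 : ∀ {χ : ℝ → ℝ} (hχ : ContDiff ℝ ∞ χ) (hs : HasCompactSupport χ),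
      ∀ᵐ x ∂(haarA S).restrict (Set.univ ×ˢ unitsFin S), w x * χ x.1 = 0 := by
    intro χ hχ hs
    rw [← hρ]
    refine ae_eq_zero_of_boxes (w := fun x => w x * χ x.1) ?_ fun I hI B hB => ?_
    · rw [hρ]
      refine (hi (boxData hχ hs hsph)).restrict.congr ?_
      filter_upwards [ae_restrict_mem hmu] with x hx
      rw [boxData_fn, Set.indicator_of_mem (hunits ▸ hx.2), Pi.one_apply, mul_one]
    · obtain ⟨b, hb, rfl⟩ := hB
      have hb' : ∀ p : S, b p ∩ Metric.sphere 0 1 ∈ compactOpens ℚ_[(p : Nat.Primes)] := fun p =>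
        ⟨(hb p trivial).1.inter (hsph p).1, (hb p trivial).2.inter (hsph p).2⟩
      have hbm : MeasurableSet (Set.univ.pi b) := MeasurableSet.univ_pi fun p => (hb p trivial).2.measurableSet
      have h4 : Set.univ.pi (fun p => b p ∩ Metric.sphere 0 1) = Set.univ.pi b ∩ unitsFin S := by
        rw [Set.pi_inter_distrib, hunits]
      have h5 := h2 hχ hs hb'
      have h6 := hi (boxData hχ hs hb')
      have hBm := hbm.inter (measurableSet_unitsFin S)
      rw [hρ, Measure.restrict_restrict (hI.prod hbm), Set.prod_inter_prod, Set.inter_univ]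
      have h7 : ∫ x in I ×ˢ (Set.univ.pi b ∩ unitsFin S), w x * χ x.1 ∂haarA S
          = ∫ x in I ×ˢ Set.univ, w x * (boxData hχ hs hb').fn x ∂haarA S := by
        refine Eq.trans (setIntegral_congr_fun (hI.prod hBm) fun x hx => ?_)
          (setIntegral_eq_of_subset_of_forall_sdiff_eq_zero (hI.prod MeasurableSet.univ)
            (Set.prod_mono_right (Set.subset_univ (Set.univ.pi b ∩ unitsFin S))) ?_).symm
        · have := hx.2
          rw [← h4] at this
          simp only [boxData_fn, Set.indicator_of_mem this, Pi.one_apply, mul_one]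
        · intro x hx
          have : x.2 ∉ Set.univ.pi fun p => b p ∩ Metric.sphere 0 1 := by
            rw [h4]; exact fun h => hx.2 ⟨hx.1.1, h⟩
          simp only [boxData_fn, Set.indicator_of_notMem this, mul_zero]
      rw [h7]
      rw [haarA_eq] at h6 ⊢
      rw [setIntegral_prod _ h6.integrableOn, Measure.restrict_univ]
      exact integral_eq_zero_of_ae (ae_restrict_of_ae h5)
  -- a smooth function equal to one on `[-N, N]`
  let χ : ∀ N : ℕ, ContDiffBump (0 : ℝ) := fun N => ⟨N + 1, N + 2, by positivity, by linarith⟩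
  have h4 : ∀ᵐ x ∂(haarA S).restrict (Set.univ ×ˢ unitsFin S), ∀ N : ℕ, w x * (χ N) x.1 = 0 :=
    ae_all_iff.2 fun N => h3 (χ N).contDiff (χ N).hasCompactSupport
  rw [Lp.eq_zero_iff_ae_eq_zero]
  refine ae_of_ae_proj S (measurableSet_eq_fun (Lp.stronglyMeasurable ξ).measurable
    measurable_const) ?_
  have hsub : fundDomain S ⊆ Set.univ ×ˢ unitsFin S := fun x hx => ⟨trivial, hx.2⟩
  filter_upwards [ae_restrict_of_ae_restrict_of_subset hsub h4] with x hx
  obtain ⟨N, hN⟩ := exists_nat_ge |x.1|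
  have h5 := hx N
  rw [(χ N).one_of_mem_closedBall, Complex.ofReal_one, mul_one] at h5
  · exact (map_eq_zero _).1 h5
  · rw [mem_closedBall_zero_iff, Real.norm_eq_abs]
    change |x.1| ≤ N + 1
    linarith

end Density

/-! ### The Fourier transform of `L²(X_S)` -/

section SemilocalFourier

variable {S : Finset Nat.Primes} {ψ : (p : S) → AddChar ℚ_[(p : Nat.Primes)] Circle}
  (hψ : ∀ p : S, IsNormalizedChar (p : Nat.Primes) (ψ p))

/-- The isometry of `L²(X_S)` induced by the Fourier transform of the pure tensors. -/
def fourierIsom : L2X S →ₗᵢ[ℂ] L2X S := (exists_isometry_of_gram dense_toL2 (SBData.inner_hat hψ)).choose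

theorem fourierIsom_toL2 (D : SBData S) : fourierIsom hψ D.toL2 = (D.hat hψ).toL2 :=
  (exists_isometry_of_gram dense_toL2 (SBData.inner_hat hψ)).choose_spec D

/-- The isometry is an involution, hence onto. -/
theorem fourierIsom_fourierIsom (ξ : L2X S) : fourierIsom hψ (fourierIsom hψ ξ) = ξ := by
  have h : (fourierIsom hψ).toContinuousLinearMap ∘L (fourierIsom hψ).toContinuousLinearMap
      = ContinuousLinearMap.id ℂ (L2X S) := by
    refine ext_of_dense_span dense_toL2 fun D => ?_
    change fourierIsom hψ (fourierIsom hψ D.toL2) = D.toL2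
    rw [fourierIsom_toL2, fourierIsom_toL2, SBData.hat_hat_toL2]
  exact congrArg (fun T : L2X S →L[ℂ] L2X S => T ξ) h

/-- The Fourier transform of `L²(X_S)`. -/
def FS : L2X S ≃ₗᵢ[ℂ] L2X S :=
  LinearIsometryEquiv.ofSurjective (fourierIsom hψ) fun ξ => ⟨_, fourierIsom_fourierIsom hψ ξ⟩

theorem FS_toL2 (D : SBData S) : FS hψ D.toL2 = (D.hat hψ).toL2 := fourierIsom_toL2 hψ D

theorem FS_FS (ξ : L2X S) : FS hψ (FS hψ ξ) = ξ := fourierIsom_fourierIsom hψ ξ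

theorem isSemilocalFourier_FS :
    IsSemilocalFourier S ψ ((FS hψ).toContinuousLinearEquiv : L2X S →L[ℂ] L2X S) :=
  fun φinf φ hφ =>
    let D : SBData S := ⟨φinf, φ, hφ⟩
    ⟨D.toL2, (D.hat hψ).toL2, D.isClassOf_toL2, (D.hat hψ).isClassOf_toL2, FS_toL2 hψ D⟩

/-- An operator which has the right values on the classes of pure tensors is determined by density. -/
theorem IsSemilocalFourier.eq_FS {G : L2X S →L[ℂ] L2X S} (hG : IsSemilocalFourier S ψ G) (ξ : L2X S) :
    G ξ = FS hψ ξ := by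
  have h : G = ((FS hψ).toContinuousLinearEquiv : L2X S →L[ℂ] L2X S) := by
    refine ext_of_dense_span dense_toL2 fun D => ?_
    obtain ⟨ξ, ζ, h1, h2, h3⟩ := hG D.inf D.fin D.isSB
    change G D.toL2 = FS hψ D.toL2
    rw [FS_toL2, SBData.toL2_eq h1, h3]
    exact (SBData.toL2_eq (D := D.hat hψ) h2).symm
  exact congrArg (fun T : L2X S →L[ℂ] L2X S => T ξ) h

theorem modA_inv (a : (Adele S)ˣ) : modA S ((a⁻¹ : (Adele S)ˣ) : Adele S) = (modA S a)⁻¹ := by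
  refine eq_inv_of_mul_eq_one_left ?_
  rw [← modA_mul, Units.inv_mul, modA_one]

/-- The Fourier transform exchanges the action of an idele class and that of its inverse. -/
theorem FS_theta (c : CS S) (ξ : L2X S) : FS hψ (theta S c ξ) = theta S c⁻¹ (FS hψ ξ) := by
  induction c using QuotientGroup.induction_on with
  | H a =>
  have h : ((FS hψ).toContinuousLinearEquiv : L2X S →L[ℂ] L2X S) ∘L
        (theta S (QuotientGroup.mk a)).toContinuousLinearMap
      = (theta S (QuotientGroup.mk a⁻¹)).toContinuousLinearMap ∘L
        ((FS hψ).toContinuousLinearEquiv : L2X S →L[ℂ] L2X S) := by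
    refine ext_of_dense_span dense_toL2 fun D => ?_
    change FS hψ (theta S (QuotientGroup.mk a) D.toL2)
      = theta S (QuotientGroup.mk a⁻¹) (FS hψ D.toL2)
    have h1 : ((D.mul a).hat hψ).toL2
        = (((modA S a)⁻¹ : ℝ) : ℂ) • ((D.hat hψ).mul a⁻¹).toL2 := by
      refine SBData.toL2_eq ?_
      filter_upwards [((D.hat hψ).mul a⁻¹).isClassOf_toL2, ae_proj S (Lp.coeFn_smul
        (((modA S a)⁻¹ : ℝ) : ℂ) ((D.hat hψ).mul a⁻¹).toL2)] with x h1 h2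
      rw [h2, Pi.smul_apply, smul_eq_mul]
      refine Eq.mp (congrArg (fun F => HasSum F _) (funext fun g => ?_))
        (h1.mul_left (((modA S a)⁻¹ : ℝ) : ℂ))
      rw [SBData.hat_mul_fn, SBData.mul_fn]
    rw [SBData.theta_toL2, map_smul, FS_toL2, FS_toL2, SBData.theta_toL2, h1, smul_smul, modA_inv]
    congr 1
    have hpos := modA_pos S a
    rw [← Complex.ofReal_mul]
    congr 1
    rw [Real.inv_rpow hpos.le, ← Real.rpow_neg hpos.le, ← Real.rpow_neg_one, ← Real.rpow_add hpos]
    norm_num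
  exact congrArg (fun T : L2X S →L[ℂ] L2X S => T ξ) h

/-- The Fourier transform preserves the `K_S`-invariant vectors, `K_S` being stable under inversion. -/
theorem FS_mem {ξ : L2X S} (hξ : ξ ∈ HS S) : FS hψ ξ ∈ HS S := by
  rw [mem_HS] at hξ ⊢
  intro k hk
  have h : theta S k⁻¹⁻¹ (FS hψ ξ) = FS hψ ξ :=
    (FS_theta hψ k⁻¹ ξ).symm.trans (congrArg (FS hψ) (hξ _ (inv_mem hk)))
  exact (congrArg (fun c => theta S c (FS hψ ξ)) (inv_inv k).symm).trans h

/-- The restriction of the Fourier transform to `L²(X_S)^{K_S}`. -/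
def gradingFS : HS S →L[ℂ] HS S :=
  (((FS hψ).toContinuousLinearEquiv : L2X S →L[ℂ] L2X S) ∘L (HS S).subtypeL).codRestrict (HS S)
    fun ξ => FS_mem hψ ξ.2

theorem coe_gradingFS (ξ : HS S) : (gradingFS hψ ξ : L2X S) = FS hψ (ξ : L2X S) := rfl

theorem scaleClass_neg (t : ℝ) : scaleClass S (-t) = (scaleClass S t)⁻¹ := by
  refine eq_inv_of_mul_eq_one_left ?_
  rw [scaleClass, scaleClass, ← QuotientGroup.mk_mul, ← map_mul]
  refine (congrArg (fun a => (QuotientGroup.mk (MulEquiv.prodUnits.symm a) : CS S))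
    (Prod.ext (Units.ext ?_) (one_mul 1))).trans
      ((congrArg QuotientGroup.mk (map_one MulEquiv.prodUnits.symm)).trans (QuotientGroup.mk_one _))
  change Real.exp (-t) * Real.exp t = 1
  rw [← Real.exp_add, neg_add_cancel, Real.exp_zero]

/-- The Fourier transform reverses the scaling group. -/
theorem isGeneratorValue_gradingFS {ξ ζ : HS S} (h : IsGeneratorValue S ξ ζ) :
    IsGeneratorValue S (gradingFS hψ ξ) (-gradingFS hψ ζ) := by
  have hneg : Tendsto (fun t : ℝ => -t) (𝓝[≠] 0) (𝓝[≠] 0) := by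
    refine tendsto_nhdsWithin_iff.2 ⟨?_, ?_⟩
    · exact (continuous_neg.tendsto' (0 : ℝ) 0 neg_zero).mono_left nhdsWithin_le_nhds
    · filter_upwards [self_mem_nhdsWithin] with t ht using neg_ne_zero.2 ht
  have h1 := (((FS hψ).continuous.tendsto _).comp (h.comp hneg)).neg
  refine (h1.congr fun t => ?_).trans_eq ?_
  · have h2 := FS_theta hψ (scaleClass S (-t)) (ξ : L2X S)
    rw [← scaleClass_neg, neg_neg] at h2
    simp only [Function.comp_apply]
    rw [map_smul, map_sub, h2, coe_gradingFS, ← neg_smul]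
    push_cast
    rw [inv_neg, neg_neg]
  · rw [map_smul, Submodule.coe_neg, coe_gradingFS, smul_neg]

end SemilocalFourier

/-! ### The Fourier transform on the image of `η_S` -/

section EvenPart

/-- The operator `f ↦ f(-x)` on `L²(ℝ)`. -/
def negLp : Lp ℂ 2 (volume : Measure ℝ) →L[ℂ] Lp ℂ 2 (volume : Measure ℝ) :=
  (Lp.compMeasurePreservingₗᵢ ℂ (fun x : ℝ => -x)
    (Measure.measurePreserving_neg volume)).toContinuousLinearMap

theorem mem_L2even {f : Lp ℂ 2 (volume : Measure ℝ)} : f ∈ L2even ↔ negLp f = f := Iff.rfl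

theorem coeFn_negLp (f : Lp ℂ 2 (volume : Measure ℝ)) : negLp f =ᵐ[volume] fun x => f (-x) :=
  Lp.coeFn_compMeasurePreserving f (Measure.measurePreserving_neg volume)

theorem negLp_negLp (f : Lp ℂ 2 (volume : Measure ℝ)) : negLp (negLp f) = f := by
  rw [Lp.ext_iff]
  filter_upwards [coeFn_negLp (negLp f), (Measure.measurePreserving_neg
    (volume : Measure ℝ)).quasiMeasurePreserving.ae (coeFn_negLp f)] with x h1 h2
  rw [h1, h2, neg_neg]

/-- Twice the even part of an element of `L²(ℝ)`. -/
def evenPart : Lp ℂ 2 (volume : Measure ℝ) →L[ℂ] L2even :=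
  (ContinuousLinearMap.id ℂ _ + negLp).codRestrict L2even fun f => by
    rw [mem_L2even]
    change negLp (f + negLp f) = f + negLp f
    rw [map_add, negLp_negLp, add_comm]

theorem coe_evenPart (f : Lp ℂ 2 (volume : Measure ℝ)) :
    (evenPart f : Lp ℂ 2 (volume : Measure ℝ)) = f + negLp f := rfl

theorem evenPart_coe (f : L2even) : evenPart (f : Lp ℂ 2 (volume : Measure ℝ)) = (2 : ℂ) • f := by
  refine Subtype.ext ?_
  rw [coe_evenPart, mem_L2even.1 f.2, Submodule.coe_smul, two_smul]

theorem denseRange_schwartz_toLp :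
    DenseRange fun φ : SchwartzMap ℝ ℂ => φ.toLp 2 (volume : Measure ℝ) :=
  SchwartzMap.denseRange_toLpCLM (F := ℂ) (E := ℝ) (p := 2) (by simp)

theorem coeFn_evenPart_toLp (φ : SchwartzMap ℝ ℂ) :
    (evenPart (φ.toLp 2 volume) : Lp ℂ 2 (volume : Measure ℝ)) =ᵐ[volume]
      fun x => φ x + φ (-x) := by
  have h := φ.coeFn_toLp 2 volume
  rw [coe_evenPart]
  filter_upwards [Lp.coeFn_add (φ.toLp 2 volume) (negLp (φ.toLp 2 volume)),
    coeFn_negLp (φ.toLp 2 volume), h, (Measure.measurePreserving_neg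
    (volume : Measure ℝ)).quasiMeasurePreserving.ae h] with x h1 h2 h3 h4
  rw [h1, Pi.add_apply, h2, h3, h4]

/-- The Fourier transform of `L²(ℝ)` commutes with `x ↦ -x`. -/
theorem fourier_negLp (f : Lp ℂ 2 (volume : Measure ℝ)) : 𝓕 (negLp f) = negLp (𝓕 f) := by
  have hF : Continuous fun f : Lp ℂ 2 (volume : Measure ℝ) => 𝓕 f :=
    (Lp.fourierTransformₗᵢ ℝ ℂ).continuous
  refine congrFun (denseRange_schwartz_toLp.equalizer (g := fun f => 𝓕 (negLp f))
    (h := fun f => negLp (𝓕 f)) (hF.comp negLp.continuous) (negLp.continuous.comp hF)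
    (funext fun φ => ?_)) f
  have h : ∀ φ : SchwartzMap ℝ ℂ, negLp (φ.toLp 2 volume)
      = (dilSchwartz (neg_ne_zero.2 one_ne_zero) φ).toLp 2 volume := fun φ => by
    rw [Lp.ext_iff]
    filter_upwards [coeFn_negLp (φ.toLp 2 volume), (Measure.measurePreserving_neg
      (volume : Measure ℝ)).quasiMeasurePreserving.ae (φ.coeFn_toLp 2 volume),
      (dilSchwartz (neg_ne_zero.2 one_ne_zero) φ).coeFn_toLp 2 volume] with x h1 h2 h3
    rw [h1, h2, h3, dilSchwartz_apply, neg_one_mul]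
  change 𝓕 (negLp (φ.toLp 2 volume)) = negLp (𝓕 (φ.toLp 2 volume))
  rw [h, SchwartzMap.toLp_fourier_eq, SchwartzMap.toLp_fourier_eq, h]
  congr 1
  ext w
  rw [fourier_dilSchwartz, dilSchwartz_apply]
  norm_num

theorem fourier_mem_L2even (f : L2even) : 𝓕 (f : Lp ℂ 2 (volume : Measure ℝ)) ∈ L2even := by
  rw [mem_L2even, ← fourier_negLp, mem_L2even.1 f.2]

/-- The Gaussian `exp(-π x²)` is its own Fourier transform. -/
theorem fourier_xiInf :
    𝓕 ((xiInf : L2even) : Lp ℂ 2 (volume : Measure ℝ)) = (xiInf : Lp ℂ 2 (volume : Measure ℝ)) := by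
  set c : ℂ := ((2 ^ (1 / 4 : ℝ) : ℝ) : ℂ) with hc
  have h0 : ∀ x : ℝ, ((2 ^ (1 / 4 : ℝ) * Real.exp (-Real.pi * x ^ 2) : ℝ) : ℂ)
      = c • Complex.exp (-Real.pi * 1 * x ^ 2) := fun x => by
    rw [hc, smul_eq_mul]; push_cast; rw [mul_one]
  have h1 : ((xiInf : L2even) : Lp ℂ 2 (volume : Measure ℝ)) =ᵐ[volume]
      fun x : ℝ => c • Complex.exp (-Real.pi * 1 * x ^ 2) :=
    coeFn_xiInf.trans (Eventually.of_forall h0)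
  have hi : Integrable ((xiInf : L2even) : Lp ℂ 2 (volume : Measure ℝ)) volume := by
    refine Integrable.congr ?_ coeFn_xiInf.symm
    exact ((integrable_exp_neg_mul_sq Real.pi_pos).const_mul _).ofReal
  have h2 : 𝓕 (((xiInf : L2even) : Lp ℂ 2 (volume : Measure ℝ)) : ℝ → ℂ)
      = fun x : ℝ => c • Complex.exp (-Real.pi * 1 * x ^ 2) := by
    ext w
    have h3 := congrFun (fourier_gaussian_pi (b := 1) (by simp)) w
    rw [Real.fourier_eq] at h3 ⊢
    have h4 : c • Complex.exp (-Real.pi * 1 * w ^ 2)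
        = c • (1 / (1 : ℂ) ^ (1 / 2 : ℂ) * Complex.exp (-Real.pi / 1 * w ^ 2)) := by simp
    rw [h4, ← h3, ← integral_smul]
    refine integral_congr_ae ?_
    filter_upwards [h1] with x hx
    rw [hx, smul_comm]
  rw [Lp.ext_iff]
  refine (Lp_fourier_eq_integral _ hi).trans ?_
  rw [h2]
  exact h1.symm

end EvenPart

section Intertwining

variable {S : Finset Nat.Primes}

variable (S) in
/-- The pure tensor `φ ⊗ 1_{R_S}`. -/
def oneData (φ : SchwartzMap ℝ ℂ) : SBData S := ⟨φ, fun p => oneZp (p : Nat.Primes), fun _ => isSB_oneZp⟩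

theorem oneData_fn (φ : SchwartzMap ℝ ℂ) (x : Adele S) : (oneData S φ).fn x = oneTensor S φ x := by
  rw [SBData.fn_apply, oneTensor, mul_comm]
  congr 1
  change ∏ p : S, oneZp (p : Nat.Primes) (x.2 p) = _
  by_cases hx : ∀ p, ‖x.2 p‖ ≤ 1
  · rw [Set.indicator_of_mem (show x.2 ∈ {y : (p : S) → ℚ_[(p : Nat.Primes)] | ∀ p, ‖y p‖ ≤ 1} from hx)]
    exact Finset.prod_eq_one fun p _ => oneZp_of_le (hx p)
  · rw [Set.indicator_of_notMem (show x.2 ∉ {y : (p : S) → ℚ_[(p : Nat.Primes)] | ∀ p, ‖y p‖ ≤ 1} from hx)]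
    obtain ⟨p, hp⟩ := not_forall.1 hx
    exact Finset.prod_eq_zero (Finset.mem_univ p) (oneZp_of_not_le hp)

/-- The sum over `Γ` of `φ ⊗ 1_{R_S}` is the sum over `Γ_+` of its symmetrization. -/
theorem toL2_oneData (φ : SchwartzMap ℝ ℂ) :
    (oneData S φ).toL2 = (etaS S (evenPart (φ.toLp 2 volume)) : L2X S) := by
  refine SBData.toL2_eq ?_
  filter_upwards [(oneData S φ).isClassOf_toL2, isEta_etaS S (evenPart (φ.toLp 2 volume)),
    ae_gam_smul_fst (S := S) (coeFn_evenPart_toLp φ)] with x h1 h2 h3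
  have h4 := ((signEquiv S).hasSum_iff.2 h1).prod_fiberwise fun g =>
    hasSum_fintype fun b => ((fun g : Gam S => (oneData S φ).fn (g • x)) ∘ signEquiv S) (g, b)
  have h5 : ∀ g : {g : Gam S // 0 < ((g : ℚˣ) : ℚ)},
      ∑ b, ((fun g : Gam S => (oneData S φ).fn (g • x)) ∘ signEquiv S) (g, b)
      = oneTensor S (evenPart (φ.toLp 2 volume) : Lp ℂ 2 (volume : Measure ℝ)) ((g : Gam S) • x) := by
    intro g
    rw [Fintype.sum_bool]
    simp only [Function.comp_apply]
    rw [(signEquiv_smul g x).1, (signEquiv_smul g x).2, oneData_fn, oneData_fn, oneTensor, oneTensor,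
      oneTensor, h3, Prod.fst_neg, mul_add]
    congr 2
    simp only [Set.indicator, Set.mem_ofPred_eq, Prod.snd_neg, Pi.neg_apply, norm_neg, Pi.one_apply]
  have h6 : HasSum (fun g : {g : Gam S // 0 < ((g : ℚˣ) : ℚ)} =>
      oneTensor S (evenPart (φ.toLp 2 volume) : Lp ℂ 2 (volume : Measure ℝ)) ((g : Gam S) • x))
      ((oneData S φ).toL2 (proj S x)) :=
    Eq.mp (congrArg (fun F => HasSum F _) (funext h5)) h4
  rw [h2.unique h6]
  exact h1

variable {ψ : (p : S) → AddChar ℚ_[(p : Nat.Primes)] Circle}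
  (hψ : ∀ p : S, IsNormalizedChar (p : Nat.Primes) (ψ p))

theorem oneData_hat (φ : SchwartzMap ℝ ℂ) : (oneData S φ).hat hψ = oneData S (𝓕 φ) := by
  have h : (fun p : S => locF (ψ p) (oneZp (p : Nat.Primes))) = fun p : S => oneZp (p : Nat.Primes) :=
    funext fun p => (hψ p).fourier_one
  rw [SBData.hat, oneData, SBData.mk.injEq]
  exact ⟨rfl, h⟩

/-- Since `1_{ℤ_p}` is its own Fourier transform, `F_S` acts on `η_S(f)` through the archimedean
component. This is clear for the even parts of Schwartz functions, which are dense. -/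
theorem FS_etaS (f : L2even) : FS hψ (etaS S f : L2X S)
    = (etaS S ⟨𝓕 (f : Lp ℂ 2 (volume : Measure ℝ)), fourier_mem_L2even f⟩ : L2X S) := by
  have hF : Continuous fun f : Lp ℂ 2 (volume : Measure ℝ) => 𝓕 f :=
    (Lp.fourierTransformₗᵢ ℝ ℂ).continuous
  have hη : Continuous fun f : Lp ℂ 2 (volume : Measure ℝ) => (etaS S (evenPart f) : L2X S) :=
    continuous_subtype_val.comp ((etaS S).continuous.comp evenPart.continuous)
  have h1 : (fun f : Lp ℂ 2 (volume : Measure ℝ) => FS hψ (etaS S (evenPart f) : L2X S))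
      = fun f => (etaS S (evenPart (𝓕 f)) : L2X S) := by
    refine denseRange_schwartz_toLp.equalizer ((FS hψ).continuous.comp hη) (hη.comp hF)
      (funext fun φ => ?_)
    change FS hψ (etaS S (evenPart (φ.toLp 2 volume)) : L2X S)
      = (etaS S (evenPart (𝓕 (φ.toLp 2 volume))) : L2X S)
    rw [← toL2_oneData, FS_toL2, oneData_hat, SchwartzMap.toLp_fourier_eq, ← toL2_oneData]
  have h2 := congrFun h1 (f : Lp ℂ 2 (volume : Measure ℝ))
  have h3 := evenPart_coe ⟨𝓕 (f : Lp ℂ 2 (volume : Measure ℝ)), fourier_mem_L2even f⟩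
  simp only at h2 h3
  rw [h3, evenPart_coe, map_smul, map_smul, Submodule.coe_smul, Submodule.coe_smul, map_smul] at h2
  exact smul_right_injective _ (two_ne_zero (α := ℂ)) h2

/-- The restriction of `F_S` anticommutes with `𝕊` since `F_S` reverses the scaling group, and fixes
`ξ_S` since the Gaussian is its own Fourier transform. -/
theorem isGrading_gradingFS :
    IsGrading (scalingOp S) ((‖etaS S xiInf‖⁻¹ : ℂ) • etaS S xiInf) (gradingFS hψ) := by
  have h2 : ∀ ξ, gradingFS hψ (gradingFS hψ ξ) = ξ := fun ξ => Subtype.ext (FS_FS hψ ξ)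
  refine ⟨h2, isSelfAdjoint_of_involutive _ (fun ξ => (FS hψ).norm_map ξ) h2, fun ξ => ?_, ?_⟩
  · have h := isGeneratorValue_gradingFS hψ (isGeneratorValue_scalingOp S ξ)
    exact ⟨⟨_, h⟩, (isGeneratorValue_scalingOp S ⟨_, ⟨_, h⟩⟩).unique S h⟩
  · rw [map_smul]
    congr 1
    refine Subtype.ext ?_
    rw [coe_gradingFS, FS_etaS]
    congr 2
    exact Subtype.ext fourier_xiInf

/-- By uniqueness of the grading, the Fourier transform acts as the reflection in the canonical form. -/
theorem gradingFS_eq : gradingFS hψ = gradingS S :=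
  (isCyclicPair S).grading_unique (isGrading_gradingFS hψ) (isGrading_gradingS S)

end Intertwining

end Semilocal
end

theorem theorem1 (S : Finset Nat.Primes) :
    ∃ (Fmu : Lp ℂ 2 dstar ≃L[ℂ] Lp ℂ 2 (volume : Measure ℝ))
      (wInf : L2even →L[ℂ] Lp ℂ 2 dstar)
      (wS : HS S ≃ₗᵢ[ℂ] Lp ℂ 2 dstar)
      (η : L2even →L[ℂ] HS S)
      (V : HS S ≃L[ℂ] Lp ℂ 2 (mS S)),
      -- the maps are given by their defining formulas
      IsMultFourier Fmu ∧ IsWInf wInf ∧ IsWS S wS ∧ IsEta S η ∧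
      (∀ ξ : HS S, V ξ =ᵐ[mS S] fun s => (fullEuler S s)⁻¹ * Fmu (wS ξ) s) ∧
      -- the Mellin transform of the image of `f`
      (∀ f : L2even,
        Fmu (wS (η f)) =ᵐ[volume] fun s => finiteEuler S s * Fmu (wInf f) s) ∧
      -- the canonical form of the cyclic pair
      (∀ ξ : HS S, ‖V ξ‖ = Real.sqrt (2 * Real.pi) * ‖ξ‖) ∧
      V (η xiInf) =ᵐ[mS S] (fun _ => (((2 : ℝ) ^ (-(3 / 4) : ℝ) : ℝ) : ℂ)) ∧
      η xiInf ≠ 0 ∧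
      IsCyclicPair (scalingOp S) ((‖η xiInf‖⁻¹ : ℂ) • η xiInf) ∧
      (∃ U : HS S ≃ₗᵢ[ℂ] Lp ℂ 2 ((mS S Set.univ)⁻¹ • mS S),
        (∀ ξ : HS S, U ξ =ᵐ[mS S]
          fun s => (((2 : ℝ) ^ (3 / 4 : ℝ) * ‖η xiInf‖ : ℝ) : ℂ) * V ξ s) ∧
        IsCanonicalForm (scalingOp S) ((‖η xiInf‖⁻¹ : ℂ) • η xiInf)
          ((mS S Set.univ)⁻¹ • mS S) U) ∧
      -- evenness
      IsEven (scalingOp S) ((‖η xiInf‖⁻¹ : ℂ) • η xiInf) ∧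
      -- the Fourier transform on `L²(X_S)` and the grading
      ∀ ψ : (p : S) → AddChar ℚ_[(p : Nat.Primes)] Circle,
        (∀ p : S, IsNormalizedChar (p : Nat.Primes) (ψ p)) →
        ∃ FS : L2X S ≃ₗᵢ[ℂ] L2X S,
          IsSemilocalFourier S ψ (FS.toContinuousLinearEquiv : L2X S →L[ℂ] L2X S) ∧
          (∀ G : L2X S →L[ℂ] L2X S, IsSemilocalFourier S ψ G → ∀ ξ, G ξ = FS ξ) ∧
          (∀ f : L2even, ∃ h : 𝓕 (f : Lp ℂ 2 (volume : Measure ℝ)) ∈ L2even,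
            FS (η f : L2X S) = (η ⟨𝓕 (f : Lp ℂ 2 (volume : Measure ℝ)), h⟩ : L2X S)) ∧
          ∃ γ : HS S →L[ℂ] HS S,
            (∀ ξ : HS S, (γ ξ : L2X S) = FS (ξ : L2X S)) ∧
            IsGrading (scalingOp S) ((‖η xiInf‖⁻¹ : ℂ) • η xiInf) γ ∧
            (∀ γ' : HS S →L[ℂ] HS S,
              IsGrading (scalingOp S) ((‖η xiInf‖⁻¹ : ℂ) • η xiInf) γ' → γ' = γ) ∧
            ∀ ξ : HS S, V (γ ξ) =ᵐ[mS S] fun s => V ξ (-s) := by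
  refine ⟨Fmu, wInf, wS S, etaS S, VS S, isMultFourier_Fmu, isWInf_wInf, isWS_wS S, isEta_etaS S,
    VS_apply S, fun f => ?_, norm_VS S, VS_xi S, etaS_xi_ne_zero S, isCyclicPair S,
    ⟨US S, US_apply S, isCanonicalForm_US S⟩, ⟨gradingS S, isGrading_gradingS S⟩, fun ψ hψ =>
    ⟨FS hψ, isSemilocalFourier_FS hψ, fun G hG => hG.eq_FS hψ, fun f =>
      ⟨fourier_mem_L2even f, FS_etaS hψ f⟩, gradingFS hψ, coe_gradingFS hψ, isGrading_gradingFS hψ,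
      fun γ' hγ' => (isCyclicPair S).grading_unique hγ' (isGrading_gradingFS hψ), fun ξ => ?_⟩⟩
  · rw [wS_etaS]
    exact Fmu_sumOp S _
  · rw [gradingFS_eq]
    exact VS_gradingS S ξ
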